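/- **Setting.** Let $N$ be a smooth $3$-manifold and $R\in\mathbb R$ a constant (the scalar curvature of the ambient Einstein spacetime). The pulled-back Einstein structure equations on the null hypersurface $N$ are the following equations for smooth one-forms $\mathbf M$ (complex) and $\mathbf K$ (real) with $\mathbf M\wedge\bar{\mathbf M}\wedge\mathbf K\neq0$ everywhere, smooth connection one-forms $\Gamma_{41},\Gamma_{23}$ (complex), $\Gamma_{12}$ (imaginary), $\Gamma_{34}$ (real), and complex functions $\Psi_0,\dots,\Psi_3$ (the pulled-back Weyl scalars), where $\Gamma_{ab}=-\Gamma_{ba}$ and complex conjugation exchanges the indices $1$ and $2$: $$d\mathbf M=-\Gamma_{21}\wedge\mathbf M-\Gamma_{24}\wedge\mathbf K,\qquad 0=\Gamma_{41}\wedge\mathbf M+\Gamma_{42}\wedge\bar{\mathbf M},\qquad d\mathbf K=\Gamma_{31}\wedge\mathbf M+\Gamma_{32}\wedge\bar{\mathbf M}+\Gamma_{34}\wedge\mathbf K,$$ $$d\Gamma_{23}=(\Gamma_{12}+\Gamma_{34})\wedge\Gamma_{23}-\Psi_3\,\mathbf M\wedge\bar{\mathbf M}+\left(\Psi_2+\tfrac{R}{12}\right)\mathbf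 K\wedge\mathbf M,$$ $$d\Gamma_{14}=\Gamma_{14}\wedge(\Gamma_{12}+\Gamma_{34})+\Psi_1\,\mathbf M\wedge\bar{\mathbf M}-\Psi_0\,\mathbf K\wedge\mathbf M,$$ $$\tfrac12\left(d\Gamma_{12}+d\Gamma_{34}\right)=\Gamma_{23}\wedge\Gamma_{14}+\left(\Psi_2-\tfrac{R}{24}\right)\mathbf M\wedge\bar{\mathbf M}-\Psi_1\,\mathbf K\wedge\mathbf M.$$ Write $\Gamma_{41}=\sigma\mathbf M+\rho\bar{\mathbf M}+\kappa\mathbf K$. A gauge transformation with real parameters $\phi$ and $A>0$ and a complex parameter $z$ (smooth functions) acts by $$\mathbf M'=e^{i\phi}\mathbf M,\qquad \mathbf K'=A(\mathbf K+z\bar{\mathbf M}+\bar z\mathbf M),\qquad \Gamma_{41}'=A^{-1}e^{-i\phi}\Gamma_{41},$$ $$\Gamma_{23}'=Ae^{i\phi}\left(\Gamma_{23}+z(\Gamma_{12}+\Gamma_{34})-z^2\Gamma_{14}-dz\right),\qquad (\Gamma_{12}+\Gamma_{34})'=\Gamma_{12}+\Gamma_{34}+2z\Gamma_{41}+d\ln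 A+i\,d\phi,$$ $$\Psi_0'=A^{-2}e^{-2i\phi}\Psi_0,\quad \Psi_1'=A^{-1}e^{-i\phi}(\Psi_1-z\Psi_0),\quad \Psi_2'=\Psi_2-2z\Psi_1+z^2\Psi_0,\quad \Psi_3'=Ae^{i\phi}(\Psi_3-3z\Psi_2+3z^2\Psi_1-z^3\Psi_0).$$ The connection coefficients $\Gamma^a{}_{bc}$ are the components in the coframe $(\theta^1,\theta^2,\theta^4)=(\mathbf M,\bar{\mathbf M},\mathbf K)$ of $\Gamma^2{}_4=-\Gamma_{41}$, $\Gamma^2{}_2=\Gamma_{12}$, $\Gamma^4{}_4=\Gamma_{34}$, $\Gamma^4{}_2=-\Gamma_{23}$, that is, $\Gamma^a{}_b=\Gamma^a{}_{bc}\theta^c$; the remaining nonzero ones are their complex conjugates. **Proposition.** Consider a solution with $\sigma=0$ and $\rho\neq0$ everywhere. Then every point of $N$ has an open neighbourhood on which the solution is gauge equivalent to one for which there are smooth coordinates $(\rho,\zeta,\bar\zeta)$, with $\rho$ real and nonvanishing and $\zeta$ complex, smooth complex functions $x,q$ of $(\zeta,\bar\zeta)$ and a smooth real function $a$ of $(\zeta,\bar\zeta)$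 such that $$\mathbf M=\frac{d\zeta}{\rho},\qquad \mathbf K=-d\left(\frac1\rho\right)+\tfrac12\rho\,(x\,d\zeta+\bar x\,d\bar\zeta),$$ $$\Gamma^2{}_{41}=0,\quad\Gamma^2{}_{42}=-\rho,\quad\Gamma^2{}_{44}=0,\qquad \Gamma^2{}_{21}=-\tfrac12x\rho^3,\quad\Gamma^2{}_{22}=\tfrac12\bar x\rho^3,\quad\Gamma^2{}_{24}=0,$$ $$\Gamma^4{}_{41}=-\tfrac12x\rho^3,\quad\Gamma^4{}_{42}=-\tfrac12\bar x\rho^3,\quad\Gamma^4{}_{44}=0,$$ $$\Gamma^4{}_{21}=-\rho\left[-\tfrac16\rho^4|x|^2+\tfrac12\rho^2x_{,\bar\zeta}+\rho a-\frac{R}{24\rho^2}\right],\quad\Gamma^4{}_{22}=-\rho q,\quad\Gamma^4{}_{24}=0,$$ and $$\Psi_0=0,\qquad\Psi_1=x\rho^4,\qquad\Psi_2=a\rho^3-\tfrac23\rho^6x\bar x+\rho^4x_{,\bar\zeta},$$ $$\Psi_3=\tfrac13\rho^8x\bar x^2-\tfrac13\rho^6\left(2\bar xx_{,\bar\zeta}+\tfrac12x\bar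 x_{,\bar\zeta}\right)-\tfrac12\rho^5\bar xa+\rho^4\left(\tfrac12x_{,\bar\zeta\bar\zeta}-qx\right)+\rho^3a_{,\bar\zeta}-\rho^2q_{,\zeta}-\frac{R}{24}\rho^2\bar x.$$ Conversely, $x,q,a$ are arbitrary: for every open $V\subseteq\mathbb C$, all smooth $x,q:V\to\mathbb C$ and every smooth $a:V\to\mathbb R$, these formulas define on $\{(\rho,\zeta)\in\mathbb R\times\mathbb C:\rho\neq0,\ \zeta\in V\}$ a solution of the structure equations with $\Gamma_{41}=\rho\bar{\mathbf M}$ (so $\sigma=\kappa=0$). -/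

import Mathlib

open scoped Manifold ContDiff ComplexConjugate

noncomputable section

namespace NullHypersurface

/-! ### Complex-valued one-forms on a manifold modelled on a real normed space -/

section Forms

variable {E : Type*} [NormedAddCommGroup E] [NormedSpace ℝ E]
  {N : Type*} [TopologicalSpace N] [ChartedSpace E N]

variable (E N) in
/-- Complex-valued (i.e. real-linear on each tangent space) one-forms on `N`. -/
abbrev OneForm : Type _ := (p : N) → (TangentSpace 𝓘(ℝ, E) p →L[ℝ] ℂ)

/-- The complex conjugate of a one-form. -/
def OneForm.bar (η : OneForm E N) : OneForm E N :=
  fun p => (Complex.conjCLE : ℂ →L[ℝ] ℂ) ∘L η p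

/-- The expression of a one-form in the preferred chart at `p₀`: its pullback under the inverse of
the chart. It is meaningful on the target of the chart. -/
def OneForm.inChart (η : OneForm E N) (p₀ : N) : E → (E →L[ℝ] ℂ) :=
  fun y => η ((extChartAt 𝓘(ℝ, E) p₀).symm y) ∘L
    mfderiv 𝓘(ℝ, E) 𝓘(ℝ, E) (extChartAt 𝓘(ℝ, E) p₀).symm y

/-- A one-form is smooth on the open set `U` if all its expressions in charts are smooth. -/
def OneForm.SmoothOn (η : OneForm E N) (U : Set N) : Prop :=
  ∀ p₀ : N, ContDiffOn ℝ ∞ (η.inChart p₀)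
    ((extChartAt 𝓘(ℝ, E) p₀).target ∩ (extChartAt 𝓘(ℝ, E) p₀).symm ⁻¹' U)

/-- The exterior derivative of a one-form, as a function of two tangent vectors: at `p`, it is
the exterior derivative of the expression of the form in the chart at `p`, pulled back by the
chart. The normalization is `dη(X, Y) = X(η(Y)) - Y(η(X)) - η([X, Y])`. -/
def extd (η : OneForm E N) (p : N) (u v : TangentSpace 𝓘(ℝ, E) p) : ℂ :=
  extDeriv (fun y => ContinuousAlternatingMap.ofSubsingleton ℝ E ℂ (0 : Fin 1) (η.inChart p y))
    (extChartAt 𝓘(ℝ, E) p p)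
    ![mfderiv 𝓘(ℝ, E) 𝓘(ℝ, E) (extChartAt 𝓘(ℝ, E) p) p u,
      mfderiv 𝓘(ℝ, E) 𝓘(ℝ, E) (extChartAt 𝓘(ℝ, E) p) p v]

/-- The wedge product of two one-forms, `(α ∧ β)(u, v) = α(u) β(v) - α(v) β(u)`. -/
def wedge (α β : OneForm E N) (p : N) (u v : TangentSpace 𝓘(ℝ, E) p) : ℂ :=
  α p u * β p v - α p v * β p u

/-- The wedge product of three one-forms. -/
def wedge₃ (α β γ : OneForm E N) (p : N) (u v w : TangentSpace 𝓘(ℝ, E) p) : ℂ :=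
  Matrix.det !![α p u, α p v, α p w; β p u, β p v, β p w; γ p u, γ p v, γ p w]

/-- The differential of a complex-valued function. -/
def dC (f : N → ℂ) : OneForm E N := mvfderiv 𝓘(ℝ, E) f

/-- The differential of a real-valued function, seen as a complex-valued one-form. -/
def dR (f : N → ℝ) : OneForm E N := dC (fun p => (f p : ℂ))

/-- The one-form `c₁ M + c₂ M̄ + c₄ K`, i.e. the one-form with components `(c₁, c₂, c₄)` in the
coframe `(θ¹, θ², θ⁴) = (M, M̄, K)`. -/
def frameComb (M K : OneForm E N) (c₁ c₂ c₄ : N → ℂ) : OneForm E N :=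
  fun p => c₁ p • M p + c₂ p • M.bar p + c₄ p • K p

end Forms

/-! ### Wirtinger derivatives -/

/-- `f_{,ζ}` for a function `f` of `(ζ, ζ̄)`. -/
def dζ (f : ℂ → ℂ) (w : ℂ) : ℂ :=
  (1 / 2) * (fderiv ℝ f w 1 - Complex.I * fderiv ℝ f w Complex.I)

/-- `f_{,ζ̄}` for a function `f` of `(ζ, ζ̄)`. -/
def dζbar (f : ℂ → ℂ) (w : ℂ) : ℂ :=
  (1 / 2) * (fderiv ℝ f w 1 + Complex.I * fderiv ℝ f w Complex.I)

/-! ### The pulled-back structure equations -/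

section Structure

variable (E : Type*) [NormedAddCommGroup E] [NormedSpace ℝ E]
  (N : Type*) [TopologicalSpace N] [ChartedSpace E N]

/-- The unknowns of the structure equations on a null hypersurface: the coframe `(M, M̄, K)`, the
pulled-back connection one-forms `Γ₄₁`, `Γ₂₃`, `Γ₁₂`, `Γ₃₄` (the other ones are obtained by
antisymmetry and complex conjugation) and the pulled-back Weyl scalars. -/
structure Data where
  M : OneForm E N
  K : OneForm E N
  Γ41 : OneForm E N
  Γ23 : OneForm E N
  Γ12 : OneForm E N
  Γ34 : OneForm E N
  Ψ0 : N → ℂ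
  Ψ1 : N → ℂ
  Ψ2 : N → ℂ
  Ψ3 : N → ℂ

end Structure

section Equations

variable {E : Type*} [NormedAddCommGroup E] [NormedSpace ℝ E]
  {N : Type*} [TopologicalSpace N] [ChartedSpace E N]

namespace Data

/-- `Γ₁₄ = -Γ₄₁`. -/
def Γ14 (D : Data E N) : OneForm E N := -D.Γ41

/-- `Γ₄₂` is the complex conjugate of `Γ₄₁`. -/
def Γ42 (D : Data E N) : OneForm E N := D.Γ41.bar

/-- `Γ₂₄ = -Γ₄₂`. -/
def Γ24 (D : Data E N) : OneForm E N := -D.Γ42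

/-- `Γ₂₁ = -Γ₁₂`. -/
def Γ21 (D : Data E N) : OneForm E N := -D.Γ12

/-- `Γ₃₂ = -Γ₂₃`. -/
def Γ32 (D : Data E N) : OneForm E N := -D.Γ23

/-- `Γ₃₁` is the complex conjugate of `Γ₃₂`. -/
def Γ31 (D : Data E N) : OneForm E N := D.Γ32.bar

/-- `D` solves on the open set `U` the first and second Cartan structure equations, pulled back to
a null hypersurface of an Einstein spacetime with (constant) scalar curvature `R`.
Reality: `K` and `Γ₃₄` are real, and the conjugate of `Γ₁₂` is `Γ₂₁ = -Γ₁₂`. Smoothness of the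
Weyl scalars is not required, since it follows from the equations. -/
structure IsSolutionOn (R : ℝ) (D : Data E N) (U : Set N) : Prop where
  smooth_M : D.M.SmoothOn U
  smooth_K : D.K.SmoothOn U
  smooth_Γ41 : D.Γ41.SmoothOn U
  smooth_Γ23 : D.Γ23.SmoothOn U
  smooth_Γ12 : D.Γ12.SmoothOn U
  smooth_Γ34 : D.Γ34.SmoothOn U
  real_K : ∀ p ∈ U, D.K.bar p = D.K p
  conj_Γ12 : ∀ p ∈ U, D.Γ12.bar p = D.Γ21 p
  real_Γ34 : ∀ p ∈ U, D.Γ34.bar p = D.Γ34 p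
  coframe : ∀ p ∈ U, wedge₃ D.M D.M.bar D.K p ≠ 0
  first_M : ∀ p ∈ U, extd D.M p = -wedge D.Γ21 D.M p - wedge D.Γ24 D.K p
  first_L : ∀ p ∈ U, 0 = wedge D.Γ41 D.M p + wedge D.Γ42 D.M.bar p
  first_K : ∀ p ∈ U,
    extd D.K p = wedge D.Γ31 D.M p + wedge D.Γ32 D.M.bar p + wedge D.Γ34 D.K p
  second_23 : ∀ p ∈ U, extd D.Γ23 p =
    wedge (D.Γ12 + D.Γ34) D.Γ23 p - D.Ψ3 p • wedge D.M D.M.bar p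
      + (D.Ψ2 p + R / 12) • wedge D.K D.M p
  second_14 : ∀ p ∈ U, extd D.Γ14 p =
    wedge D.Γ14 (D.Γ12 + D.Γ34) p + D.Ψ1 p • wedge D.M D.M.bar p
      - D.Ψ0 p • wedge D.K D.M p
  second_12_34 : ∀ p ∈ U, (1 / 2 : ℂ) • (extd D.Γ12 p + extd D.Γ34 p) =
    wedge D.Γ23 D.Γ14 p + (D.Ψ2 p - R / 24) • wedge D.M D.M.bar p
      - D.Ψ1 p • wedge D.K D.M p

/-- `σ`, `ρ`, `κ` are the components of `Γ₄₁` in the coframe: `Γ₄₁ = σ M + ρ M̄ + κ K`. -/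
def HasSpinCoeffs (D : Data E N) (U : Set N) (σ ρ κ : N → ℂ) : Prop :=
  ∀ p ∈ U, D.Γ41 p = frameComb D.M D.K σ ρ κ p

/-- The action of the frame transformation with parameters `φ`, `A`, `z` on the coframe, on the
connection one-forms and on the Weyl scalars. The sum `Γ₁₂ + Γ₃₄` changes into
`Γ₁₂ + Γ₃₄ + 2 z Γ₄₁ + d(ln A) + i dφ`; the formulas for `Γ₁₂` and `Γ₃₄` are the imaginary and
real parts of this one. -/
def gauge (D : Data E N) (φ A : N → ℝ) (z : N → ℂ) : Data E N where
  M p := Complex.exp (Complex.I * φ p) • D.M p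
  K p := (A p : ℂ) • (D.K p + z p • D.M.bar p + conj (z p) • D.M p)
  Γ41 p := ((A p : ℂ)⁻¹ * Complex.exp (-(Complex.I * φ p))) • D.Γ41 p
  Γ23 p := ((A p : ℂ) * Complex.exp (Complex.I * φ p)) •
    (D.Γ23 p + z p • (D.Γ12 p + D.Γ34 p) - z p ^ 2 • D.Γ14 p - dC z p)
  Γ12 p := D.Γ12 p + z p • D.Γ41 p - conj (z p) • D.Γ42 p + Complex.I • dR φ p
  Γ34 p := D.Γ34 p + z p • D.Γ41 p + conj (z p) • D.Γ42 p + dR (fun q => Real.log (A q)) p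
  Ψ0 p := (A p : ℂ)⁻¹ ^ 2 * Complex.exp (-(2 * Complex.I * φ p)) * D.Ψ0 p
  Ψ1 p := (A p : ℂ)⁻¹ * Complex.exp (-(Complex.I * φ p)) * (D.Ψ1 p - z p * D.Ψ0 p)
  Ψ2 p := D.Ψ2 p - 2 * z p * D.Ψ1 p + z p ^ 2 * D.Ψ0 p
  Ψ3 p := (A p : ℂ) * Complex.exp (Complex.I * φ p) *
    (D.Ψ3 p - 3 * z p * D.Ψ2 p + 3 * z p ^ 2 * D.Ψ1 p - z p ^ 3 * D.Ψ0 p)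

/-- All components of `D` and `D'` coincide on `U`. -/
structure EqOn (D D' : Data E N) (U : Set N) : Prop where
  M : ∀ p ∈ U, D.M p = D'.M p
  K : ∀ p ∈ U, D.K p = D'.K p
  Γ41 : ∀ p ∈ U, D.Γ41 p = D'.Γ41 p
  Γ23 : ∀ p ∈ U, D.Γ23 p = D'.Γ23 p
  Γ12 : ∀ p ∈ U, D.Γ12 p = D'.Γ12 p
  Γ34 : ∀ p ∈ U, D.Γ34 p = D'.Γ34 p
  Ψ0 : ∀ p ∈ U, D.Ψ0 p = D'.Ψ0 p
  Ψ1 : ∀ p ∈ U, D.Ψ1 p = D'.Ψ1 p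
  Ψ2 : ∀ p ∈ U, D.Ψ2 p = D'.Ψ2 p
  Ψ3 : ∀ p ∈ U, D.Ψ3 p = D'.Ψ3 p

end Data

/-! ### The normal form -/

/-- `M = dζ / ρ`. -/
def normalM (ρ : N → ℝ) (ζ : N → ℂ) : OneForm E N :=
  fun p => (ρ p : ℂ)⁻¹ • dC ζ p

/-- `K = -d(1/ρ) + ½ ρ (x dζ + x̄ dζ̄)`, with `x` evaluated at `ζ`. -/
def normalK (ρ : N → ℝ) (ζ : N → ℂ) (x : ℂ → ℂ) : OneForm E N :=
  fun p => -dR (fun q => (ρ q)⁻¹) p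
    + ((1 / 2 : ℂ) * ρ p) • (x (ζ p) • dC ζ p + conj (x (ζ p)) • (dC ζ).bar p)

/-- The coefficient `Γ⁴₂₁` of the normal form at `(ρ, ζ) = (r, w)`. -/
def normalΓ421 (R : ℝ) (x : ℂ → ℂ) (a : ℂ → ℝ) (r : ℝ) (w : ℂ) : ℂ :=
  -r * (-(1 / 6) * r ^ 4 * (x w * conj (x w)) + (1 / 2) * r ^ 2 * dζbar x w
    + r * a w - R / (24 * r ^ 2))

/-- The Weyl scalar `Ψ₂` of the normal form at `(ρ, ζ) = (r, w)`. -/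
def normalΨ2 (x : ℂ → ℂ) (a : ℂ → ℝ) (r : ℝ) (w : ℂ) : ℂ :=
  a w * r ^ 3 - (2 / 3) * r ^ 6 * (x w * conj (x w)) + r ^ 4 * dζbar x w

/-- The Weyl scalar `Ψ₃` of the normal form at `(ρ, ζ) = (r, w)`. -/
def normalΨ3 (R : ℝ) (x q : ℂ → ℂ) (a : ℂ → ℝ) (r : ℝ) (w : ℂ) : ℂ :=
  (1 / 3) * r ^ 8 * x w * conj (x w) ^ 2
    - (1 / 3) * r ^ 6 * (2 * conj (x w) * dζbar x w
        + (1 / 2) * x w * dζbar (fun t => conj (x t)) w)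
    - (1 / 2) * r ^ 5 * conj (x w) * a w
    + r ^ 4 * ((1 / 2) * dζbar (dζbar x) w - q w * x w)
    + r ^ 3 * dζbar (fun t => (a t : ℂ)) w
    - r ^ 2 * dζ q w
    - (R / 24) * r ^ 2 * conj (x w)

/-- The normal form, for a real function `ρ` and a complex function `ζ` on the hypersurface, and
for functions `x`, `q`, `a` of `ζ`. The connection coefficients `Γ^a_{bc}` are the components, in
the coframe `(θ¹, θ², θ⁴) = (M, M̄, K)`, of the one-forms
`Γ²₄ = -Γ₄₁`, `Γ²₂ = Γ₁₂`, `Γ⁴₄ = Γ₃₄`, `Γ⁴₂ = -Γ₂₃`. -/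
def normalForm (R : ℝ) (ρ : N → ℝ) (ζ : N → ℂ) (x q : ℂ → ℂ) (a : ℂ → ℝ) : Data E N where
  M := normalM ρ ζ
  K := normalK ρ ζ x
  -- `Γ²₄₁ = 0`, `Γ²₄₂ = -ρ`, `Γ²₄₄ = 0`
  Γ41 := -frameComb (normalM ρ ζ) (normalK ρ ζ x)
    (fun _ => 0) (fun p => -(ρ p : ℂ)) (fun _ => 0)
  -- `Γ⁴₂₁`, `Γ⁴₂₂ = -ρ q`, `Γ⁴₂₄ = 0`
  Γ23 := -frameComb (normalM ρ ζ) (normalK ρ ζ x)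
    (fun p => normalΓ421 R x a (ρ p) (ζ p)) (fun p => -(ρ p : ℂ) * q (ζ p)) (fun _ => 0)
  -- `Γ²₂₁ = -½ x ρ³`, `Γ²₂₂ = ½ x̄ ρ³`, `Γ²₂₄ = 0`
  Γ12 := frameComb (normalM ρ ζ) (normalK ρ ζ x)
    (fun p => -(1 / 2) * x (ζ p) * ρ p ^ 3) (fun p => (1 / 2) * conj (x (ζ p)) * ρ p ^ 3)
    (fun _ => 0)
  -- `Γ⁴₄₁ = -½ x ρ³`, `Γ⁴₄₂ = -½ x̄ ρ³`, `Γ⁴₄₄ = 0`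
  Γ34 := frameComb (normalM ρ ζ) (normalK ρ ζ x)
    (fun p => -(1 / 2) * x (ζ p) * ρ p ^ 3) (fun p => -(1 / 2) * conj (x (ζ p)) * ρ p ^ 3)
    (fun _ => 0)
  Ψ0 _ := 0
  Ψ1 p := x (ζ p) * ρ p ^ 4
  Ψ2 p := normalΨ2 x a (ρ p) (ζ p)
  Ψ3 p := normalΨ3 R x q a (ρ p) (ζ p)

end Equations

end NullHypersurface

end

/-!
With `σ = 0`, the equation `Γ₄₁ ∧ M + Γ₄₂ ∧ M̄ = 0` forces `κ = 0` and `ρ` real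
(`FlatData.IsSolutionOn.spinCoeffs`). Then `Γ₄₂ = ρ M`, so the first structure equation gives
`M ∧ dM = 0`, and locally `M` is the product of a function and an exact form `dζ`
(`exists_integrating_factor`). For smooth data this is not elementary: the flow of a vector field in
the real kernel of `M` (`exists_local_flow`) reduces the problem to the plane, where `ζ` solves a
Beltrami equation (`exists_local_beltrami`). After a rescaling the coefficient of that equation is
small, and on the Fourier side the equation becomes a convolution equation which is solved by a Neumann
series (`exists_fixedPoint_convolution`); weighted `L¹` norms show that the solution is smooth.

The phase of the factor between `M` and `dζ` is removed by a rotation, and its modulus, up to a sign, is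
the inverse of a new coordinate `ρ`: because the expansion does not vanish, the first structure
equation shows that `(ρ, ζ)` is a coordinate system (`exists_equiv_fderiv`). A boost makes
`Γ₄₁ = dζ̄`, and a null rotation removes the `dζ̄`-component of `Γ₁₂ + Γ₃₄`; the equation for its
parameter `z` is linear because `Γ₄₁` has a non-zero `dζ̄`-component
(`exists_gauge_eqOn_normalForm`). This uses the covariance of the structure equations under
changes of coordinates (`isSolutionOn_pushData`) and of frame (`FlatData.isSolutionOn_gauge`).

In this gauge part of the structure equations is algebraic: one function determines `Γ₁₂`, `Γ₃₄`,
`K` and `Ψ₁` (`rigidity_pointwise`). The others are ordinary differential equations in `ρ`, with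
explicit solutions whose constants of integration are the functions `x`, `q` and `a` of `ζ`; the
reality of `K` makes `a` real (`exists_eqOn_normalForm`). The gauge equivalence found in coordinates is
pulled back to the manifold by `eqOn_of_pushData`.

Conversely, the components of the normal form are polynomials in `ρ` and `ρ⁻¹` with coefficients
depending on `ζ`, and the structure equations are verified component by component
(`normalFlat_isSolutionOn`).
-/

open MeasureTheory Filter Topology NullHypersurface
open scoped Convolution ENNReal FourierTransform SchwartzMap

/-! ### Neumann series for a convolution equation -/

/-- The `L¹` norm with respect to a submultiplicative weight is submultiplicative under convolution.
-/
lemma lintegral_weight_convolution_le {w : ℂ → ℝ≥0∞} (hw : Measurable w)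
    (hsub : ∀ ξ η, w (ξ + η) ≤ w ξ * w η) {f g : ℂ → ℂ} (hf : AEStronglyMeasurable f)
    (hg : Measurable g) :
    ∫⁻ ξ, w ξ * ‖(f ⋆[ContinuousLinearMap.mul ℂ ℂ] g) ξ‖ₑ ≤
      (∫⁻ ξ, w ξ * ‖f ξ‖ₑ) * ∫⁻ ξ, w ξ * ‖g ξ‖ₑ := by
  have hm1 : AEMeasurable (fun t => w t * ‖f t‖ₑ) := hw.aemeasurable.mul hf.enorm
  have hm2 : Measurable (fun t => w t * ‖g t‖ₑ) := hw.mul hg.enorm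
  calc ∫⁻ ξ, w ξ * ‖(f ⋆[ContinuousLinearMap.mul ℂ ℂ] g) ξ‖ₑ
      ≤ ∫⁻ ξ, ∫⁻ t, (w t * ‖f t‖ₑ) * (w (ξ - t) * ‖g (ξ - t)‖ₑ) := by
        refine lintegral_mono fun ξ => ?_
        calc w ξ * ‖(f ⋆[ContinuousLinearMap.mul ℂ ℂ] g) ξ‖ₑ
            ≤ w ξ * ∫⁻ t, ‖f t * g (ξ - t)‖ₑ := by
              gcongr
              exact enorm_integral_le_lintegral_enorm _
          _ ≤ ∫⁻ t, w ξ * ‖f t * g (ξ - t)‖ₑ := lintegral_const_mul_le _ _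
          _ ≤ _ := by
              refine lintegral_mono fun t => ?_
              have := hsub t (ξ - t)
              rw [add_sub_cancel] at this
              calc w ξ * ‖f t * g (ξ - t)‖ₑ ≤ (w t * w (ξ - t)) * (‖f t‖ₑ * ‖g (ξ - t)‖ₑ) := by
                    rw [enorm_mul]; gcongr
                _ = _ := by ring
    _ = ∫⁻ t, ∫⁻ ξ, (w t * ‖f t‖ₑ) * (w (ξ - t) * ‖g (ξ - t)‖ₑ) := by
        refine lintegral_lintegral_swap ?_
        refine AEMeasurable.mul ?_ ?_
        · exact hm1.comp_quasiMeasurePreserving Measure.quasiMeasurePreserving_snd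
        · exact (hm2.comp (measurable_fst.sub measurable_snd)).aemeasurable
    _ = ∫⁻ t, (w t * ‖f t‖ₑ) * ∫⁻ ξ, w ξ * ‖g ξ‖ₑ := by
        refine lintegral_congr fun t => ?_
        rw [lintegral_const_mul]
        · rw [lintegral_sub_right_eq_self (fun ξ => w ξ * ‖g ξ‖ₑ) t]
        · exact hm2.comp (measurable_id.sub_const t)
    _ = _ := lintegral_mul_const'' _ hm1

/-- The terms of the Neumann series of the equation `h = a + (m h) ⋆ a`: the first one is `a`, and
each further one is obtained from its predecessor by `h ↦ (m h) ⋆ a`. -/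
noncomputable def neumannTerm (m a : ℂ → ℂ) : ℕ → ℂ → ℂ
  | 0 => a
  | n + 1 => (fun ξ => m ξ * neumannTerm m a n ξ) ⋆[ContinuousLinearMap.mul ℂ ℂ] a

section Neumann

variable {m a : ℂ → ℂ} (hm : Measurable m) (hm1 : ∀ ξ, ‖m ξ‖ ≤ 1) (hc : Continuous a)
  {C : ℝ} (hC : ∀ ξ, ‖a ξ‖ ≤ C) (hint : Integrable a)

include hm hm1 hc hC hint

lemma neumannTerm_spec (n : ℕ) :
    Continuous (neumannTerm m a n) ∧ Integrable (neumannTerm m a n) := by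
  induction n with
  | zero => exact ⟨hc, hint⟩
  | succ n ih =>
    have hI : Integrable (fun ξ => m ξ * neumannTerm m a n ξ) :=
      ih.2.bdd_mul hm.aestronglyMeasurable (Eventually.of_forall hm1)
    refine ⟨?_, hI.integrable_convolution _ hint⟩
    refine BddAbove.continuous_convolution_right_of_integrable _ ?_ hI hc
    exact ⟨C, by rintro _ ⟨ξ, rfl⟩; exact hC ξ⟩

lemma lintegral_weight_neumannTerm_le {w : ℂ → ℝ≥0∞} (hw : Measurable w)
    (hsub : ∀ ξ η, w (ξ + η) ≤ w ξ * w η) (n : ℕ) :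
    ∫⁻ ξ, w ξ * ‖neumannTerm m a n ξ‖ₑ ≤ (∫⁻ ξ, w ξ * ‖a ξ‖ₑ) ^ (n + 1) := by
  induction n with
  | zero => simp [neumannTerm]
  | succ n ih =>
    have h := neumannTerm_spec hm hm1 hc hC hint n
    calc _ ≤ (∫⁻ ξ, w ξ * ‖m ξ * neumannTerm m a n ξ‖ₑ) * ∫⁻ ξ, w ξ * ‖a ξ‖ₑ :=
          lintegral_weight_convolution_le hw hsub
            (hm.aestronglyMeasurable.mul h.2.1) hc.measurable
      _ ≤ (∫⁻ ξ, w ξ * ‖neumannTerm m a n ξ‖ₑ) * ∫⁻ ξ, w ξ * ‖a ξ‖ₑ := by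
          gcongr with ξ
          rw [enorm_mul]
          calc _ ≤ 1 * ‖neumannTerm m a n ξ‖ₑ := by
                gcongr
                rw [← ofReal_norm]
                exact ENNReal.ofReal_le_one.2 (hm1 ξ)
            _ = _ := one_mul _
      _ ≤ _ := by rw [pow_succ]; gcongr

lemma norm_neumannTerm_le (n : ℕ) (ξ : ℂ) :
    ‖neumannTerm m a n ξ‖ ≤ C * (∫ η, ‖a η‖) ^ n ∧
      ∫ η, ‖neumannTerm m a n η‖ ≤ (∫ η, ‖a η‖) ^ (n + 1) := by
  have key : ∀ n, ∫ η, ‖neumannTerm m a n η‖ ≤ (∫ η, ‖a η‖) ^ (n + 1) := by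
    intro n
    have h := lintegral_weight_neumannTerm_le hm hm1 hc hC hint (w := fun _ => 1)
      measurable_const (by simp) n
    simp only [one_mul] at h
    rw [integral_norm_eq_lintegral_enorm (neumannTerm_spec hm hm1 hc hC hint n).2.1,
      integral_norm_eq_lintegral_enorm hint.1, ← ENNReal.toReal_pow]
    exact ENNReal.toReal_mono (ENNReal.pow_ne_top hint.2.ne) h
  refine ⟨?_, key n⟩
  have hC0 : 0 ≤ C := (norm_nonneg _).trans (hC 0)
  cases n with
  | zero => simpa [neumannTerm] using hC ξ
  | succ n =>
    have h := (neumannTerm_spec hm hm1 hc hC hint n).2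
    calc ‖neumannTerm m a (n + 1) ξ‖
        = ‖∫ t, (m t * neumannTerm m a n t) * a (ξ - t)‖ := rfl
      _ ≤ ∫ t, ‖neumannTerm m a n t‖ * C := by
          refine norm_integral_le_of_norm_le (h.norm.mul_const C) (Eventually.of_forall fun t => ?_)
          rw [norm_mul, norm_mul]
          have := hm1 t
          have := hC (ξ - t)
          calc _ ≤ 1 * ‖neumannTerm m a n t‖ * C := by gcongr
            _ = _ := by ring
      _ = (∫ t, ‖neumannTerm m a n t‖) * C := integral_mul_const _ _
      _ ≤ (∫ η, ‖a η‖) ^ (n + 1) * C := by gcongr; exact key n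
      _ = _ := mul_comm _ _

end Neumann

/-- If `‖a‖₁ < 1` and all moments of `a` are finite, the mass of `a` with respect to the
submultiplicative weight `(1 + l ‖ξ‖) ^ s` is still less than `1` for small `l`. The Neumann series
with kernel `a` therefore converges in every weighted `L¹` space, and its sum has finite moments. -/
lemma exists_weight {a : ℂ → ℂ} (ha : AEStronglyMeasurable a)
    (hmom : ∀ n : ℕ, Integrable (fun ξ => ‖ξ‖ ^ n * ‖a ξ‖)) (hsmall : ∫ ξ, ‖a ξ‖ < 1) (s : ℕ) :
    ∃ l : ℝ, 0 < l ∧ ∫⁻ ξ, ENNReal.ofReal ((1 + l * ‖ξ‖) ^ s) * ‖a ξ‖ₑ < 1 := by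
  have hlim : Tendsto (fun l : ℝ => ∫ ξ, (1 + l * ‖ξ‖) ^ s * ‖a ξ‖) (𝓝[>] 0)
      (𝓝 (∫ ξ, ‖a ξ‖)) := by
    have h0 : (∫ ξ, ‖a ξ‖) = ∫ ξ, (1 + 0 * ‖ξ‖) ^ s * ‖a ξ‖ := by simp
    rw [h0]
    have hdom : Integrable (fun ξ => 2 ^ (s - 1) * (‖ξ‖ ^ 0 * ‖a ξ‖ + ‖ξ‖ ^ s * ‖a ξ‖)) :=
      ((hmom 0).add (hmom s)).const_mul _
    refine tendsto_integral_filter_of_dominated_convergence _ ?_ ?_ hdom ?_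
    · refine Eventually.of_forall fun l => ?_
      exact (by fun_prop : Continuous fun ξ : ℂ => (1 + l * ‖ξ‖) ^ s).aestronglyMeasurable.mul
        ha.norm
    · have : Set.Ioo (0 : ℝ) 1 ∈ 𝓝[>] (0 : ℝ) := Ioo_mem_nhdsGT one_pos
      filter_upwards [this] with l hl
      refine Eventually.of_forall fun ξ => ?_
      have hl0 := hl.1.le
      rw [Real.norm_of_nonneg (by positivity)]
      have h1 : (1 + l * ‖ξ‖) ^ s ≤ (1 + ‖ξ‖) ^ s := by
        gcongr
        nlinarith [norm_nonneg ξ, hl.2]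
      have h2 := add_pow_le zero_le_one (norm_nonneg ξ) s
      calc _ ≤ (2 ^ (s - 1) * (1 ^ s + ‖ξ‖ ^ s)) * ‖a ξ‖ := by gcongr; exact h1.trans h2
        _ = _ := by simp; ring
    · refine Eventually.of_forall fun ξ => ?_
      refine Tendsto.mono_left ?_ nhdsWithin_le_nhds
      exact (by fun_prop : Continuous fun l : ℝ => (1 + l * ‖ξ‖) ^ s * ‖a ξ‖).tendsto 0
  obtain ⟨l, hl, hl0⟩ := ((hlim.eventually (gt_mem_nhds hsmall)).and self_mem_nhdsWithin).exists
  have hl0 : 0 < l := hl0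
  refine ⟨l, hl0, ?_⟩
  have : ∫⁻ ξ, ENNReal.ofReal ((1 + l * ‖ξ‖) ^ s) * ‖a ξ‖ₑ =
      ∫⁻ ξ, ENNReal.ofReal ((1 + l * ‖ξ‖) ^ s * ‖a ξ‖) := by
    refine lintegral_congr fun ξ => ?_
    rw [ENNReal.ofReal_mul (by positivity), ofReal_norm]
  rw [this, ← ENNReal.ofReal_one, ← ofReal_integral_eq_lintegral_ofReal]
  · exact (ENNReal.ofReal_lt_ofReal_iff one_pos).2 hl
  · have hdom : Integrable (fun ξ => (1 + l) ^ s *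
      (2 ^ (s - 1) * (‖ξ‖ ^ 0 * ‖a ξ‖ + ‖ξ‖ ^ s * ‖a ξ‖))) :=
      (((hmom 0).add (hmom s)).const_mul _).const_mul _
    refine hdom.mono' ((by fun_prop : Continuous fun ξ : ℂ =>
      (1 + l * ‖ξ‖) ^ s).aestronglyMeasurable.mul ha.norm) (Eventually.of_forall fun ξ => ?_)
    rw [Real.norm_of_nonneg (by positivity)]
    have h1 : (1 + l * ‖ξ‖) ^ s ≤ ((1 + l) * (1 + ‖ξ‖)) ^ s := by
      gcongr
      nlinarith [norm_nonneg ξ]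
    have h2 := add_pow_le zero_le_one (norm_nonneg ξ) s
    rw [mul_pow] at h1
    calc (1 + l * ‖ξ‖) ^ s * ‖a ξ‖ ≤ ((1 + l) ^ s * (2 ^ (s - 1) * (1 ^ s + ‖ξ‖ ^ s))) * ‖a ξ‖ := by
          gcongr
          exact h1.trans (by gcongr)
      _ = _ := by simp; ring
  · exact Eventually.of_forall fun ξ => by positivity

/-- The equation `h = a + (m h) ⋆ a` is solved by its Neumann series. The moments of `h` are finite,
so its Fourier transform is smooth; no regularity of the multiplier `m` is needed. -/
lemma exists_fixedPoint_convolution {m a : ℂ → ℂ} (hm : Measurable m) (hm1 : ∀ ξ, ‖m ξ‖ ≤ 1)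
    (hc : Continuous a) {C : ℝ} (hC : ∀ ξ, ‖a ξ‖ ≤ C)
    (hmom : ∀ n : ℕ, Integrable (fun ξ => ‖ξ‖ ^ n * ‖a ξ‖)) (hsmall : ∫ ξ, ‖a ξ‖ < 1 / 2) :
    ∃ h : ℂ → ℂ, Continuous h ∧ (∃ C', ∀ ξ, ‖h ξ‖ ≤ C') ∧
      (∀ n : ℕ, Integrable (fun ξ => ‖ξ‖ ^ n * ‖h ξ‖)) ∧
      (∀ ξ, h ξ = a ξ + ((fun ξ => m ξ * h ξ) ⋆[ContinuousLinearMap.mul ℂ ℂ] a) ξ) ∧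
      ∫ ξ, ‖h ξ‖ < 1 := by
  have hint : Integrable a := by
    have := hmom 0
    simp only [pow_zero, one_mul] at this
    exact (integrable_norm_iff hc.aestronglyMeasurable).1 this
  set H := neumannTerm m a with hH
  set θ := ∫ ξ, ‖a ξ‖ with hθ
  have hθ0 : 0 ≤ θ := integral_nonneg fun ξ => norm_nonneg _
  have hspec := neumannTerm_spec hm hm1 hc hC hint
  have hbd := norm_neumannTerm_le hm hm1 hc hC hint
  have hgeom : Summable fun n => C * θ ^ n :=
    (summable_geometric_of_lt_one hθ0 (by linarith)).mul_left _
  have hsum : ∀ ξ, Summable fun n => H n ξ := fun ξ =>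
    Summable.of_norm_bounded hgeom fun n => (hbd n ξ).1
  set h : ℂ → ℂ := fun ξ => ∑' n, H n ξ with hh
  have hcont : Continuous h := continuous_tsum (fun n => (hspec n).1) hgeom fun n ξ => (hbd n ξ).1
  have hweight : ∀ w : ℂ → ℝ≥0∞, Measurable w → (∀ ξ η, w (ξ + η) ≤ w ξ * w η) →
      ∫⁻ ξ, w ξ * ‖h ξ‖ₑ ≤ ∑' n, (∫⁻ ξ, w ξ * ‖a ξ‖ₑ) ^ (n + 1) := by
    intro w hw hsub
    calc ∫⁻ ξ, w ξ * ‖h ξ‖ₑ ≤ ∫⁻ ξ, ∑' n, w ξ * ‖H n ξ‖ₑ := by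
          refine lintegral_mono fun ξ => ?_
          rw [ENNReal.tsum_mul_left]
          gcongr
          exact enorm_tsum_le_tsum_enorm
      _ = ∑' n, ∫⁻ ξ, w ξ * ‖H n ξ‖ₑ := by
          rw [lintegral_tsum]
          intro n
          exact (hw.mul (hspec n).1.measurable.enorm).aemeasurable
      _ ≤ _ := ENNReal.tsum_le_tsum fun n =>
          lintegral_weight_neumannTerm_le hm hm1 hc hC hint hw hsub n
  have hI : Integrable h ∧ ∫ ξ, ‖h ξ‖ < 1 := by
    have h1 := hweight (fun _ => 1) measurable_const (by simp)
    simp only [one_mul] at h1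
    have h2 : ∫⁻ ξ, ‖a ξ‖ₑ = ENNReal.ofReal θ := by
      rw [hθ, ofReal_integral_norm_eq_lintegral_enorm hint]
    have hlt : (1 : ℝ≥0∞) / 2 = ENNReal.ofReal (1 / 2) := by
      rw [ENNReal.ofReal_div_of_pos two_pos]; simp
    have h3 : ∑' n, (∫⁻ ξ, ‖a ξ‖ₑ) ^ (n + 1) = ENNReal.ofReal (θ / (1 - θ)) := by
      rw [h2]
      have : ∀ n : ℕ, ENNReal.ofReal θ ^ (n + 1) = ENNReal.ofReal (θ * θ ^ n) := by
        intro n; rw [← ENNReal.ofReal_pow hθ0, pow_succ']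
      simp_rw [this]
      rw [← ENNReal.ofReal_tsum_of_nonneg (fun n => by positivity)
        ((summable_geometric_of_lt_one hθ0 (by linarith)).mul_left _), tsum_mul_left,
        tsum_geometric_of_lt_one hθ0 (by linarith), div_eq_mul_inv]
    rw [h3] at h1
    have hIh : Integrable h := ⟨hcont.aestronglyMeasurable, h1.trans_lt ENNReal.ofReal_lt_top⟩
    refine ⟨hIh, ?_⟩
    rw [← ofReal_integral_norm_eq_lintegral_enorm hIh] at h1
    have h4 : θ / (1 - θ) < 1 := by rw [div_lt_one (by linarith)]; linarith
    have h5 := (ENNReal.ofReal_le_ofReal_iff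
      (div_nonneg hθ0 (by linarith))).1 h1
    linarith
  refine ⟨h, hcont, ⟨∑' n, C * θ ^ n, fun ξ => ?_⟩, fun s => ?_, fun ξ => ?_, hI.2⟩
  · exact tsum_of_norm_bounded hgeom.hasSum fun n => (hbd n ξ).1
  · obtain ⟨l, hl, hls⟩ := exists_weight hc.aestronglyMeasurable hmom (by linarith) s
    have h1 := hweight (fun ξ => ENNReal.ofReal ((1 + l * ‖ξ‖) ^ s))
      (by fun_prop) (fun ξ η => by
        rw [← ENNReal.ofReal_mul (by positivity), ← mul_pow]
        gcongr
        nlinarith [norm_add_le ξ η, mul_nonneg (mul_nonneg hl.le (norm_nonneg ξ))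
          (mul_nonneg hl.le (norm_nonneg η)), mul_le_mul_of_nonneg_left (norm_add_le ξ η) hl.le])
    have h2 : ∫⁻ ξ, ENNReal.ofReal ((1 + l * ‖ξ‖) ^ s) * ‖h ξ‖ₑ < ⊤ := by
      refine h1.trans_lt ?_
      simp_rw [pow_succ']
      rw [ENNReal.tsum_mul_left, ENNReal.tsum_geometric]
      refine ENNReal.mul_lt_top (hls.trans ENNReal.one_lt_top) ?_
      rw [ENNReal.inv_lt_top]
      exact tsub_pos_of_lt hls
    have h3 : Integrable fun ξ => (1 + l * ‖ξ‖) ^ s * ‖h ξ‖ := by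
      refine ⟨((by fun_prop : Continuous fun ξ : ℂ =>
        (1 + l * ‖ξ‖) ^ s).mul hcont.norm).aestronglyMeasurable, ?_⟩
      refine lt_of_le_of_lt (le_of_eq ?_) h2
      refine lintegral_congr fun ξ => ?_
      rw [enorm_mul, Real.enorm_of_nonneg (by positivity), enorm_norm]
    refine (h3.const_mul ((l⁻¹) ^ s)).mono'
      ((continuous_norm.pow s).mul hcont.norm).aestronglyMeasurable
      (Eventually.of_forall fun ξ => ?_)
    rw [Real.norm_of_nonneg (by positivity), ← mul_assoc, ← mul_pow]
    gcongr
    rw [mul_add, inv_mul_cancel_left₀ hl.ne']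
    have : 0 < l⁻¹ := inv_pos.2 hl
    linarith
  · have h1 : h ξ = H 0 ξ + ∑' n, H (n + 1) ξ := (hsum ξ).tsum_eq_zero_add
    rw [h1]
    congr 1
    have hterm : ∀ n, H (n + 1) ξ = ∫ t, (m t * H n t) * a (ξ - t) := fun n => rfl
    simp_rw [hterm]
    change _ = ∫ t, (m t * h t) * a (ξ - t)
    have hIn : ∀ n, Integrable fun t => (m t * H n t) * a (ξ - t) := fun n => by
      have := (hspec n).2.bdd_mul hm.aestronglyMeasurable (Eventually.of_forall hm1)
      refine this.mul_bdd (c := C) ?_ (Eventually.of_forall fun t => hC _)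
      exact (hc.comp (continuous_const.sub continuous_id)).aestronglyMeasurable
    have hC0 : 0 ≤ C := (norm_nonneg _).trans (hC 0)
    rw [integral_tsum_of_summable_integral_norm hIn]
    · congr 1
      ext t
      rw [← tsum_mul_left, ← tsum_mul_right]
    · refine Summable.of_nonneg_of_le (fun n => integral_nonneg fun t => norm_nonneg _)
        (fun n => ?_)
        ((hgeom.mul_left θ))
      calc ∫ t, ‖(m t * H n t) * a (ξ - t)‖ ≤ ∫ t, ‖H n t‖ * C := by
            refine integral_mono_of_nonneg (Eventually.of_forall fun t => norm_nonneg _)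
              ((hspec n).2.norm.mul_const C) (Eventually.of_forall fun t => ?_)
            dsimp only
            rw [norm_mul, norm_mul]
            have := hm1 t
            have := hC (ξ - t)
            calc _ ≤ 1 * ‖H n t‖ * C := by gcongr
              _ = _ := by ring
        _ = (∫ t, ‖H n t‖) * C := integral_mul_const _ _
        _ ≤ θ ^ (n + 1) * C := by gcongr; exact (hbd n 0).2
        _ = _ := by ring

/-! ### Local solutions of the Beltrami equation -/

/-- In the plane, `1 / ‖v‖` is integrable near the origin. -/
lemma integrable_indicator_norm_inv :
    Integrable (fun v : ℂ => (Set.Ioo (0 : ℝ) 1).indicator (fun y => y⁻¹) ‖v‖) := by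
  rw [integrable_fun_norm_addHaar]
  have h1 : Module.finrank ℝ ℂ - 1 = 1 := by simp [Complex.finrank_real_complex]
  rw [h1]
  have h2 : Integrable ((Set.Ioo (0 : ℝ) 1).indicator (fun _ => (1 : ℝ))) :=
    (integrable_indicator_iff measurableSet_Ioo).2 (by simp)
  refine h2.integrableOn.congr_fun (fun y hy => ?_) measurableSet_Ioi
  by_cases h : y ∈ Set.Ioo (0 : ℝ) 1
  · have : y ≠ 0 := h.1.ne'
    simp [h, this]
  · simp [h]

/-- Division by the coordinate preserves the finiteness of all moments of a bounded function; the
singularity at the origin is integrable in dimension two. -/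
lemma integrable_pow_mul_norm_div {h : ℂ → ℂ} (hc : Continuous h) {C : ℝ} (hC : ∀ ξ, ‖h ξ‖ ≤ C)
    (hmom : ∀ n : ℕ, Integrable (fun ξ => ‖ξ‖ ^ n * ‖h ξ‖)) (n : ℕ) :
    Integrable (fun ξ => ‖ξ‖ ^ n * ‖h ξ / ξ‖) := by
  have hmeas : AEStronglyMeasurable (fun ξ => ‖ξ‖ ^ n * ‖h ξ / ξ‖) :=
    ((continuous_norm.pow n).measurable.mul
      (hc.measurable.div measurable_id).norm).aestronglyMeasurable
  have hC0 : 0 ≤ C := (norm_nonneg _).trans (hC 0)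
  cases n with
  | zero =>
    refine ((integrable_indicator_norm_inv.const_mul C).add (hmom 0)).mono' hmeas
      (Eventually.of_forall fun ξ => ?_)
    simp only [pow_zero, one_mul, norm_norm, Pi.add_apply, norm_div]
    by_cases h1 : ‖ξ‖ ∈ Set.Ioo (0 : ℝ) 1
    · rw [Set.indicator_of_mem h1, div_eq_mul_inv]
      have := hC ξ
      have h2 : 0 ≤ ‖ξ‖⁻¹ := by positivity
      nlinarith [norm_nonneg (h ξ)]
    · rw [Set.indicator_of_notMem h1, mul_zero, zero_add]
      rcases eq_or_lt_of_le (norm_nonneg ξ) with h0 | h0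
      · simp [← h0]
      · have : 1 ≤ ‖ξ‖ := by
          by_contra hlt
          exact h1 ⟨h0, not_le.1 hlt⟩
        exact div_le_self (norm_nonneg _) this
  | succ n =>
    refine (hmom n).mono' hmeas (Eventually.of_forall fun ξ => ?_)
    rw [Real.norm_of_nonneg (by positivity), norm_div, pow_succ, mul_assoc]
    gcongr
    by_cases h0 : ‖ξ‖ = 0
    · simp [h0]
    · rw [mul_div_cancel₀ _ h0]

/-- A solution of `∂u/∂ζ̄ = ν (1 + ∂u/∂ζ)`, for `ν = 𝓕 a` with `‖a‖₁ < 1 / 2`. It is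
`u = 𝓕 (h / (-π i v))`, for which `∂u/∂ζ̄ = 𝓕 h` and `∂u/∂ζ = 𝓕 (m h)` with `m v =
    v̄ / v`; the equation
becomes `h = a + (m h) ⋆ a`. -/
lemma exists_beltrami_of_fourier {ν a : ℂ → ℂ} (hν : ∀ x, 𝓕 a x = ν x)
    (hc : Continuous a) {C : ℝ} (hC : ∀ ξ, ‖a ξ‖ ≤ C)
    (hmom : ∀ n : ℕ, Integrable (fun ξ => ‖ξ‖ ^ n * ‖a ξ‖)) (hsmall : ∫ ξ, ‖a ξ‖ < 1 / 2) :
    ∃ u : ℂ → ℂ, ContDiff ℝ ∞ u ∧ ∀ x, dζbar u x = ν x * (1 + dζ u x) ∧ ‖dζ u x‖ < 1 := by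
  set m : ℂ → ℂ := fun v => conj v / v with hm
  have hmm : Measurable m := Complex.continuous_conj.measurable.div measurable_id
  have hm1 : ∀ ξ, ‖m ξ‖ ≤ 1 := fun ξ => by
    rw [hm]; simp only [norm_div, RCLike.norm_conj]; exact div_self_le_one _
  obtain ⟨h, hhc, ⟨C', hC'⟩, hhmom, hfix, hlt⟩ :=
    exists_fixedPoint_convolution hmm hm1 hc hC hmom hsmall
  have toInt : ∀ {f : ℂ → ℂ}, AEStronglyMeasurable f →
      (∀ n : ℕ, Integrable (fun ξ => ‖ξ‖ ^ n * ‖f ξ‖)) → Integrable f := by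
    intro f hf hmf
    have := hmf 0
    simp only [pow_zero, one_mul] at this
    exact (integrable_norm_iff hf).1 this
  have hai : Integrable a := toInt hc.aestronglyMeasurable hmom
  have hhi : Integrable h := toInt hhc.aestronglyMeasurable hhmom
  have hmhi : Integrable (fun ξ => m ξ * h ξ) :=
    hhi.bdd_mul hmm.aestronglyMeasurable (Eventually.of_forall hm1)
  set k : ℂ → ℂ := fun v => (-Real.pi * Complex.I)⁻¹ * (h v / v) with hk
  have hkmeas : AEStronglyMeasurable k :=
    ((hhc.measurable.div measurable_id).const_mul _).aestronglyMeasurable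
  have hkmom : ∀ n : ℕ, Integrable (fun ξ => ‖ξ‖ ^ n * ‖k ξ‖) := fun n => by
    refine ((integrable_pow_mul_norm_div hhc hC' hhmom n).const_mul
      ‖(-Real.pi * Complex.I : ℂ)⁻¹‖).congr (Eventually.of_forall fun ξ => ?_)
    simp only [hk, norm_mul]; ring
  have hki : Integrable k := toInt hkmeas hkmom
  have hpi : (-Real.pi * Complex.I : ℂ) ≠ 0 := by simp [Real.pi_ne_zero]
  have hk1 : Integrable fun ξ => ‖ξ‖ * ‖k ξ‖ := by simpa using hkmom 1
  set G := VectorFourier.fourierSMulRight (innerSL ℝ) k with hG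
  have hGi : Integrable G := by
    refine (hk1.const_mul (2 * Real.pi * ‖(innerSL ℝ : ℂ →L[ℝ] ℂ →L[ℝ] ℝ)‖)).mono'
      hkmeas.fourierSMulRight (Eventually.of_forall fun v => ?_)
    calc _ ≤ _ := VectorFourier.norm_fourierSMulRight_le _ _ _
      _ = _ := by ring
  have hGapp : ∀ v y : ℂ, G v y = -(2 * Real.pi * Complex.I) * (conj v * y).re * k v := by
    intro v y
    simp only [hG, VectorFourier.fourierSMulRight_apply, innerSL_apply_apply ℝ, Complex.inner,
      smul_eq_mul, Complex.real_smul, mul_comm y]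
    ring
  have hD : ∀ x y, fderiv ℝ (𝓕 k) x y = 𝓕 (fun v => G v y) x := by
    intro x y
    rw [Real.fderiv_fourier hki hk1]
    exact Real.fourier_continuousLinearMap_apply hGi
  have hcombo : ∀ (x c d : ℂ), c * fderiv ℝ (𝓕 k) x 1 + d * fderiv ℝ (𝓕 k) x Complex.I =
      𝓕 (fun v => c * G v 1 + d * G v Complex.I) x := by
    intro x c d
    rw [hD, hD]
    simp only [Real.fourier_eq]
    have i1 := (Real.fourierIntegral_convergent_iff (μ := volume) (f := fun v => G v 1) x).2
      (hGi.apply_continuousLinearMap 1)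
    have i2 := (Real.fourierIntegral_convergent_iff (μ := volume) (f := fun v => G v Complex.I) x).2
      (hGi.apply_continuousLinearMap Complex.I)
    rw [← integral_const_mul, ← integral_const_mul,
        ← integral_add (i1.const_mul c) (i2.const_mul d)]
    congr 1
    ext v
    simp only [Circle.smul_def, smul_eq_mul]
    ring
  have hzbar : ∀ x, dζbar (𝓕 k) x = 𝓕 h x := by
    intro x
    have := hcombo x (1 / 2) (1 / 2 * Complex.I)
    rw [dζbar, mul_add, ← mul_assoc, this]
    refine Real.fourier_congr_ae ?_ x
    have hne : ∀ᵐ v : ℂ, v ≠ 0 := by simp [ae_iff, measure_singleton]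
    filter_upwards [hne] with v hv
    rw [hGapp, hGapp, hk]
    have hre : (((conj v * 1).re : ℝ) : ℂ) + Complex.I * (((conj v * Complex.I).re : ℝ) : ℂ) = v :=
        by
      apply Complex.ext <;> simp
    have : (1 / 2 * (-(2 * Real.pi * Complex.I) * ((conj v * 1).re : ℝ) *
        ((-Real.pi * Complex.I)⁻¹ * (h v / v)))
        + 1 / 2 * Complex.I * (-(2 * Real.pi * Complex.I) * ((conj v * Complex.I).re : ℝ) *
        ((-Real.pi * Complex.I)⁻¹ * (h v / v))) : ℂ) =
        (-Real.pi * Complex.I) * (-Real.pi * Complex.I)⁻¹ * (h v / v) *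
          (((conj v * 1).re : ℝ) + Complex.I * ((conj v * Complex.I).re : ℝ)) := by ring
    rw [this, hre, mul_inv_cancel₀ hpi, one_mul, div_mul_cancel₀ _ hv]
  have hz : ∀ x, dζ (𝓕 k) x = 𝓕 (fun v => m v * h v) x := by
    intro x
    have := hcombo x (1 / 2) (-(1 / 2 * Complex.I))
    rw [dζ, mul_sub, ← mul_assoc, sub_eq_add_neg, ← neg_mul, this]
    refine Real.fourier_congr_ae (Eventually.of_forall fun v => ?_) x
    rw [hGapp, hGapp, hk, hm]
    have hre : (((conj v * 1).re : ℝ) : ℂ) - Complex.I * (((conj v * Complex.I).re : ℝ) : ℂ) =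
        conj v := by
      apply Complex.ext <;> simp
    have : (1 / 2 * (-(2 * Real.pi * Complex.I) * ((conj v * 1).re : ℝ) *
        ((-Real.pi * Complex.I)⁻¹ * (h v / v)))
        + -(1 / 2 * Complex.I) * (-(2 * Real.pi * Complex.I) * ((conj v * Complex.I).re : ℝ) *
        ((-Real.pi * Complex.I)⁻¹ * (h v / v))) : ℂ) =
        (-Real.pi * Complex.I) * (-Real.pi * Complex.I)⁻¹ * (h v / v) *
          (((conj v * 1).re : ℝ) - Complex.I * ((conj v * Complex.I).re : ℝ)) := by ring
    dsimp only
    rw [this, hre, mul_inv_cancel₀ hpi, one_mul]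
    ring
  refine ⟨𝓕 k, Real.contDiff_fourier fun n _ => hkmom n, fun x => ⟨?_, ?_⟩⟩
  · rw [hzbar, hz, mul_add, mul_one]
    have h1 : 𝓕 h x = 𝓕 a x + 𝓕 ((fun ξ => m ξ * h ξ) ⋆[ContinuousLinearMap.mul ℂ ℂ] a) x := by
      simp only [Real.fourier_eq]
      have i1 := (Real.fourierIntegral_convergent_iff (μ := volume) (f := a) x).2 hai
      have i2 := (Real.fourierIntegral_convergent_iff (μ := volume)
        (f := (fun ξ => m ξ * h ξ) ⋆[ContinuousLinearMap.mul ℂ ℂ] a) x).2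
        (hmhi.integrable_convolution _ hai)
      rw [← integral_add i1 i2]
      congr 1
      ext v
      rw [hfix v, smul_add]
    rw [h1, Real.fourier_mul_convolution_eq hmhi hai, hν]
    ring
  · rw [hz, Real.fourier_eq]
    refine lt_of_le_of_lt ?_ hlt
    refine norm_integral_le_of_norm_le hhi.norm (Eventually.of_forall fun v => ?_)
    rw [Circle.norm_smul, norm_mul]
    have := hm1 v
    nlinarith [norm_nonneg (h v)]

/-- After rescaling and cutting off, a coefficient `μ` which vanishes at the origin has an inverse
Fourier transform of small `L¹` norm: all derivatives of `χ x * μ (δ x)` are of order `δ`. -/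
lemma exists_small_rescaling {μ : ℂ → ℂ} (hμ : ContDiff ℝ ∞ μ) (hμc : HasCompactSupport μ)
    (hμ0 : μ 0 = 0) (χ : 𝓢(ℂ, ℂ)) (hχ : HasCompactSupport χ) :
    ∃ (δ : ℝ) (ν : 𝓢(ℂ, ℂ)), 0 < δ ∧ (∀ x, ν x = χ x * μ (δ • x)) ∧ ∫ ξ, ‖(𝓕⁻ ν) ξ‖ < 1 / 2 := by
  have hcd : ∀ δ : ℝ, ContDiff ℝ ∞ fun x : ℂ => μ (δ • x) := fun δ =>
    hμ.comp (contDiff_const_smul δ)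
  have hcs : ∀ δ : ℝ, HasCompactSupport fun x => χ x * μ (δ • x) := fun δ => hχ.mul_right
  set ν : ℝ → 𝓢(ℂ, ℂ) := fun δ => (hcs δ).toSchwartzMap ((χ.smooth ⊤).mul (hcd δ)) with hν
  have hνa : ∀ δ x, ν δ x = χ x * μ (δ • x) := fun δ x => rfl
  -- all derivatives of `μ` are bounded
  have hB : ∀ j : ℕ, ∃ B, ∀ x, ‖iteratedFDeriv ℝ j μ x‖ ≤ B := fun j =>
    (hμc.iteratedFDeriv (𝕜 := ℝ) j).exists_bound_of_continuous
      (hμ.continuous_iteratedFDeriv (by exact_mod_cast le_top))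
  choose B hB using hB
  have hB0 : ∀ j, 0 ≤ B j := fun j => (norm_nonneg _).trans (hB j 0)
  have hscale : ∀ (j : ℕ) (δ : ℝ), 0 < δ → δ ≤ 1 → ∀ x : ℂ,
      ‖iteratedFDeriv ℝ j (fun x : ℂ => μ (δ • x)) x‖ ≤ δ * ((B j + B 1) * (1 + ‖x‖)) := by
    intro j δ h0 h1 x
    cases j with
    | zero =>
      rw [norm_iteratedFDeriv_zero]
      have hl : ‖μ (δ • x) - μ 0‖ ≤ B 1 * ‖δ • x - 0‖ := by
        refine Convex.norm_image_sub_le_of_norm_fderiv_le (𝕜 := ℝ) (s := Set.univ)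
          (fun y _ => (hμ.differentiable (by simp)) y) (fun y _ => ?_) convex_univ
          (Set.mem_univ _) (Set.mem_univ _)
        rw [← norm_iteratedFDeriv_one]; exact hB 1 y
      rw [hμ0, sub_zero, sub_zero, norm_smul, Real.norm_of_nonneg h0.le] at hl
      have := hB0 0
      have := hB0 1
      calc _ ≤ δ * (B 1 * ‖x‖) := by rw [mul_left_comm]; exact hl
        _ ≤ _ := by
          gcongr
          · linarith
          · linarith
    | succ j =>
      rw [iteratedFDeriv_comp_const_smul δ (hμ.of_le (by exact_mod_cast le_top))]
      rw [norm_smul, norm_pow, Real.norm_of_nonneg h0.le]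
      have h2 : δ ^ (j + 1) ≤ δ := by
        rw [pow_succ]; exact mul_le_of_le_one_left h0.le (pow_le_one₀ h0.le h1)
      have := hB0 1
      have h3 := hB (j + 1) (δ • x)
      have := hB0 (j + 1)
      calc δ ^ (j + 1) * ‖iteratedFDeriv ℝ (j + 1) μ (δ • x)‖ ≤ δ * B (j + 1) := by gcongr
        _ ≤ _ := by
          gcongr
          nlinarith [norm_nonneg x]
  set K : ℕ → ℂ → ℝ := fun n x => ∑ i ∈ Finset.range (n + 1),
    (n.choose i : ℝ) * (B (n - i) + B 1) *
      (‖x‖ ^ 0 * ‖iteratedFDeriv ℝ i χ x‖ + ‖x‖ ^ 1 * ‖iteratedFDeriv ℝ i χ x‖) with hK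
  have hKint : ∀ n, Integrable (K n) := fun n => integrable_finsetSum _ fun i _ =>
    ((χ.integrable_pow_mul_iteratedFDeriv volume 0 i).add
      (χ.integrable_pow_mul_iteratedFDeriv volume 1 i)).const_mul _
  have hder : ∀ (n : ℕ) (δ : ℝ), 0 < δ → δ ≤ 1 → ∀ x : ℂ,
      ‖iteratedFDeriv ℝ n (ν δ) x‖ ≤ δ * K n x := by
    intro n δ h0 h1 x
    have := norm_iteratedFDeriv_mul_le (χ.smooth ⊤) (hcd δ) x (n := n) (by exact_mod_cast le_top)
    calc ‖iteratedFDeriv ℝ n (ν δ) x‖ ≤ _ := this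
      _ ≤ ∑ i ∈ Finset.range (n + 1), (n.choose i : ℝ) * ‖iteratedFDeriv ℝ i χ x‖ *
          (δ * ((B (n - i) + B 1) * (1 + ‖x‖))) := by
        gcongr with i hi
        exact hscale _ δ h0 h1 x
      _ = _ := by
        rw [hK, Finset.mul_sum]
        refine Finset.sum_congr rfl fun i _ => ?_
        ring
  set P := (volume : Measure ℂ).integrablePower with hP
  -- bound on the transform
  have hinvsup : ∀ (n : ℕ) (δ : ℝ), 0 < δ → δ ≤ 1 → ∀ ξ : ℂ, ‖ξ‖ ^ n * ‖(𝓕⁻ (ν δ)) ξ‖ ≤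
      δ * (2 ^ n * ∑ p ∈ Finset.range (0 + 1) ×ˢ Finset.range (n + 1), ∫ x, K p.2 x) := by
    intro n δ h0 h1 ξ
    have h2 := Real.pow_mul_norm_iteratedFDeriv_fourier_le (K := ⊤) (N := ⊤) ((ν δ).smooth ⊤)
      (fun k n _ _ => (ν δ).integrable_pow_mul_iteratedFDeriv volume k n)
      (k := 0) (n := n) le_top le_top (-ξ)
    rw [norm_iteratedFDeriv_zero, norm_neg] at h2
    rw [SchwartzMap.fourierInv_coe, Real.fourierInv_eq_fourier_neg]
    refine h2.trans ?_
    simp only [pow_zero, one_mul, CharP.cast_eq_zero, mul_zero, zero_add]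
    rw [mul_left_comm δ]
    gcongr
    rw [Finset.mul_sum]
    refine Finset.sum_le_sum fun p hp => ?_
    have hp0 : p.1 = 0 := by
      have := (Finset.mem_product.1 hp).1
      simpa using this
    rw [hp0, ← integral_const_mul]
    refine integral_mono ((ν δ).integrable_pow_mul_iteratedFDeriv volume 0 p.2)
      ((hKint p.2).const_mul δ) fun x => ?_
    simpa using hder p.2 δ h0 h1 x
  obtain ⟨S, hS⟩ : ∃ S : ℕ → ℝ, ∀ (n : ℕ) (δ : ℝ), 0 < δ → δ ≤ 1 → ∀ ξ : ℂ,
      ‖ξ‖ ^ n * ‖(𝓕⁻ (ν δ)) ξ‖ ≤ δ * S n := ⟨_, hinvsup⟩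
  set I0 := 2 ^ P * (∫ x : ℂ, (1 + ‖x‖) ^ (-(P : ℝ))) with hI0
  have hfin : ∀ δ : ℝ, 0 < δ → δ ≤ 1 → ∫ ξ, ‖(𝓕⁻ (ν δ)) ξ‖ ≤ δ * (I0 * (S 0 + S P)) := by
    intro δ h0 h1
    have := integral_pow_mul_le_of_le_of_pow_mul_le (μ := (volume : Measure ℂ)) (k := 0)
      (f := ((𝓕⁻ (ν δ) : 𝓢(ℂ, ℂ)) : ℂ → ℂ)) (C₁ := δ * S 0) (C₂ := δ * S P)
      (fun x => by simpa using hS 0 δ h0 h1 x) (fun x => by simpa using hS P δ h0 h1 x)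
    simp only [pow_zero, one_mul] at this
    calc _ ≤ _ := this
      _ = _ := by rw [hI0]; ring
  set T := |I0 * (S 0 + S P)| with hT
  have hT0 : 0 ≤ T := abs_nonneg _
  refine ⟨(1 / (2 * (T + 1))), ν (1 / (2 * (T + 1))), by positivity, hνa _, ?_⟩
  have h1 : (1 / (2 * (T + 1))) ≤ 1 := by
    rw [div_le_one (by positivity)]; linarith
  refine (hfin _ (by positivity) h1).trans_lt ?_
  have h2 : I0 * (S 0 + S P) < T + 1 := (le_abs_self _).trans_lt (by linarith)
  calc 1 / (2 * (T + 1)) * (I0 * (S 0 + S P)) < 1 / (2 * (T + 1)) * (T + 1) := by gcongr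
    _ = 1 / 2 := by field_simp

lemma dζbar_comp_smul {g : ℂ → ℂ} (hg : Differentiable ℝ g) (c : ℝ) (w : ℂ) :
    dζbar (fun w => g (c • w)) w = c * dζbar g (c • w) ∧
      dζ (fun w => g (c • w)) w = c * dζ g (c • w) := by
  have h : fderiv ℝ (fun w => g (c • w)) w = c • fderiv ℝ g (c • w) := by
    have h1 : HasFDerivAt (fun w : ℂ => c • w) (c • ContinuousLinearMap.id ℝ ℂ) w :=
      (hasFDerivAt_id w).const_smul c
    have h2 := ((hg (c • w)).hasFDerivAt.comp w h1).fderiv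
    refine h2.trans ?_
    ext <;> simp
  rw [dζbar, dζ, h, dζbar, dζ]
  simp only [FunLike.coe_smul, Pi.smul_apply, Complex.real_smul]
  constructor
  · ring
  · ring

/-- Local solvability of the Beltrami equation with a smooth coefficient. The solution is
`w ↦ w / δ + u (w / δ)`, where `u` solves the inhomogeneous equation for the rescaled
coefficient. -/
theorem exists_local_beltrami {μ : ℂ → ℂ} {r : ℝ} (hr : 0 < r)
    (hμ : ContDiffOn ℝ ∞ μ (Metric.ball 0 r)) (hμ0 : μ 0 = 0) :
    ∃ f : ℂ → ℂ, ContDiff ℝ ∞ f ∧ (∀ᶠ w in 𝓝 (0 : ℂ), dζbar f w = μ w * dζ f w) ∧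
      ∀ w, dζ f w ≠ 0 := by
  let b : ContDiffBump (0 : ℂ) := ⟨r / 3, r / 2, by positivity, by linarith⟩
  have hbsupp : tsupport (fun w => (b w : ℂ) * μ w) ⊆ Metric.ball 0 r := by
    have h1 : tsupport (fun w => (b w : ℂ) * μ w) ⊆ tsupport b := by
      refine closure_mono fun w hw => ?_
      rw [Function.mem_support] at hw ⊢
      intro h0
      exact hw (by simp [h0])
    refine h1.trans ?_
    rw [b.tsupport_eq]
    exact Metric.closedBall_subset_ball (by change r / 2 < r; linarith)
  have hsm : ContDiff ℝ ∞ (fun w => (b w : ℂ) * μ w) := by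
    rw [contDiff_iff_contDiffAt]
    intro w
    by_cases hw : w ∈ tsupport (fun w => (b w : ℂ) * μ w)
    · exact (Complex.ofRealCLM.contDiff.comp b.contDiff).contDiffAt.mul
        (hμ.contDiffAt (Metric.isOpen_ball.mem_nhds (hbsupp hw)))
    · refine (contDiffAt_const (c := (0 : ℂ))).congr_of_eventuallyEq ?_
      exact notMem_tsupport_iff_eventuallyEq.1 hw
  have hcs : HasCompactSupport (fun w => (b w : ℂ) * μ w) :=
    (b.hasCompactSupport.comp_left Complex.ofReal_zero).mul_right
  let c : ContDiffBump (0 : ℂ) := ⟨1, 2, by norm_num, by norm_num⟩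
  have hccs : HasCompactSupport fun w => (c w : ℂ) :=
    c.hasCompactSupport.comp_left Complex.ofReal_zero
  have hcsm : ContDiff ℝ ∞ fun w => (c w : ℂ) := Complex.ofRealCLM.contDiff.comp c.contDiff
  obtain ⟨δ, ν, hδ, hν, hlt⟩ := exists_small_rescaling hsm hcs (by simp [hμ0])
    (hccs.toSchwartzMap hcsm) hccs
  have hinv : 𝓕 (𝓕⁻ ν) = ν := FourierTransform.fourier_fourierInv_eq ν
  generalize (𝓕⁻ ν : 𝓢(ℂ, ℂ)) = a at hinv hlt
  obtain ⟨u, hu, hueq⟩ := exists_beltrami_of_fourier (ν := ν) (a := a)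
    (fun x => by rw [← SchwartzMap.fourier_coe, hinv]) a.continuous
    (fun ξ => SchwartzMap.norm_le_seminorm ℝ a ξ) (fun n => a.integrable_pow_mul volume n) hlt
  set g : ℂ → ℂ := fun w => w + u w with hg
  have hgs : ContDiff ℝ ∞ g := contDiff_id.add hu
  have hud : Differentiable ℝ u := hu.differentiable (by simp)
  have hgd : Differentiable ℝ g := hgs.differentiable (by simp)
  have hgf : ∀ w, fderiv ℝ g w = ContinuousLinearMap.id ℝ ℂ + fderiv ℝ u w := fun w => by
    exact ((hasFDerivAt_id w).add (hud w).hasFDerivAt).fderiv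
  have hg1 : ∀ w, dζbar g w = dζbar u w := fun w => by
    simp only [dζbar, hgf, FunLike.coe_add, Pi.add_apply, ContinuousLinearMap.id_apply]
    linear_combination (1 / 2) * Complex.I_mul_I
  have hg2 : ∀ w, dζ g w = 1 + dζ u w := fun w => by
    simp only [dζ, hgf, FunLike.coe_add, Pi.add_apply, ContinuousLinearMap.id_apply]
    linear_combination -(1 / 2) * Complex.I_mul_I
  have hδ' : (δ : ℂ)⁻¹ ≠ 0 := inv_ne_zero (by exact_mod_cast hδ.ne')
  refine ⟨fun w => g (δ⁻¹ • w), hgs.comp (contDiff_const_smul _), ?_, fun w => ?_⟩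
  · have e1 : ∀ᶠ w in 𝓝 (0 : ℂ), w ∈ Metric.ball (0 : ℂ) (r / 3) :=
      Metric.ball_mem_nhds _ (by positivity)
    have e2 : ∀ᶠ w in 𝓝 (0 : ℂ), w ∈ Metric.ball (0 : ℂ) δ := Metric.ball_mem_nhds _ hδ
    filter_upwards [e1, e2] with w h1 h2
    rw [(dζbar_comp_smul hgd _ w).1, (dζbar_comp_smul hgd _ w).2, hg1, hg2, (hueq _).1, hν]
    have hb1 : b w = 1 := b.one_of_mem_closedBall (Metric.ball_subset_closedBall h1)
    have hc1 : c (δ⁻¹ • w) = 1 := by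
      refine c.one_of_mem_closedBall ?_
      rw [mem_closedBall_zero_iff, norm_smul, norm_inv, Real.norm_of_nonneg hδ.le]
      rw [mem_ball_zero_iff] at h2
      change δ⁻¹ * ‖w‖ ≤ 1
      rw [inv_mul_le_one₀ hδ]
      exact h2.le
    have hcv : (hccs.toSchwartzMap hcsm) (δ⁻¹ • w) = (c (δ⁻¹ • w) : ℂ) := rfl
    rw [hcv, hc1, smul_inv_smul₀ hδ.ne', hb1]
    push_cast
    ring
  · rw [(dζbar_comp_smul hgd _ w).2, hg2]
    push_cast
    refine mul_ne_zero hδ' fun h0 => ?_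
    have h1 := (hueq (δ⁻¹ • w)).2
    have h2 : dζ u (δ⁻¹ • w) = -1 := by linear_combination h0
    rw [h2] at h1
    simp at h1

/-! ### Smooth dependence of integral curves on their initial point -/

section InverseFunction

variable {E F : Type*} [NormedAddCommGroup E] [NormedSpace ℝ E] [CompleteSpace E]
  [NormedAddCommGroup F] [NormedSpace ℝ F]

/-- The inverse function theorem, with the smoothness of the inverse on the whole target. -/
theorem exists_openPartialHomeomorph_contDiffOn {f : E → F} {U : Set E} (hU : IsOpen U)
    (hf : ContDiffOn ℝ ∞ f U) {a : E} (ha : a ∈ U) (e : E ≃L[ℝ] F)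
    (he : fderiv ℝ f a = e) :
    ∃ Φ : OpenPartialHomeomorph E F, a ∈ Φ.source ∧ Φ.source ⊆ U ∧ (∀ x, Φ x = f x) ∧
      ContDiffOn ℝ ∞ Φ.symm Φ.target := by
  have hfa : ContDiffAt ℝ ∞ f a := hf.contDiffAt (hU.mem_nhds ha)
  have hd : HasFDerivAt f (e : E →L[ℝ] F) a :=
    he ▸ (hfa.differentiableAt (by simp)).hasFDerivAt
  set Ψ := hfa.toOpenPartialHomeomorph f hd (by simp) with hΨ
  have hΨf : ∀ x, Ψ x = f x := fun x => rfl
  set W : Set E := U ∩ (fderiv ℝ f) ⁻¹' Set.range ((↑) : (E ≃L[ℝ] F) → E →L[ℝ] F) with hW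
  have hWo : IsOpen W :=
    (hf.continuousOn_fderiv_of_isOpen hU (by simp)).isOpen_inter_preimage hU
      ContinuousLinearEquiv.isOpen
  have haW : a ∈ W := ⟨ha, e, he.symm⟩
  refine ⟨Ψ.restrOpen W hWo, ⟨hfa.mem_toOpenPartialHomeomorph_source hd (by simp), haW⟩,
    fun x hx => hx.2.1, fun x => rfl, fun y hy => ?_⟩
  have hy' : y ∈ Ψ.target := hy.1
  have hyW : Ψ.symm y ∈ W := by
    have := (Ψ.restrOpen W hWo).map_target hy
    exact this.2
  obtain ⟨hyU, e', he'⟩ := hyW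
  refine ContDiffAt.contDiffWithinAt ?_
  have h1 : ContDiffAt ℝ ∞ f (Ψ.symm y) := hf.contDiffAt (hU.mem_nhds hyU)
  refine Ψ.contDiffAt_symm (f₀' := e') hy' ?_ h1
  rw [he']
  exact (h1.differentiableAt (by simp)).hasFDerivAt

end InverseFunction

section Nemytskii

universe u

variable {K : Type*} [TopologicalSpace K] [CompactSpace K]
  {E F : Type u} [NormedAddCommGroup E] [NormedSpace ℝ E] [NormedAddCommGroup F] [NormedSpace ℝ F]

/-- The pointwise application of a curve of operators to a curve of vectors, as a continuous bilinear
map. -/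
noncomputable def pointwiseApply (K : Type*) [TopologicalSpace K] [CompactSpace K]
    (E F : Type u) [NormedAddCommGroup E] [NormedSpace ℝ E] [NormedAddCommGroup F]
    [NormedSpace ℝ F] : C(K, E →L[ℝ] F) →L[ℝ] C(K, E) →L[ℝ] C(K, F) :=
  LinearMap.mkContinuous₂
    (LinearMap.mk₂ ℝ (fun (A : C(K, E →L[ℝ] F)) (h : C(K, E)) =>
        (⟨fun s => A s (h s), A.continuous.clm_apply h.continuous⟩ : C(K, F)))
      (fun A B h => by ext; simp) (fun c A h => by ext; simp) (fun A h k => by ext; simp)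
      (fun c A h => by ext; simp)) 1 (fun A h => by
        rw [one_mul]
        refine (ContinuousMap.norm_le _ (by positivity)).2 fun s => ?_
        exact ((A s).le_opNorm _).trans (by gcongr <;> exact ContinuousMap.norm_coe_le_norm _ s))

lemma hasFDerivAt_comp_left {f : E → F} {f' : E → E →L[ℝ] F} (hf : ∀ x, HasFDerivAt f (f' x) x)
    (hc : Continuous f) (hc' : Continuous f') (α : C(K, E)) :
    HasFDerivAt (fun α : C(K, E) => (⟨f, hc⟩ : C(E, F)).comp α)
      (pointwiseApply K E F ((⟨f', hc'⟩ : C(E, E →L[ℝ] F)).comp α)) α := by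
  rw [hasFDerivAt_iff_isLittleO_nhds_zero, Asymptotics.isLittleO_iff]
  intro c hc0
  have hcont : Continuous fun β : C(K, E) => (⟨f', hc'⟩ : C(E, E →L[ℝ] F)).comp β :=
    ContinuousMap.continuous_postcomp _
  obtain ⟨δ, hδ, hδc⟩ := (Metric.continuous_iff (α := C(K, E))
      (β := C(K, E →L[ℝ] F))).1 hcont α c hc0
  filter_upwards [Metric.ball_mem_nhds (0 : C(K, E)) hδ] with h hh
  rw [mem_ball_zero_iff] at hh
  refine (ContinuousMap.norm_le _ (by positivity)).2 fun s => ?_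
  have key : ‖f (α s + h s) - f (α s) - f' (α s) (α s + h s - α s)‖ ≤ c * ‖α s + h s - α s‖ := by
    refine Convex.norm_image_sub_le_of_norm_hasFDerivWithin_le' (𝕜 := ℝ) (f' := f')
      (s := segment ℝ (α s) (α s + h s)) (fun x _ => (hf x).hasFDerivWithinAt) (fun x hx => ?_)
      (convex_segment _ _) (left_mem_segment _ _ _) (right_mem_segment _ _ _)
    rw [segment_eq_image'] at hx
    obtain ⟨t, ht, rfl⟩ := hx
    have h1 : dist (α + t • h) α < δ := by
      rw [dist_eq_norm, add_sub_cancel_left, norm_smul, Real.norm_of_nonneg ht.1]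
      exact (mul_le_of_le_one_left (norm_nonneg _) ht.2).trans_lt hh
    have h2 := (ContinuousMap.dist_apply_le_dist s).trans (hδc _ h1).le
    rw [dist_eq_norm] at h2
    simpa using h2
  rw [add_sub_cancel_left] at key
  exact key.trans (by gcongr; exact ContinuousMap.norm_coe_le_norm _ s)

/-- Composition with a smooth map `f` is a map of class `C ^ n` on the space of continuous curves. By
induction on `n`: its derivative is composition with the derivative of `f`,
    followed by the pointwise
application. -/
lemma contDiff_comp_left_nat (n : ℕ) : ∀ {F : Type u} [NormedAddCommGroup F] [NormedSpace ℝ F]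
    {f : E → F} (hf : ContDiff ℝ ∞ f),
    ContDiff ℝ n (fun α : C(K, E) => (⟨f, hf.continuous⟩ : C(E, F)).comp α) := by
  induction n with
  | zero =>
    intro F _ _ f hf
    exact contDiff_zero.2 (ContinuousMap.continuous_postcomp _)
  | succ n ih =>
    intro F _ _ f hf
    have hf' : ContDiff ℝ ∞ (fderiv ℝ f) := (contDiff_infty_iff_fderiv.1 hf).2
    have hL : ContDiff ℝ n fun A : C(K, E →L[ℝ] F) => pointwiseApply K E F A := by
      fun_prop
    refine contDiff_succ_iff_hasFDerivAt.2 ⟨fun α => pointwiseApply K E F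
      ((⟨fderiv ℝ f, hf'.continuous⟩ : C(E, E →L[ℝ] F)).comp α), hL.comp (ih hf'),
      fun α => hasFDerivAt_comp_left
        (fun x => (hf.differentiable (by simp) x).hasFDerivAt) _ _ α⟩

lemma contDiff_comp_left {f : E → F} (hf : ContDiff ℝ ∞ f) :
    ContDiff ℝ ∞ (fun α : C(K, E) => (⟨f, hf.continuous⟩ : C(E, F)).comp α) :=
  contDiff_infty.2 fun n => contDiff_comp_left_nat n hf

end Nemytskii

section Flow

variable {E : Type} [NormedAddCommGroup E] [NormedSpace ℝ E] [CompleteSpace E]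

/-- The primitive vanishing at `0`, as an operator on curves `[-1, 1] → E`. -/
noncomputable def primitive (E : Type) [NormedAddCommGroup E] [NormedSpace ℝ E] [CompleteSpace E] :
    C(Set.Icc (-1 : ℝ) 1, E) →L[ℝ] C(Set.Icc (-1 : ℝ) 1, E) :=
  LinearMap.mkContinuous
    { toFun := fun α => ⟨fun s => ∫ t in (0 : ℝ)..s,
        α (Set.projIcc (-1) 1 (neg_le_self zero_le_one) t), by
        have h : Continuous fun t => α (Set.projIcc (-1) 1 (neg_le_self zero_le_one) t) :=
          α.continuous.comp continuous_projIcc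
        exact (intervalIntegral.continuous_primitive (fun a b => h.intervalIntegrable a b) 0).comp
          continuous_subtype_val⟩
      map_add' := fun α β => by
        ext s
        have h : ∀ α : C(Set.Icc (-1 : ℝ) 1, E), Continuous fun t =>
            α (Set.projIcc (-1) 1 (neg_le_self zero_le_one) t) := fun α =>
          α.continuous.comp continuous_projIcc
        simp only [ContinuousMap.coe_mk, ContinuousMap.add_apply]
        exact intervalIntegral.integral_add ((h α).intervalIntegrable _ _)
          ((h β).intervalIntegrable _ _)
      map_smul' := fun c α => by
        ext s
        simp only [ContinuousMap.coe_mk, ContinuousMap.smul_apply, RingHom.id_apply]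
        exact intervalIntegral.integral_smul _ _ } 1 (fun α => by
      rw [one_mul]
      refine (ContinuousMap.norm_le _ (by positivity)).2 fun s => ?_
      have h := intervalIntegral.norm_integral_le_of_norm_le_const (a := (0 : ℝ)) (b := s)
        (f := fun t => α (Set.projIcc (-1) 1 (neg_le_self zero_le_one) t)) (C := ‖α‖)
        fun t _ => ContinuousMap.norm_coe_le_norm _ _
      refine h.trans (mul_le_of_le_one_right (norm_nonneg _) ?_)
      rw [sub_zero, abs_le]
      exact s.2)

/-- Integral curves of `ε X` on the time interval `[-1, 1]` depend smoothly on `ε` and on their initial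
point. This is the inverse function theorem for the integral equation `α = y +
    ε ∫ X ∘ α` in the Banach
space of continuous curves. -/
lemma exists_smooth_integral_curves {X : E → E} (hX : ContDiff ℝ ∞ X) (y₀ : E) :
    ∃ (W : Set (ℝ × E)) (α : ℝ × E → C(Set.Icc (-1 : ℝ) 1, E)), IsOpen W ∧ (0, y₀) ∈ W ∧
      ContDiffOn ℝ ∞ α W ∧ ∀ p ∈ W, ∀ s : Set.Icc (-1 : ℝ) 1,
        α p s = p.2 + p.1 • ∫ t in (0 : ℝ)..s,
            X (α p (Set.projIcc (-1) 1 (neg_le_self zero_le_one) t)) := by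
  let B := C(Set.Icc (-1 : ℝ) 1, E)
  let c : E →L[ℝ] B := ContinuousLinearMap.const ℝ _
  let N : B → B := fun β => (⟨X, hX.continuous⟩ : C(E, E)).comp β
  have hN : ContDiff ℝ ∞ N := contDiff_comp_left hX
  let G : (ℝ × E) × B → B := fun z => z.2 - c z.1.2 - z.1.1 • primitive E (N z.2)
  have hG : ContDiff ℝ ∞ G := by
    refine ContDiff.sub (contDiff_snd.sub (c.contDiff.comp (contDiff_snd.comp contDiff_fst))) ?_
    exact (contDiff_fst.comp contDiff_fst).smul
      ((primitive E).contDiff.comp (hN.comp contDiff_snd))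
  let β₀ : B := c y₀
  have hGd : HasFDerivAt G (ContinuousLinearMap.snd ℝ (ℝ × E) B
      - c ∘L (ContinuousLinearMap.snd ℝ ℝ E) ∘L (ContinuousLinearMap.fst ℝ (ℝ × E) B)
      - ((ContinuousLinearMap.fst ℝ ℝ E) ∘L (ContinuousLinearMap.fst ℝ (ℝ × E) B)).smulRight
        (primitive E (N β₀))) ((0, y₀), β₀) := by
    have h1 : HasFDerivAt (fun z : (ℝ × E) × B => z.1.1)
        ((ContinuousLinearMap.fst ℝ ℝ E) ∘L (ContinuousLinearMap.fst ℝ (ℝ × E) B))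
        ((0, y₀), β₀) :=
      ((ContinuousLinearMap.fst ℝ ℝ E) ∘L (ContinuousLinearMap.fst ℝ (ℝ × E) B)).hasFDerivAt
    have h2 : DifferentiableAt ℝ (fun z : (ℝ × E) × B => primitive E (N z.2)) ((0, y₀), β₀) :=
      ((primitive E).contDiff.comp (hN.comp contDiff_snd)).differentiable (n := ∞) (by simp) _
    have h3 := h1.smul h2.hasFDerivAt
    have h4 : HasFDerivAt (fun z : (ℝ × E) × B => z.2 - c z.1.2)
        (ContinuousLinearMap.snd ℝ (ℝ × E) B
      - c ∘L (ContinuousLinearMap.snd ℝ ℝ E) ∘L (ContinuousLinearMap.fst ℝ (ℝ × E) B))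
        ((0, y₀), β₀) :=
      (ContinuousLinearMap.snd ℝ (ℝ × E) B
      - c ∘L (ContinuousLinearMap.snd ℝ ℝ E) ∘L (ContinuousLinearMap.fst ℝ (ℝ × E) B)).hasFDerivAt
    refine (h4.sub h3).congr_fderiv ?_
    congr 1
    simp
  let Φ : (ℝ × E) × B → (ℝ × E) × B := fun z => (z.1, G z)
  have hΦ : ContDiff ℝ ∞ Φ := contDiff_fst.prodMk hG
  let T : (ℝ × E) →L[ℝ] B := c ∘L (ContinuousLinearMap.snd ℝ ℝ E) +
    (ContinuousLinearMap.fst ℝ ℝ E).smulRight (primitive E (N β₀))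
  let e : ((ℝ × E) × B) ≃L[ℝ] ((ℝ × E) × B) := ContinuousLinearEquiv.equivOfInverse
    ((ContinuousLinearMap.fst ℝ (ℝ × E) B).prod
      (ContinuousLinearMap.snd ℝ (ℝ × E) B - T ∘L ContinuousLinearMap.fst ℝ (ℝ × E) B))
    ((ContinuousLinearMap.fst ℝ (ℝ × E) B).prod
      (ContinuousLinearMap.snd ℝ (ℝ × E) B + T ∘L ContinuousLinearMap.fst ℝ (ℝ × E) B))
    (fun z => by ext1 <;> simp) (fun z => by ext1 <;> simp)
  have hΦd : fderiv ℝ Φ ((0, y₀), β₀) = e := by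
    have h1 : HasFDerivAt (fun z : (ℝ × E) × B => z.1) (ContinuousLinearMap.fst ℝ (ℝ × E) B)
        ((0, y₀), β₀) := hasFDerivAt_fst
    refine (h1.prodMk hGd).fderiv.trans ?_
    refine ContinuousLinearMap.ext fun z => Prod.ext rfl ?_
    simp only [T, e, ContinuousLinearMap.prod_apply, FunLike.coe_sub, Pi.sub_apply,
      ContinuousLinearEquiv.coe_coe, ContinuousLinearEquiv.equivOfInverse_apply,
      ContinuousLinearMap.comp_apply, FunLike.coe_add, Pi.add_apply]
    abel
  obtain ⟨Θ, hΘ0, -, hΘf, hΘs⟩ := exists_openPartialHomeomorph_contDiffOn isOpen_univ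
    hΦ.contDiffOn (Set.mem_univ _) e hΦd
  have hΦ0 : Φ ((0, y₀), β₀) = ((0, y₀), 0) := by
    simp [Φ, G, β₀]
  have hcontp : Continuous fun p : ℝ × E => (p, (0 : B)) := by fun_prop
  refine ⟨(fun p : ℝ × E => (p, (0 : B))) ⁻¹' Θ.target, fun p => (Θ.symm (p, 0)).2,
    Θ.open_target.preimage hcontp, ?_, ?_, ?_⟩
  · have := Θ.map_source hΘ0
    rw [hΘf, hΦ0] at this
    exact this
  · exact contDiff_snd.comp_contDiffOn (hΘs.comp (contDiff_id.prodMk contDiff_const).contDiffOn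
      fun p hp => hp)
  · intro p hp s
    have h1 := Θ.right_inv hp
    rw [hΘf] at h1
    have h2 : (Θ.symm (p, 0)).1 = p := congrArg Prod.fst h1
    have h3 : G (Θ.symm (p, 0)) = 0 := congrArg Prod.snd h1
    simp only [G, h2] at h3
    have h4 : (Θ.symm (p, 0)).2 s - p.2 - p.1 • ∫ t in (0 : ℝ)..s,
        X ((Θ.symm (p, 0)).2 (Set.projIcc (-1) 1 (neg_le_self zero_le_one) t)) = 0 :=
            DFunLike.congr_fun h3 s
    rwa [sub_eq_zero, sub_eq_iff_eq_add'] at h4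

/-- The local flow of a smooth vector field is smooth. The value of the flow at time `t` is the value
at time `1` of the integral curve of `t X`. -/
theorem exists_local_flow {X : E → E} (hX : ContDiff ℝ ∞ X) {L : NNReal} (hL : LipschitzWith L X)
    (y₀ : E) :
    ∃ (r : ℝ) (Fl : ℝ × E → E), 0 < r ∧
      ContDiffOn ℝ ∞ Fl (Metric.ball (0, y₀) r) ∧
      (∀ p ∈ Metric.ball ((0 : ℝ), y₀) r, HasDerivAt (fun t => Fl (t, p.2)) (X (Fl p)) p.1) ∧
      ∀ y ∈ Metric.ball y₀ r, Fl (0, y) = y := by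
  obtain ⟨W, α, hW, hW0, hα, hαeq⟩ := exists_smooth_integral_curves hX y₀
  obtain ⟨r, hr, hrW⟩ := Metric.isOpen_iff.1 hW _ hW0
  set one : Set.Icc (-1 : ℝ) 1 := ⟨1, by norm_num⟩ with hone
  let A : ℝ × E → ℝ → E := fun p s =>
    p.2 + p.1 • ∫ t in (0 : ℝ)..s, X (α p (Set.projIcc (-1) 1 (neg_le_self zero_le_one) t))
  have hA : ∀ p s, HasDerivAt (A p) (p.1 • X (α p (Set.projIcc (-1) 1 (neg_le_self zero_le_one) s)))
      s := by
    intro p s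
    have hcont : Continuous fun t => X (α p (Set.projIcc (-1) 1 (neg_le_self zero_le_one) t)) :=
      hX.continuous.comp ((α p).continuous.comp continuous_projIcc)
    exact ((hcont.integral_hasStrictDerivAt 0 s).hasDerivAt.const_smul p.1).const_add p.2
  have hAα : ∀ p ∈ W, ∀ (s : ℝ) (hs : s ∈ Set.Icc (-1 : ℝ) 1), α p ⟨s, hs⟩ = A p s :=
    fun p hp s hs => hαeq p hp ⟨s, hs⟩
  have hA' : ∀ p ∈ W, ∀ s ∈ Set.Icc (-1 : ℝ) 1, HasDerivAt (A p) (p.1 • X (A p s)) s := by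
    intro p hp s hs
    have := hA p s
    rwa [Set.projIcc_of_mem _ hs, hAα p hp s hs] at this
  -- the time-one values of the rescaled curves lie on a single integral curve
  have hmem : ∀ t y, |t| ≤ r / 2 → y ∈ Metric.ball y₀ (r) → (t, y) ∈ W := by
    intro t y ht hy
    refine hrW ?_
    rw [← ball_prod_same]
    refine ⟨?_, hy⟩
    rw [mem_ball_zero_iff, Real.norm_eq_abs]
    linarith
  have huniq : ∀ t y, |t| ≤ r / 2 → y ∈ Metric.ball y₀ r →
      α (t, y) one = A (r / 2, y) (t / (r / 2)) := by
    intro t y ht hy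
    have hr2 : 0 < r / 2 := by positivity
    have hp := hmem t y ht hy
    have hq := hmem (r / 2) y (by rw [abs_of_pos hr2]) hy
    have habs : |t / (r / 2)| ≤ 1 := by
      rw [abs_div, abs_of_pos hr2]; exact (div_le_one hr2).2 ht
    have hin : ∀ s ∈ Set.Icc (0 : ℝ) 1, s * (t / (r / 2)) ∈ Set.Icc (-1 : ℝ) 1 := by
      intro s hs
      rw [Set.mem_Icc, ← abs_le, abs_mul, abs_of_nonneg hs.1]
      exact mul_le_one₀ hs.2 (abs_nonneg _) habs
    have hd1 : ∀ s ∈ Set.Icc (0 : ℝ) 1, HasDerivAt (A (t, y)) (t • X (A (t, y) s)) s :=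
      fun s hs => hA' _ hp s ⟨by linarith [hs.1], hs.2⟩
    have hd2 : ∀ s ∈ Set.Icc (0 : ℝ) 1, HasDerivAt (fun s => A (r / 2, y) (s * (t / (r / 2))))
        (t • X (A (r / 2, y) (s * (t / (r / 2))))) s := by
      intro s hs
      have h1 := hA' _ hq _ (hin s hs)
      have h2 : HasDerivAt (fun s : ℝ => s * (t / (r / 2))) (t / (r / 2)) s := by
        simpa using (hasDerivAt_id s).mul_const (t / (r / 2))
      have h3 := h1.scomp s h2
      rw [smul_smul] at h3
      have h4 : t / (r / 2) * (r / 2, y).1 = t := div_mul_cancel₀ _ hr2.ne'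
      rw [h4] at h3
      exact h3
    have := ODE_solution_unique (v := fun _ x => t • X x) (K := ‖t‖₊ * L) (a := 0) (b := 1)
      (f := A (t, y)) (g := fun s => A (r / 2, y) (s * (t / (r / 2))))
      (fun _ => (lipschitzWith_smul t).comp hL)
      (fun s hs => (hd1 s hs).continuousAt.continuousWithinAt)
      (fun s hs => (hd1 s (Set.Ico_subset_Icc_self hs)).hasDerivWithinAt)
      (fun s hs => (hd2 s hs).continuousAt.continuousWithinAt)
      (fun s hs => (hd2 s (Set.Ico_subset_Icc_self hs)).hasDerivWithinAt)
      (by simp [A]) (Set.right_mem_Icc.2 zero_le_one)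
    rw [hAα _ hp 1 one.2]
    refine this.trans ?_
    dsimp only
    rw [one_mul]
  have hr2 : 0 < r / 2 := by positivity
  refine ⟨r / 2, fun p => α p one, hr2, ?_, ?_, ?_⟩
  · have h1 : ContDiffOn ℝ ∞ α (Metric.ball (0, y₀) (r / 2)) :=
      hα.mono ((Metric.ball_subset_ball (by linarith)).trans hrW)
    exact (ContinuousMap.evalCLM ℝ one).contDiff.comp_contDiffOn h1
  · rintro ⟨t, y⟩ hp
    rw [← ball_prod_same] at hp
    obtain ⟨ht, hy⟩ := hp
    have hy' : y ∈ Metric.ball y₀ r := Metric.ball_subset_ball (by linarith) hy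
    dsimp only at ht ⊢
    have heq : (fun t => α (t, y) one) =ᶠ[𝓝 t] fun t => A (r / 2, y) (t / (r / 2)) := by
      filter_upwards [Metric.isOpen_ball.mem_nhds ht] with τ hτ
      rw [mem_ball_zero_iff, Real.norm_eq_abs] at hτ
      exact huniq τ y hτ.le hy'
    rw [mem_ball_zero_iff, Real.norm_eq_abs] at ht
    have hq := hmem (r / 2) y (by rw [abs_of_pos hr2]) hy'
    refine HasDerivAt.congr_of_eventuallyEq ?_ heq
    rw [huniq t y ht.le hy']
    have hin : t / (r / 2) ∈ Set.Icc (-1 : ℝ) 1 := by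
      rw [Set.mem_Icc, ← abs_le, abs_div, abs_of_pos hr2]; exact (div_le_one hr2).2 ht.le
    have h3 := (hA' _ hq _ hin).scomp t ((hasDerivAt_id t).div_const (r / 2))
    rw [smul_smul] at h3
    have h4 : 1 / (r / 2) * (r / 2, y).1 = 1 := div_mul_cancel₀ _ hr2.ne'
    rw [h4, one_smul] at h3
    exact h3
  · intro y hy
    have hp := hmem 0 y (by simpa using hr2.le) (Metric.ball_subset_ball (by linarith) hy)
    dsimp only
    rw [hαeq _ hp one]
    simp

end Flow

/-! ### One-forms on normed spaces and integrating factors -/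

section FlatForms

variable {E F : Type*} [NormedAddCommGroup E] [NormedSpace ℝ E]
  [NormedAddCommGroup F] [NormedSpace ℝ F]

/-- The exterior derivative of a one-form on a normed space, evaluated on two vectors. -/
noncomputable def flatExtd (η : E → E →L[ℝ] ℂ) (y u v : E) : ℂ :=
  fderiv ℝ η y u v - fderiv ℝ η y v u

lemma flatExtd_pullback {η : E → E →L[ℝ] ℂ} {g : F → E} {x : F}
    (hη : DifferentiableAt ℝ η (g x)) (hg : ContDiffAt ℝ 2 g x) (u v : F) :
    flatExtd (fun x => η (g x) ∘L fderiv ℝ g x) x u v =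
      flatExtd η (g x) (fderiv ℝ g x u) (fderiv ℝ g x v) := by
  have hgd : DifferentiableAt ℝ g x := hg.differentiableAt (by simp)
  have hg2 : DifferentiableAt ℝ (fderiv ℝ g) x :=
    (hg.fderiv_right (m := 1) (by norm_num)).differentiableAt (by simp)
  have h1 : HasFDerivAt (fun x => η (g x)) (fderiv ℝ η (g x) ∘L fderiv ℝ g x) x :=
    hη.hasFDerivAt.comp x hgd.hasFDerivAt
  have h2 := (h1.clm_comp hg2.hasFDerivAt).fderiv
  have hsymm : fderiv ℝ (fderiv ℝ g) x u v = fderiv ℝ (fderiv ℝ g) x v u :=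
    (hg.isSymmSndFDerivAt (by simp)) u v
  rw [flatExtd, flatExtd, h2]
  simp [hsymm]

lemma flatExtd_congr {η η' : E → E →L[ℝ] ℂ} {y : E} (h : η =ᶠ[𝓝 y] η') (u v : E) :
    flatExtd η y u v = flatExtd η' y u v := by
  rw [flatExtd, flatExtd, h.fderiv_eq]

end FlatForms

lemma clm_prod_apply (A : ℝ × ℂ →L[ℝ] ℂ) (s : ℝ) (v : ℂ) :
    A (s, v) = s * A (1, 0) + v.re * A (0, 1) + v.im * A (0, Complex.I) := by
  have h : ((s, v) : ℝ × ℂ) = s • (1, 0) + v.re • (0, 1) + v.im • (0, Complex.I) := by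
    ext <;> simp
  rw [h]
  simp only [map_add, map_smul, Complex.real_smul]

lemma contDiffOn_div {E : Type*} [NormedAddCommGroup E] [NormedSpace ℝ E] {f g : E → ℂ} {s : Set E}
    {n : WithTop ℕ∞} (hf : ContDiffOn ℝ n f s) (hg : ContDiffOn ℝ n g s) (h : ∀ x ∈ s, g x ≠ 0) :
    ContDiffOn ℝ n (fun x => f x / g x) s := by
  simp only [div_eq_mul_inv]
  exact hf.mul (hg.inv h)

/-- A complex one-form `M` on a three-dimensional space with `M ∧ dM = 0`, whose real and imaginary
parts are independent, is locally the product of a function and an exact form. The flow of a vector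
field in the kernel of `M` gives coordinates `(t, w)` in which `M = P d(re w) + Q d(im w)`. The
integrability condition says that `Q / P` does not depend on `t`, so that only the Beltrami equation
in the plane with the coefficient `(P + i Q) / (P - i Q)` has to be solved. -/
theorem exists_integrating_factor {M : ℝ × ℂ → (ℝ × ℂ →L[ℝ] ℂ)} {U : Set (ℝ × ℂ)} (hU : IsOpen U)
    (h0U : (0 : ℝ × ℂ) ∈ U) (hM : ContDiffOn ℝ ∞ M U) (hM0 : ∀ v, M 0 v = v.2)
    (hint : ∀ p ∈ U, ∀ u v w, flatExtd M p u v * M p w + flatExtd M p v w * M p u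
      + flatExtd M p w u * M p v = 0) :
    ∃ (W : Set (ℝ × ℂ)) (ζ F : ℝ × ℂ → ℂ), IsOpen W ∧ 0 ∈ W ∧ W ⊆ U ∧ ContDiffOn ℝ ∞ ζ W ∧
      ContDiffOn ℝ ∞ F W ∧ ∀ p ∈ W, F p ≠ 0 ∧ fderiv ℝ ζ p = F p • M p := by
  -- a vector field in the kernel of `M`
  let a : ℝ × ℂ → ℂ := fun p => (1 / 2) * (M p (0, 1) - Complex.I * M p (0, Complex.I))
  let b : ℝ × ℂ → ℂ := fun p => (1 / 2) * (M p (0, 1) + Complex.I * M p (0, Complex.I))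
  let c : ℝ × ℂ → ℂ := fun p => M p (1, 0)
  let X : ℝ × ℂ → ℝ × ℂ := fun p =>
    (Complex.normSq (a p) - Complex.normSq (b p), -conj (a p) * c p + b p * conj (c p))
  have hMv : ∀ v : ℝ × ℂ, ContDiffOn ℝ ∞ (fun p => M p v) U := fun v =>
    hM.clm_apply contDiffOn_const
  have ha : ContDiffOn ℝ ∞ a U :=
    contDiffOn_const.mul ((hMv _).sub (contDiffOn_const.mul (hMv _)))
  have hb : ContDiffOn ℝ ∞ b U :=
    contDiffOn_const.mul ((hMv _).add (contDiffOn_const.mul (hMv _)))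
  have hc : ContDiffOn ℝ ∞ c U := hMv _
  have hconj : ContDiff ℝ ∞ (fun z : ℂ => conj z) := Complex.conjCLE.contDiff
  have hnormSq : ContDiff ℝ ∞ Complex.normSq := by
    have : (Complex.normSq : ℂ → ℝ) = fun z => (Complex.reCLM z) * (Complex.reCLM z) +
        (Complex.imCLM z) * (Complex.imCLM z) := by
      ext z; simp [Complex.normSq_apply]
    rw [this]
    fun_prop
  have hX : ContDiffOn ℝ ∞ X U := by
    refine ((hnormSq.comp_contDiffOn ha).sub (hnormSq.comp_contDiffOn hb)).prodMk ?_
    exact ((hconj.comp_contDiffOn ha).neg.mul hc).add (hb.mul (hconj.comp_contDiffOn hc))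
  have hMX : ∀ p, M p (X p) = 0 := by
    intro p
    have hs : ∀ s v, M p (s, v) = s * c p + a p * v + b p * conj v := by
      intro s v
      rw [clm_prod_apply]
      have h1 : (v : ℂ) = v.re + v.im * Complex.I := (Complex.re_add_im v).symm
      have h2 : conj v = v.re - v.im * Complex.I := by apply Complex.ext <;> simp
      rw [h2]
      simp only [a, b, c]
      linear_combination (-(1 / 2) * (M p (0, 1) - Complex.I * M p (0, Complex.I))) * h1 +
        (v.im * M p (0, Complex.I)) * Complex.I_mul_I
    rw [hs]
    push_cast
    rw [Complex.normSq_eq_conj_mul_self, Complex.normSq_eq_conj_mul_self]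
    simp only [map_add, map_mul, map_neg, Complex.conj_conj]
    ring
  have hX0 : X 0 = (1, 0) := by
    have h1 : a 0 = 1 := by
      simp only [a, hM0]; linear_combination -(1 / 2) * Complex.I_mul_I
    have h2 : b 0 = 0 := by
      simp only [b, hM0]; linear_combination (1 / 2) * Complex.I_mul_I
    have h3 : c 0 = 0 := hM0 _
    simp [X, h1, h2, h3]
  -- cut off to a globally Lipschitz field
  obtain ⟨r₀, hr₀, hr₀U⟩ := Metric.isOpen_iff.1 hU _ h0U
  let χ : ContDiffBump (0 : ℝ × ℂ) := ⟨r₀ / 3, r₀ / 2, by positivity, by linarith⟩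
  let Y : ℝ × ℂ → ℝ × ℂ := fun p => χ p • X p
  have hYsupp : tsupport Y ⊆ U := by
    have h1 : tsupport Y ⊆ tsupport χ := by
      refine closure_mono fun w hw => ?_
      rw [Function.mem_support] at hw ⊢
      intro h0
      exact hw (by simp [Y, h0])
    refine h1.trans ?_
    rw [χ.tsupport_eq]
    exact (Metric.closedBall_subset_ball (by change r₀ / 2 < r₀; linarith)).trans hr₀U
  have hY : ContDiff ℝ ∞ Y := by
    rw [contDiff_iff_contDiffAt]
    intro w
    by_cases hw : w ∈ tsupport Y
    · exact χ.contDiff.contDiffAt.smul (hX.contDiffAt (hU.mem_nhds (hYsupp hw)))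
    · refine (contDiffAt_const (c := (0 : ℝ × ℂ))).congr_of_eventuallyEq ?_
      exact notMem_tsupport_iff_eventuallyEq.1 hw
  have hYc : HasCompactSupport Y := χ.hasCompactSupport.smul_right
  obtain ⟨L, hL⟩ := hY.lipschitzWith_of_hasCompactSupport hYc (by simp)
  have hMY : ∀ p, M p (Y p) = 0 := fun p => by
    simp only [Y, map_smul, hMX, smul_zero]
  have hY0 : Y 0 = (1, 0) := by
    have : χ (0 : ℝ × ℂ) = 1 := χ.one_of_mem_closedBall (Metric.mem_closedBall_self χ.rIn_pos.le)
    simp only [Y, this, one_smul, hX0]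
  obtain ⟨r, Fl, hr, hFl, hFlt, hFl0⟩ := exists_local_flow hY hL (0 : ℝ × ℂ)
  -- the straightening map
  let ι : ℝ × ℂ →L[ℝ] ℝ × (ℝ × ℂ) :=
    (ContinuousLinearMap.fst ℝ ℝ ℂ).prod ((0 : ℝ × ℂ →L[ℝ] ℝ).prod (ContinuousLinearMap.snd ℝ ℝ ℂ))
  have hι : ∀ p : ℝ × ℂ, ι p = (p.1, (0, p.2)) := fun p => rfl
  let Θ : ℝ × ℂ → ℝ × ℂ := fun p => Fl (ι p)
  have hιball : ∀ p ∈ Metric.ball (0 : ℝ × ℂ) r, ι p ∈ Metric.ball ((0 : ℝ), (0 : ℝ × ℂ)) r := by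
    intro p hp
    rw [← Prod.zero_eq_mk, mem_ball_zero_iff] at *
    rw [hι, Prod.norm_mk, Prod.norm_mk, norm_zero, max_eq_right (norm_nonneg p.2)]
    exact hp
  have hΘ : ContDiffOn ℝ ∞ Θ (Metric.ball 0 r) :=
    hFl.comp ι.contDiff.contDiffOn hιball
  have hΘat : ∀ p ∈ Metric.ball (0 : ℝ × ℂ) r, ContDiffAt ℝ ∞ Θ p := fun p hp =>
    hΘ.contDiffAt (Metric.isOpen_ball.mem_nhds hp)
  have hΘt : ∀ p ∈ Metric.ball (0 : ℝ × ℂ) r, fderiv ℝ Θ p (1, 0) = Y (Θ p) := by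
    intro p hp
    have h1 := hFlt _ (hιball p hp)
    have h2 : HasDerivAt (fun t : ℝ => ((t, p.2) : ℝ × ℂ)) (1, 0) p.1 :=
      (hasDerivAt_id p.1).prodMk (hasDerivAt_const p.1 p.2)
    have h3 := ((hΘat p hp).differentiableAt (by simp)).hasFDerivAt.comp_hasDerivAt p.1 h2
    exact h3.unique h1
  have h0b : (0 : ℝ × ℂ) ∈ Metric.ball (0 : ℝ × ℂ) r := Metric.mem_ball_self hr
  have hΘ0w : ∀ w : ℂ, ‖w‖ < r → Θ (0, w) = (0, w) := by
    intro w hw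
    refine hFl0 (0, w) ?_
    rw [mem_ball_zero_iff, Prod.norm_mk, norm_zero, max_eq_right (norm_nonneg _)]
    exact hw
  have hΘ00 : Θ 0 = 0 := hΘ0w 0 (by simpa using hr)
  have hΘd : fderiv ℝ Θ 0 = ContinuousLinearEquiv.refl ℝ (ℝ × ℂ) := by
    have h1 : fderiv ℝ Θ 0 ∘L ContinuousLinearMap.inr ℝ ℝ ℂ = ContinuousLinearMap.inr ℝ ℝ ℂ := by
      have h2 : HasFDerivAt (fun w : ℂ => Θ (0, w))
          (fderiv ℝ Θ 0 ∘L ContinuousLinearMap.inr ℝ ℝ ℂ) 0 := by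
        have := ((hΘat 0 h0b).differentiableAt (by simp)).hasFDerivAt
        exact HasFDerivAt.comp (0 : ℂ) (g := Θ) this (ContinuousLinearMap.inr ℝ ℝ ℂ).hasFDerivAt
      have h3 : HasFDerivAt (fun w : ℂ => Θ (0, w)) (ContinuousLinearMap.inr ℝ ℝ ℂ) 0 := by
        refine (ContinuousLinearMap.inr ℝ ℝ ℂ).hasFDerivAt.congr_of_eventuallyEq ?_
        filter_upwards [Metric.ball_mem_nhds (0 : ℂ) hr] with w hw
        exact hΘ0w w (by simpa using hw)
      exact h2.unique h3
    refine ContinuousLinearMap.ext fun v => ?_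
    have h4 : v = v.1 • ((1, 0) : ℝ × ℂ) + ContinuousLinearMap.inr ℝ ℝ ℂ v.2 := by
      ext <;> simp
    conv_lhs => rw [h4]
    rw [map_add, map_smul, hΘt 0 h0b, hΘ00, hY0]
    have h5 := DFunLike.congr_fun h1 v.2
    rw [ContinuousLinearMap.comp_apply] at h5
    rw [h5, ← h4]
    rfl
  have hVo : IsOpen (Metric.ball (0 : ℝ × ℂ) r ∩ Θ ⁻¹' U) :=
    hΘ.continuousOn.isOpen_inter_preimage Metric.isOpen_ball hU
  obtain ⟨Φ, h0Φ, hΦV, hΦΘ, hΦs⟩ := exists_openPartialHomeomorph_contDiffOn hVo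
    (hΘ.mono Set.inter_subset_left) ⟨h0b, by rw [Set.mem_preimage, hΘ00]; exact h0U⟩
    (ContinuousLinearEquiv.refl ℝ (ℝ × ℂ)) hΘd
  -- the pulled back form
  let N : ℝ × ℂ → (ℝ × ℂ →L[ℝ] ℂ) := fun p => M (Θ p) ∘L fderiv ℝ Θ p
  have hN : ContDiffOn ℝ ∞ N (Metric.ball (0 : ℝ × ℂ) r ∩ Θ ⁻¹' U) := by
    refine ContDiffOn.clm_comp (hM.comp (hΘ.mono Set.inter_subset_left) fun p hp => hp.2) ?_
    exact (hΘ.fderiv_of_isOpen Metric.isOpen_ball (by simp)).mono Set.inter_subset_left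
  have hNt : ∀ p ∈ Metric.ball (0 : ℝ × ℂ) r, N p (1, 0) = 0 := fun p hp => by
    change M (Θ p) (fderiv ℝ Θ p (1, 0)) = 0
    rw [hΘt p hp, hMY]
  have hN0 : ∀ v, N 0 v = v.2 := fun v => by
    change M (Θ 0) (fderiv ℝ Θ 0 v) = _
    rw [hΘd, hΘ00, hM0]
    rfl
  let P : ℝ × ℂ → ℂ := fun x => N x (0, 1)
  let Q : ℝ × ℂ → ℂ := fun x => N x (0, Complex.I)
  have hPs : ContDiffOn ℝ ∞ P (Metric.ball (0 : ℝ × ℂ) r ∩ Θ ⁻¹' U) :=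
    hN.clm_apply contDiffOn_const
  have hQs : ContDiffOn ℝ ∞ Q (Metric.ball (0 : ℝ × ℂ) r ∩ Θ ⁻¹' U) :=
    hN.clm_apply contDiffOn_const
  have hPQ : ∀ x ∈ Metric.ball (0 : ℝ × ℂ) r ∩ Θ ⁻¹' U,
      fderiv ℝ P x (1, 0) * Q x = fderiv ℝ Q x (1, 0) * P x := by
    intro x hx
    have hNd : DifferentiableAt ℝ N x :=
      (hN.contDiffAt (hVo.mem_nhds hx)).differentiableAt (by simp)
    have hMd : DifferentiableAt ℝ M (Θ x) :=
      (hM.contDiffAt (hU.mem_nhds hx.2)).differentiableAt (by simp)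
    have happ : ∀ v u, fderiv ℝ (fun x => N x v) x u = fderiv ℝ N x u v := by
      intro v u
      rw [fderiv_clm_apply hNd (differentiableAt_const v)]
      simp
    have hzero : ∀ u, fderiv ℝ N x u (1, 0) = 0 := by
      intro u
      rw [← happ]
      have : (fun x => N x (1, 0)) =ᶠ[𝓝 x] fun _ => 0 := by
        filter_upwards [Metric.isOpen_ball.mem_nhds hx.1] with y hy using hNt y hy
      rw [this.fderiv_eq]
      simp
    have hpull := fun u v => flatExtd_pullback (u := u) (v := v) hMd
      ((hΘat x hx.1).of_le ENat.LEInfty.out)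
    have h1 := hint (Θ x) hx.2 (fderiv ℝ Θ x (1, 0)) (fderiv ℝ Θ x (0, 1))
      (fderiv ℝ Θ x (0, Complex.I))
    rw [← hpull, ← hpull, ← hpull] at h1
    have h2 : M (Θ x) (fderiv ℝ Θ x (1, 0)) = 0 := hNt x hx.1
    change flatExtd N x _ _ * Q x + flatExtd N x _ _ * _ + flatExtd N x _ _ * P x = 0 at h1
    rw [h2] at h1
    simp only [flatExtd, hzero] at h1
    have e1 : fderiv ℝ P x (1, 0) = fderiv ℝ N x (1, 0) (0, 1) := happ (0, 1) (1, 0)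
    have e2 : fderiv ℝ Q x (1, 0) = fderiv ℝ N x (1, 0) (0, Complex.I) :=
      happ (0, Complex.I) (1, 0)
    rw [e1, e2]
    linear_combination h1
  have hP0 : P 0 = 1 := hN0 _
  have hQ0 : Q 0 = Complex.I := hN0 _
  have h0V : (0 : ℝ × ℂ) ∈ Metric.ball (0 : ℝ × ℂ) r ∩ Θ ⁻¹' U := hΦV h0Φ
  have hev : ∀ᶠ x in 𝓝 (0 : ℝ × ℂ), x ∈ Φ.source ∧ P x ≠ 0 ∧ P x - Complex.I * Q x ≠ 0 := by
    have cP : ContinuousAt P 0 := hPs.continuousOn.continuousAt (hVo.mem_nhds h0V)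
    have cQ : ContinuousAt Q 0 := hQs.continuousOn.continuousAt (hVo.mem_nhds h0V)
    refine (Φ.open_source.eventually_mem h0Φ).and
        ((cP.eventually_ne (by rw [hP0]; exact one_ne_zero)).and
      ((cP.sub (continuousAt_const.mul cQ)).eventually_ne ?_))
    change P 0 - Complex.I * Q 0 ≠ 0
    rw [hP0, hQ0, Complex.I_mul_I]; norm_num
  obtain ⟨r₂, hr₂, hr₂s⟩ := Metric.eventually_nhds_iff_ball.1 hev
  have hVr : ∀ x ∈ Metric.ball (0 : ℝ × ℂ) r₂, x ∈ Metric.ball (0 : ℝ × ℂ) r ∩ Θ ⁻¹' U :=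
    fun x hx => hΦV (hr₂s x hx).1
  have hmemprod : ∀ (t : ℝ) (w : ℂ), |t| < r₂ → ‖w‖ < r₂ → (t, w) ∈ Metric.ball (0 : ℝ × ℂ) r₂ := by
    intro t w ht hw
    rw [mem_ball_zero_iff, Prod.norm_mk]
    exact max_lt ht hw
  let R : ℂ → ℂ := fun w => Q (0, w) / P (0, w)
  -- the ratio does not depend on `t`
  have hR : ∀ (t : ℝ) (w : ℂ), |t| < r₂ → ‖w‖ < r₂ → Q (t, w) = R w * P (t, w) := by
    intro t w ht hw
    have hder : ∀ s ∈ Set.Ioo (-r₂) r₂,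
        HasDerivAt (fun s : ℝ => Q (s, w) / P (s, w)) 0 s := by
      intro s hs
      have hsw := hmemprod s w (abs_lt.2 hs) hw
      have h2 : HasDerivAt (fun t : ℝ => ((t, w) : ℝ × ℂ)) (1, 0) s :=
        (hasDerivAt_id s).prodMk (hasDerivAt_const s w)
      have dP := ((hPs.contDiffAt (hVo.mem_nhds (hVr _ hsw))).differentiableAt
        (by simp)).hasFDerivAt.comp_hasDerivAt s h2
      have dQ := ((hQs.contDiffAt (hVo.mem_nhds (hVr _ hsw))).differentiableAt
        (by simp)).hasFDerivAt.comp_hasDerivAt s h2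
      have := dQ.div dP (hr₂s _ hsw).2.1
      refine this.congr_deriv ?_
      rw [div_eq_zero_iff]
      left
      simp only [Function.comp_apply]
      linear_combination -hPQ _ (hVr _ hsw)
    have hdiff : DifferentiableOn ℝ (fun s : ℝ => Q (s, w) / P (s, w)) (Set.Ioo (-r₂) r₂) :=
      fun s hs => (hder s hs).differentiableAt.differentiableWithinAt
    have := isOpen_Ioo.is_const_of_deriv_eq_zero isPreconnected_Ioo hdiff
      (fun s hs => (hder s hs).deriv) (abs_lt.1 ht) (show (0 : ℝ) ∈ Set.Ioo (-r₂) r₂ by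
        constructor <;> linarith)
    have hne := (hr₂s _ (hmemprod t w ht hw)).2.1
    change _ = R w at this
    rw [← this, div_mul_cancel₀ _ hne]
  let μ : ℂ → ℂ := fun w => (P (0, w) + Complex.I * Q (0, w)) / (P (0, w) - Complex.I * Q (0, w))
  have hslice : ContDiffOn ℝ ∞ (fun w : ℂ => ((0, w) : ℝ × ℂ)) (Metric.ball 0 r₂) :=
    (contDiff_const.prodMk contDiff_id).contDiffOn
  have hslmap : ∀ w ∈ Metric.ball (0 : ℂ) r₂, ((0, w) : ℝ × ℂ) ∈ Metric.ball (0 : ℝ × ℂ) r₂ :=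
    fun w hw => hmemprod 0 w (by simpa using hr₂) (by simpa using hw)
  have hP' : ContDiffOn ℝ ∞ (fun w => P (0, w)) (Metric.ball 0 r₂) :=
    hPs.comp hslice fun w hw => hVr _ (hslmap w hw)
  have hQ' : ContDiffOn ℝ ∞ (fun w => Q (0, w)) (Metric.ball 0 r₂) :=
    hQs.comp hslice fun w hw => hVr _ (hslmap w hw)
  have hμ : ContDiffOn ℝ ∞ μ (Metric.ball 0 r₂) := by
    refine contDiffOn_div (hP'.add (contDiffOn_const.mul hQ'))
      (hP'.sub (contDiffOn_const.mul hQ')) ?_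
    exact fun w hw => (hr₂s _ (hslmap w hw)).2.2
  have hμ0 : μ 0 = 0 := by
    have h1 : P (0, 0) = 1 := hP0
    have h2 : Q (0, 0) = Complex.I := hQ0
    simp [μ, h1, h2]
  obtain ⟨f, hf, hfμ, hfz⟩ := exists_local_beltrami hr₂ hμ hμ0
  obtain ⟨r₃, hr₃, hr₃s⟩ := Metric.eventually_nhds_iff_ball.1
    (hfμ.and (Metric.ball_mem_nhds (0 : ℂ) hr₂))
  have hfR : ∀ w ∈ Metric.ball (0 : ℂ) r₃, fderiv ℝ f w Complex.I = R w * fderiv ℝ f w 1 ∧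
      fderiv ℝ f w 1 ≠ 0 := by
    intro w hw
    obtain ⟨h1, h2⟩ := hr₃s w hw
    have h2' : w ∈ Metric.ball (0 : ℂ) r₂ := h2
    obtain ⟨-, hp, hpq⟩ := hr₂s _ (hslmap w h2')
    have h3 : (P (0, w) - Complex.I * Q (0, w)) * dζbar f w =
        (P (0, w) + Complex.I * Q (0, w)) * dζ f w := by
      rw [h1]; simp only [μ]; field_simp
    rw [dζbar, dζ] at h3
    have h4 : P (0, w) * fderiv ℝ f w Complex.I = Q (0, w) * fderiv ℝ f w 1 := by
      linear_combination -Complex.I * h3 + (P (0, w) * fderiv ℝ f w Complex.I -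
        Q (0, w) * fderiv ℝ f w 1) * Complex.I_mul_I
    have h5 : fderiv ℝ f w Complex.I = R w * fderiv ℝ f w 1 := by
      simp only [R]
      rw [div_mul_eq_mul_div, eq_div_iff hp, mul_comm, h4]
    refine ⟨h5, fun h6 => hfz w ?_⟩
    rw [dζ, h5, h6]
    simp
  -- transport back by the straightening map
  let Bx : Set (ℝ × ℂ) := Metric.ball 0 (min r₂ r₃)
  have hBx : ∀ x ∈ Bx, |x.1| < r₂ ∧ ‖x.2‖ < r₂ ∧ x.2 ∈ Metric.ball (0 : ℂ) r₃ ∧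
      x ∈ Metric.ball (0 : ℝ × ℂ) r₂ := by
    intro x hx
    have hx' : ‖x‖ < min r₂ r₃ := by simpa [Bx] using hx
    have h1 : |x.1| ≤ ‖x‖ := norm_fst_le x
    have h2 : ‖x.2‖ ≤ ‖x‖ := norm_snd_le x
    have h3 := min_le_left r₂ r₃
    have h4 := min_le_right r₂ r₃
    refine ⟨by linarith, by linarith, ?_, ?_⟩
    · rw [mem_ball_zero_iff]; linarith
    · rw [mem_ball_zero_iff]; linarith
  have hBxo : IsOpen Bx := Metric.isOpen_ball
  have h0Bx : (0 : ℝ × ℂ) ∈ Bx := Metric.mem_ball_self (lt_min hr₂ hr₃)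
  have hΦ0 : Φ.symm 0 = 0 := by
    have := Φ.left_inv h0Φ
    rwa [hΦΘ, hΘ00] at this
  have h0T : (0 : ℝ × ℂ) ∈ Φ.target := by
    have := Φ.map_source h0Φ
    rwa [hΦΘ, hΘ00] at this
  refine ⟨Φ.target ∩ Φ.symm ⁻¹' Bx, fun y => f (Φ.symm y).2,
    fun y => fderiv ℝ f (Φ.symm y).2 1 / P (Φ.symm y), Φ.isOpen_inter_preimage_symm hBxo,
    ⟨h0T, by rw [Set.mem_preimage, hΦ0]; exact h0Bx⟩, ?_, ?_, ?_, ?_⟩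
  · rintro y ⟨hy, -⟩
    have := (hΦV (Φ.map_target hy)).2
    rwa [Set.mem_preimage, ← hΦΘ, Φ.right_inv hy] at this
  · exact hf.comp_contDiffOn (contDiff_snd.comp_contDiffOn (hΦs.mono Set.inter_subset_left))
  · have hs : ContDiffOn ℝ ∞ Φ.symm (Φ.target ∩ Φ.symm ⁻¹' Bx) := hΦs.mono Set.inter_subset_left
    have hf1 : ContDiff ℝ ∞ fun w => fderiv ℝ f w 1 :=
      (contDiff_infty_iff_fderiv.1 hf).2.clm_apply contDiff_const
    refine contDiffOn_div (hf1.comp_contDiffOn (contDiff_snd.comp_contDiffOn hs))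
      (hPs.comp hs fun y hy => hVr _ (hBx _ hy.2).2.2.2) fun y hy => ?_
    exact (hr₂s _ (hBx _ hy.2).2.2.2).2.1
  · rintro y ⟨hy, hyB⟩
    obtain ⟨b1, b2, b3, b4⟩ := hBx _ hyB
    have hp := (hr₂s _ b4).2.1
    refine ⟨div_ne_zero (hfR _ b3).2 hp, ?_⟩
    set x := Φ.symm y with hx
    have hsd : HasFDerivAt Φ.symm (fderiv ℝ Φ.symm y) y :=
      ((hΦs.contDiffAt (Φ.open_target.mem_nhds hy)).differentiableAt (by simp)).hasFDerivAt
    have hfd : HasFDerivAt f (fderiv ℝ f x.2) x.2 :=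
      (hf.differentiable (by simp) _).hasFDerivAt
    have h1 : fderiv ℝ (fun y => f (Φ.symm y).2) y =
        fderiv ℝ f x.2 ∘L ContinuousLinearMap.snd ℝ ℝ ℂ ∘L fderiv ℝ Φ.symm y := by
      have h2 : HasFDerivAt (fun y => (Φ.symm y).2)
        (ContinuousLinearMap.snd ℝ ℝ ℂ ∘L fderiv ℝ Φ.symm y) y := hsd.snd
      exact (hfd.comp y h2).fderiv
    have hid : fderiv ℝ Θ x ∘L fderiv ℝ Φ.symm y = ContinuousLinearMap.id ℝ _ := by
      have h3 : HasFDerivAt Θ (fderiv ℝ Θ x) x :=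
        ((hΘat x (hVr _ b4).1).differentiableAt (by simp)).hasFDerivAt
      have h4 := h3.comp y hsd
      refine h4.unique ((hasFDerivAt_id y).congr_of_eventuallyEq ?_)
      filter_upwards [Φ.open_target.mem_nhds hy] with z hz
      change Θ (Φ.symm z) = z
      rw [← hΦΘ]
      exact Φ.right_inv hz
    have hΘx : Θ x = y := by rw [← hΦΘ, Φ.right_inv hy]
    rw [h1]
    refine ContinuousLinearMap.ext fun v => ?_
    simp only [ContinuousLinearMap.comp_apply, FunLike.coe_smul, Pi.smul_apply, smul_eq_mul,
      ContinuousLinearMap.coe_snd']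
    set u := fderiv ℝ Φ.symm y v with hu
    have h5 : M y v = N x u := by
      change _ = M (Θ x) (fderiv ℝ Θ x u)
      rw [hΘx]
      exact congrArg (M y) (DFunLike.congr_fun hid v).symm
    have h6 : N x u = P x * (u.2.re + R x.2 * u.2.im) := by
      have h7 := clm_prod_apply (N x) u.1 u.2
      rw [hNt x (hVr _ b4).1] at h7
      change N x u = _ + u.2.re * P x + u.2.im * Q (x.1, x.2) at h7
      rw [hR x.1 x.2 b1 b2] at h7
      change N x u = _ + u.2.re * P x + u.2.im * (R x.2 * P x) at h7
      rw [h7]; ring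
    have h8 : fderiv ℝ f x.2 u.2 = fderiv ℝ f x.2 1 * (u.2.re + R x.2 * u.2.im) := by
      have h9 : u.2 = u.2.re • (1 : ℂ) + u.2.im • Complex.I := by
        apply Complex.ext <;> simp
      conv_lhs => rw [h9]
      rw [map_add, map_smul, map_smul, (hfR _ b3).1, Complex.real_smul, Complex.real_smul]
      ring
    rw [h5, h6, h8, ← hx]
    field_simp

/-! ### One-forms in local coordinates -/

section Push

variable {E : Type*} [NormedAddCommGroup E] [NormedSpace ℝ E]
  {N : Type*} [TopologicalSpace N] [ChartedSpace E N]
  {F : Type*} [NormedAddCommGroup F] [NormedSpace ℝ F]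

lemma extd_eq_flatExtd_inChart {η : OneForm E N} {p : N}
    (h : DifferentiableAt ℝ (η.inChart p) (extChartAt 𝓘(ℝ, E) p p))
    (u v : TangentSpace 𝓘(ℝ, E) p) :
    extd η p u v = flatExtd (η.inChart p) (extChartAt 𝓘(ℝ, E) p p)
      (mfderiv 𝓘(ℝ, E) 𝓘(ℝ, E) (extChartAt 𝓘(ℝ, E) p) p u)
      (mfderiv 𝓘(ℝ, E) 𝓘(ℝ, E) (extChartAt 𝓘(ℝ, E) p) p v) := by
  let L : (E →L[ℝ] ℂ) ≃L[ℝ] (E [⋀^Fin 1]→L[ℝ] ℂ) :=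
    (ContinuousAlternatingMap.ofSubsingletonLIE (0 : Fin 1)).toContinuousLinearEquiv
  have hd : HasFDerivAt
      (fun y => ContinuousAlternatingMap.ofSubsingleton ℝ E ℂ (0 : Fin 1) (η.inChart p y))
      ((L : (E →L[ℝ] ℂ) →L[ℝ] (E [⋀^Fin 1]→L[ℝ] ℂ)) ∘L
          fderiv ℝ (η.inChart p) (extChartAt 𝓘(ℝ, E) p p))
      (extChartAt 𝓘(ℝ, E) p p) :=
    (L : (E →L[ℝ] ℂ) →L[ℝ] (E [⋀^Fin 1]→L[ℝ] ℂ)).hasFDerivAt.comp _ h.hasFDerivAt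
  rw [extd, extDeriv, ContinuousAlternatingMap.alternatizeUncurryFin_apply, hd.fderiv]
  rw [Fin.sum_univ_two]
  simp only [Fin.val_zero, pow_zero, one_smul, Fin.val_one, pow_one, neg_smul]
  rfl

lemma inChart_self (η : OneForm F F) (p : F) : η.inChart p = η := by
  funext y
  have h : mfderiv 𝓘(ℝ, F) 𝓘(ℝ, F) (extChartAt 𝓘(ℝ, F) p).symm y = ContinuousLinearMap.id ℝ F := by
    simp only [mfld_simps, mfderiv_eq_fderiv]
    exact fderiv_id
  rw [OneForm.inChart, h]
  ext v
  simp only [mfld_simps]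
  rfl

/-- A one-form on a normed space, with its tangent spaces identified with the space. -/
abbrev flat (η : OneForm F F) : F → F →L[ℝ] ℂ := η

lemma extd_eq_flatExtd {η : OneForm F F} {p : F} (h : DifferentiableAt ℝ (flat η) p)
    (u v : F) : extd η p u v = flatExtd (flat η) p u v := by
  have h' : DifferentiableAt ℝ (η.inChart p) (extChartAt 𝓘(ℝ, F) p p) := by
    rw [inChart_self]; exact h
  have h2 : mfderiv 𝓘(ℝ, F) 𝓘(ℝ, F) (extChartAt 𝓘(ℝ, F) p) p = ContinuousLinearMap.id ℝ F := by
    simp only [mfld_simps, mfderiv_eq_fderiv]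
    exact fderiv_id
  have := extd_eq_flatExtd_inChart h' u v
  rw [h2, inChart_self] at this
  exact this

lemma smoothOn_iff_contDiffOn {η : OneForm F F} {U : Set F} :
    η.SmoothOn U ↔ ContDiffOn ℝ ∞ (flat η) U := by
  have h : ∀ p₀ : F, (extChartAt 𝓘(ℝ, F) p₀).target ∩ (extChartAt 𝓘(ℝ, F) p₀).symm ⁻¹' U = U := by
    intro p₀
    rw [extChartAt_model_space_eq_id]
    exact Set.univ_inter U
  simp only [OneForm.SmoothOn, inChart_self, h]
  exact ⟨fun h => h 0, fun h _ => h⟩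

/-- The expression of a one-form in the coordinates `e`. -/
noncomputable def pushForm (e : OpenPartialHomeomorph N F) (η : OneForm E N) : F → F →L[ℝ] ℂ :=
  fun y => η (e.symm y) ∘L mfderiv 𝓘(ℝ, F) 𝓘(ℝ, E) e.symm y

variable [IsManifold 𝓘(ℝ, E) ∞ N]

lemma pushForm_eventuallyEq {e : OpenPartialHomeomorph N F}
    (he : ContMDiffOn 𝓘(ℝ, F) 𝓘(ℝ, E) ∞ e.symm e.target) (η : OneForm E N) {y : F}
    (hy : y ∈ e.target) :
    ContDiffAt ℝ ∞ (fun z => extChartAt 𝓘(ℝ, E) (e.symm y) (e.symm z)) y ∧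
    ∀ᶠ y' in 𝓝 y, pushForm e η y' =
      η.inChart (e.symm y) (extChartAt 𝓘(ℝ, E) (e.symm y) (e.symm y')) ∘L
        fderiv ℝ (fun z => extChartAt 𝓘(ℝ, E) (e.symm y) (e.symm z)) y' := by
  set p := e.symm y with hp
  set c := extChartAt 𝓘(ℝ, E) p with hc
  have hcs : IsOpen (e.target ∩ e.symm ⁻¹' c.source) := by
    refine e.isOpen_inter_preimage_symm ?_
    exact isOpen_extChartAt_source p
  have hyc : y ∈ e.target ∩ e.symm ⁻¹' c.source := ⟨hy, mem_extChartAt_source p⟩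
  have hg : ∀ z ∈ e.target ∩ e.symm ⁻¹' c.source, ContMDiffAt 𝓘(ℝ, F) 𝓘(ℝ, E) ∞
      (fun z => c (e.symm z)) z := by
    intro z hz
    have h1 : ContMDiffAt 𝓘(ℝ, F) 𝓘(ℝ, E) ∞ e.symm z :=
      he.contMDiffAt (e.open_target.mem_nhds hz.1)
    have h2 : ContMDiffAt 𝓘(ℝ, E) 𝓘(ℝ, E) ∞ c (e.symm z) :=
      contMDiffAt_extChartAt' (by simpa [hc] using hz.2)
    exact h2.comp z h1
  refine ⟨(hg y hyc).contDiffAt, ?_⟩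
  filter_upwards [hcs.mem_nhds hyc] with z hz
  have h1 : MDifferentiableAt 𝓘(ℝ, F) 𝓘(ℝ, E) (fun z => c (e.symm z)) z :=
    (hg z hz).mdifferentiableAt (by simp)
  have h2 : MDifferentiableAt 𝓘(ℝ, E) 𝓘(ℝ, E) c.symm (c (e.symm z)) := by
    refine ((contMDiffOn_extChartAt_symm (I := 𝓘(ℝ, E)) (n := ∞) p).contMDiffAt
      ?_).mdifferentiableAt (by simp)
    exact (isOpen_extChartAt_target p).mem_nhds (c.map_source hz.2)
  have h3 : e.symm =ᶠ[𝓝 z] c.symm ∘ fun z => c (e.symm z) := by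
    filter_upwards [hcs.mem_nhds hz] with w hw
    exact (c.left_inv hw.2).symm
  have h4 : mfderiv 𝓘(ℝ, F) 𝓘(ℝ, E) e.symm z =
      mfderiv 𝓘(ℝ, E) 𝓘(ℝ, E) c.symm (c (e.symm z)) ∘L fderiv ℝ (fun z => c (e.symm z)) z := by
    have h5 := mfderiv_comp z h2 h1
    rw [mfderiv_eq_fderiv] at h5
    exact h3.mfderiv_eq.trans h5
  have h5 : c.symm (c (e.symm z)) = e.symm z := c.left_inv hz.2
  rw [pushForm, h4, OneForm.inChart]
  change (η (e.symm z) : E →L[ℝ] ℂ) ∘L _ = ((η (c.symm (c (e.symm z))) : E →L[ℝ] ℂ) ∘L _) ∘L _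
  rw [h5]
  rfl

omit [IsManifold 𝓘(ℝ, E) ∞ N] in
lemma contDiffAt_inChart {η : OneForm E N} {U : Set N} (hη : η.SmoothOn U) (hU : IsOpen U) {p : N}
    (hp : p ∈ U) : ContDiffAt ℝ ∞ (η.inChart p) (extChartAt 𝓘(ℝ, E) p p) := by
  refine (hη p).contDiffAt (IsOpen.mem_nhds ?_ ⟨mem_extChartAt_target p, ?_⟩)
  · exact (continuousOn_extChartAt_symm p).isOpen_inter_preimage (isOpen_extChartAt_target p) hU
  · rwa [Set.mem_preimage, extChartAt_to_inv]

lemma contDiffOn_pushForm {e : OpenPartialHomeomorph N F}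
    (he : ContMDiffOn 𝓘(ℝ, F) 𝓘(ℝ, E) ∞ e.symm e.target) {η : OneForm E N} {U : Set N}
    (hη : η.SmoothOn U) (hU : IsOpen U) :
    ContDiffOn ℝ ∞ (pushForm e η) (e.target ∩ e.symm ⁻¹' U) := by
  intro y hy
  obtain ⟨h1, h2⟩ := pushForm_eventuallyEq he η hy.1
  refine ContDiffAt.contDiffWithinAt ?_
  refine ContDiffAt.congr_of_eventuallyEq ?_ h2
  refine ContDiffAt.clm_comp ?_ (h1.fderiv_right (by simp))
  exact ContDiffAt.comp (g := η.inChart (e.symm y)) y (contDiffAt_inChart hη hU hy.2) h1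

/-- Naturality of the exterior derivative. -/
lemma flatExtd_pushForm {e : OpenPartialHomeomorph N F}
    (he : ContMDiffOn 𝓘(ℝ, F) 𝓘(ℝ, E) ∞ e.symm e.target) {η : OneForm E N} {U : Set N}
    (hη : η.SmoothOn U) (hU : IsOpen U) {y : F} (hy : y ∈ e.target) (hyU : e.symm y ∈ U) (u v : F) :
    flatExtd (pushForm e η) y u v =
      extd η (e.symm y) (mfderiv 𝓘(ℝ, F) 𝓘(ℝ, E) e.symm y u)
        (mfderiv 𝓘(ℝ, F) 𝓘(ℝ, E) e.symm y v) := by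
  obtain ⟨h1, h2⟩ := pushForm_eventuallyEq he η hy
  have h3 := contDiffAt_inChart hη hU hyU
  have h4 := flatExtd_pullback (η := η.inChart (e.symm y))
    (g := fun z => extChartAt 𝓘(ℝ, E) (e.symm y) (e.symm z)) (x := y)
    (h3.differentiableAt (by simp)) (h1.of_le ENat.LEInfty.out) u v
  refine ((flatExtd_congr h2 u v).trans h4).trans ?_
  rw [extd_eq_flatExtd_inChart (h3.differentiableAt (by simp))]
  have h5 : fderiv ℝ (fun z => extChartAt 𝓘(ℝ, E) (e.symm y) (e.symm z)) y =
      mfderiv 𝓘(ℝ, E) 𝓘(ℝ, E) (extChartAt 𝓘(ℝ, E) (e.symm y)) (e.symm y) ∘L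
        mfderiv 𝓘(ℝ, F) 𝓘(ℝ, E) e.symm y := by
    rw [← mfderiv_eq_fderiv]
    refine mfderiv_comp y ?_ ?_
    · exact mdifferentiableAt_extChartAt (mem_chart_source _ _)
    · exact (he.contMDiffAt (e.open_target.mem_nhds hy)).mdifferentiableAt (by simp)
  rw [h5]
  rfl

end Push

/-! ### The structure equations in local coordinates -/

/-- The unknowns of the structure equations on a normed space, whose tangent spaces are identified
with the space itself. -/
structure FlatData (F : Type*) [NormedAddCommGroup F] [NormedSpace ℝ F] where
  M : F → F →L[ℝ] ℂ
  K : F → F →L[ℝ] ℂ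
  Γ41 : F → F →L[ℝ] ℂ
  Γ23 : F → F →L[ℝ] ℂ
  Γ12 : F → F →L[ℝ] ℂ
  Γ34 : F → F →L[ℝ] ℂ
  Ψ0 : F → ℂ
  Ψ1 : F → ℂ
  Ψ2 : F → ℂ
  Ψ3 : F → ℂ

section

variable {F : Type*} [NormedAddCommGroup F] [NormedSpace ℝ F]

/-- Unknowns on a normed space, seen as unknowns on the manifold which this space is. -/
def FlatData.toData (D : FlatData F) : Data F F :=
  ⟨D.M, D.K, D.Γ41, D.Γ23, D.Γ12, D.Γ34, D.Ψ0, D.Ψ1, D.Ψ2, D.Ψ3⟩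

/-- The structure equations on an open set of a normed space, evaluated on pairs of vectors. -/
structure FlatData.IsSolutionOn (R : ℝ) (D : FlatData F) (U : Set F) : Prop where
  smooth_M : ContDiffOn ℝ ∞ D.M U
  smooth_K : ContDiffOn ℝ ∞ D.K U
  smooth_Γ41 : ContDiffOn ℝ ∞ D.Γ41 U
  smooth_Γ23 : ContDiffOn ℝ ∞ D.Γ23 U
  smooth_Γ12 : ContDiffOn ℝ ∞ D.Γ12 U
  smooth_Γ34 : ContDiffOn ℝ ∞ D.Γ34 U
  real_K : ∀ p ∈ U, ∀ v, conj (D.K p v) = D.K p v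
  conj_Γ12 : ∀ p ∈ U, ∀ v, conj (D.Γ12 p v) = -D.Γ12 p v
  real_Γ34 : ∀ p ∈ U, ∀ v, conj (D.Γ34 p v) = D.Γ34 p v
  coframe : ∀ p ∈ U, ∃ u v w, Matrix.det !![D.M p u, D.M p v, D.M p w;
    conj (D.M p u), conj (D.M p v), conj (D.M p w); D.K p u, D.K p v, D.K p w] ≠ 0
  first_M : ∀ p ∈ U, ∀ u v, flatExtd D.M p u v =
    (D.Γ12 p u * D.M p v - D.Γ12 p v * D.M p u) +
    (conj (D.Γ41 p u) * D.K p v - conj (D.Γ41 p v) * D.K p u)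
  first_L : ∀ p ∈ U, ∀ u v, (D.Γ41 p u * D.M p v - D.Γ41 p v * D.M p u) +
    (conj (D.Γ41 p u) * conj (D.M p v) - conj (D.Γ41 p v) * conj (D.M p u)) = 0
  first_K : ∀ p ∈ U, ∀ u v, flatExtd D.K p u v =
    -(conj (D.Γ23 p u) * D.M p v - conj (D.Γ23 p v) * D.M p u) -
    (D.Γ23 p u * conj (D.M p v) - D.Γ23 p v * conj (D.M p u)) +
    (D.Γ34 p u * D.K p v - D.Γ34 p v * D.K p u)
  second_23 : ∀ p ∈ U, ∀ u v, flatExtd D.Γ23 p u v =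
    ((D.Γ12 p u + D.Γ34 p u) * D.Γ23 p v - (D.Γ12 p v + D.Γ34 p v) * D.Γ23 p u) -
    D.Ψ3 p * (D.M p u * conj (D.M p v) - D.M p v * conj (D.M p u)) +
    (D.Ψ2 p + R / 12) * (D.K p u * D.M p v - D.K p v * D.M p u)
  second_14 : ∀ p ∈ U, ∀ u v, flatExtd D.Γ41 p u v =
    (D.Γ41 p u * (D.Γ12 p v + D.Γ34 p v) - D.Γ41 p v * (D.Γ12 p u + D.Γ34 p u)) -
    D.Ψ1 p * (D.M p u * conj (D.M p v) - D.M p v * conj (D.M p u)) +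
    D.Ψ0 p * (D.K p u * D.M p v - D.K p v * D.M p u)
  second_12_34 : ∀ p ∈ U, ∀ u v, (1 / 2) * (flatExtd D.Γ12 p u v + flatExtd D.Γ34 p u v) =
    -(D.Γ23 p u * D.Γ41 p v - D.Γ23 p v * D.Γ41 p u) +
    (D.Ψ2 p - R / 24) * (D.M p u * conj (D.M p v) - D.M p v * conj (D.M p u)) -
    D.Ψ1 p * (D.K p u * D.M p v - D.K p v * D.M p u)

lemma flatExtd_neg {G : Type*} [NormedAddCommGroup G] [NormedSpace ℝ G] (η : G → G →L[ℝ] ℂ)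
    (p u v : G) : flatExtd (fun y => -η y) p u v = -flatExtd η p u v := by
  simp only [flatExtd, fderiv_fun_neg, FunLike.coe_neg, Pi.neg_apply]
  ring

lemma FlatData.isSolutionOn_toData {R : ℝ} {D : FlatData F} {U : Set F} (hU : IsOpen U) :
    D.toData.IsSolutionOn R U ↔ D.IsSolutionOn R U := by
  have hd : ∀ {η : F → F →L[ℝ] ℂ}, ContDiffOn ℝ ∞ η U → ∀ p ∈ U, ∀ u v : F,
      extd (E := F) (N := F) η p u v = flatExtd η p u v := fun h p hp u v =>
    extd_eq_flatExtd ((h.contDiffAt (hU.mem_nhds hp)).differentiableAt (by simp)) u v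
  constructor
  · intro h
    have s1 : ContDiffOn ℝ ∞ D.M U := smoothOn_iff_contDiffOn.1 h.smooth_M
    have s2 : ContDiffOn ℝ ∞ D.K U := smoothOn_iff_contDiffOn.1 h.smooth_K
    have s3 : ContDiffOn ℝ ∞ D.Γ41 U := smoothOn_iff_contDiffOn.1 h.smooth_Γ41
    have s4 : ContDiffOn ℝ ∞ D.Γ23 U := smoothOn_iff_contDiffOn.1 h.smooth_Γ23
    have s5 : ContDiffOn ℝ ∞ D.Γ12 U := smoothOn_iff_contDiffOn.1 h.smooth_Γ12
    have s6 : ContDiffOn ℝ ∞ D.Γ34 U := smoothOn_iff_contDiffOn.1 h.smooth_Γ34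
    refine ⟨s1, s2, s3, s4, s5, s6, fun p hp v => DFunLike.congr_fun (h.real_K p hp) v,
      fun p hp v => DFunLike.congr_fun (h.conj_Γ12 p hp) v,
      fun p hp v => DFunLike.congr_fun (h.real_Γ34 p hp) v, ?_, ?_, ?_, ?_, ?_, ?_, ?_⟩
    · intro p hp
      by_contra hc
      push Not at hc
      exact h.coframe p hp (funext fun u => funext fun v => funext fun w => hc u v w)
    · intro p hp u v
      rw [← hd s1 p hp]
      refine (congrFun₂ (h.first_M p hp) u v).trans ?_
      change -((-D.Γ12 p u) * D.M p v - (-D.Γ12 p v) * D.M p u) -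
        ((-conj (D.Γ41 p u)) * D.K p v - (-conj (D.Γ41 p v)) * D.K p u) = _
      ring
    · intro p hp u v
      exact (congrFun₂ (h.first_L p hp) u v).symm
    · intro p hp u v
      rw [← hd s2 p hp]
      refine (congrFun₂ (h.first_K p hp) u v).trans ?_
      change (conj (-D.Γ23 p u) * D.M p v - conj (-D.Γ23 p v) * D.M p u) +
        ((-D.Γ23 p u) * conj (D.M p v) - (-D.Γ23 p v) * conj (D.M p u)) +
        (D.Γ34 p u * D.K p v - D.Γ34 p v * D.K p u) = _
      simp only [map_neg]
      ring
    · intro p hp u v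
      rw [← hd s4 p hp]
      exact congrFun₂ (h.second_23 p hp) u v
    · intro p hp u v
      have h1 := congrFun₂ (h.second_14 p hp) u v
      have h2 : extd D.toData.Γ14 p u v = -flatExtd D.Γ41 p u v :=
        (hd s3.neg p hp u v).trans (flatExtd_neg D.Γ41 p u v)
      rw [h2] at h1
      change _ = ((-D.Γ41 p u) * (D.Γ12 p v + D.Γ34 p v) - (-D.Γ41 p v) * (D.Γ12 p u + D.Γ34 p u)) +
        D.Ψ1 p * (D.M p u * conj (D.M p v) - D.M p v * conj (D.M p u)) -
        D.Ψ0 p * (D.K p u * D.M p v - D.K p v * D.M p u) at h1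
      linear_combination -h1
    · intro p hp u v
      have h1 := congrFun₂ (h.second_12_34 p hp) u v
      rw [← hd s5 p hp, ← hd s6 p hp]
      refine h1.trans ?_
      change (D.Γ23 p u * (-D.Γ41 p v) - D.Γ23 p v * (-D.Γ41 p u)) +
        (D.Ψ2 p - R / 24) * (D.M p u * conj (D.M p v) - D.M p v * conj (D.M p u)) -
        D.Ψ1 p * (D.K p u * D.M p v - D.K p v * D.M p u) = _
      ring
  · intro h
    refine ⟨smoothOn_iff_contDiffOn.2 h.smooth_M, smoothOn_iff_contDiffOn.2 h.smooth_K,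
      smoothOn_iff_contDiffOn.2 h.smooth_Γ41, smoothOn_iff_contDiffOn.2 h.smooth_Γ23,
      smoothOn_iff_contDiffOn.2 h.smooth_Γ12, smoothOn_iff_contDiffOn.2 h.smooth_Γ34,
      fun p hp => ContinuousLinearMap.ext fun v => h.real_K p hp v,
      fun p hp => ContinuousLinearMap.ext fun v => h.conj_Γ12 p hp v,
      fun p hp => ContinuousLinearMap.ext fun v => h.real_Γ34 p hp v, ?_, ?_, ?_, ?_, ?_, ?_, ?_⟩
    · intro p hp hc
      obtain ⟨u, v, w, h1⟩ := h.coframe p hp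
      exact h1 (congrFun (congrFun₂ hc u v) w)
    · intro p hp
      funext u v
      refine ((hd h.smooth_M p hp u v).trans (h.first_M p hp u v)).trans ?_
      change _ = -((-D.Γ12 p u) * D.M p v - (-D.Γ12 p v) * D.M p u) -
        ((-conj (D.Γ41 p u)) * D.K p v - (-conj (D.Γ41 p v)) * D.K p u)
      ring
    · intro p hp
      funext u v
      exact (h.first_L p hp u v).symm
    · intro p hp
      funext u v
      refine ((hd h.smooth_K p hp u v).trans (h.first_K p hp u v)).trans ?_
      change _ = (conj (-D.Γ23 p u) * D.M p v - conj (-D.Γ23 p v) * D.M p u) +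
        ((-D.Γ23 p u) * conj (D.M p v) - (-D.Γ23 p v) * conj (D.M p u)) +
        (D.Γ34 p u * D.K p v - D.Γ34 p v * D.K p u)
      simp only [map_neg]
      ring
    · intro p hp
      funext u v
      exact (hd h.smooth_Γ23 p hp u v).trans (h.second_23 p hp u v)
    · intro p hp
      funext u v
      have h2 : extd D.toData.Γ14 p u v = -flatExtd D.Γ41 p u v :=
        (hd h.smooth_Γ41.neg p hp u v).trans (flatExtd_neg D.Γ41 p u v)
      rw [h2, h.second_14 p hp u v]
      change _ = ((-D.Γ41 p u) * (D.Γ12 p v + D.Γ34 p v) - (-D.Γ41 p v) * (D.Γ12 p u + D.Γ34 p u)) +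
        D.Ψ1 p * (D.M p u * conj (D.M p v) - D.M p v * conj (D.M p u)) -
        D.Ψ0 p * (D.K p u * D.M p v - D.K p v * D.M p u)
      ring
    · intro p hp
      funext u v
      have h1 := h.second_12_34 p hp u v
      rw [← hd h.smooth_Γ12 p hp u v, ← hd h.smooth_Γ34 p hp u v] at h1
      refine h1.trans ?_
      change _ = (D.Γ23 p u * (-D.Γ41 p v) - D.Γ23 p v * (-D.Γ41 p u)) +
        (D.Ψ2 p - R / 24) * (D.M p u * conj (D.M p v) - D.M p v * conj (D.M p u)) -
        D.Ψ1 p * (D.K p u * D.M p v - D.K p v * D.M p u)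
      ring

variable {E : Type*} [NormedAddCommGroup E] [NormedSpace ℝ E]
  {N : Type*} [TopologicalSpace N] [ChartedSpace E N]

/-- The expression of the unknowns in the coordinates `e`. -/
noncomputable def pushData (e : OpenPartialHomeomorph N F) (D : Data E N) : FlatData F where
  M := pushForm e D.M
  K := pushForm e D.K
  Γ41 := pushForm e D.Γ41
  Γ23 := pushForm e D.Γ23
  Γ12 := pushForm e D.Γ12
  Γ34 := pushForm e D.Γ34
  Ψ0 := fun y => D.Ψ0 (e.symm y)
  Ψ1 := fun y => D.Ψ1 (e.symm y)
  Ψ2 := fun y => D.Ψ2 (e.symm y)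
  Ψ3 := fun y => D.Ψ3 (e.symm y)

lemma mfderiv_symm_mfderiv {e : OpenPartialHomeomorph N F}
    (he : ContMDiffOn 𝓘(ℝ, E) 𝓘(ℝ, F) ∞ e e.source)
    (he' : ContMDiffOn 𝓘(ℝ, F) 𝓘(ℝ, E) ∞ e.symm e.target) {p : N} (hp : p ∈ e.source)
    (v : TangentSpace 𝓘(ℝ, E) p) :
    mfderiv 𝓘(ℝ, F) 𝓘(ℝ, E) e.symm (e p) (mfderiv 𝓘(ℝ, E) 𝓘(ℝ, F) e p v) = v := by
  have h1 : MDifferentiableAt 𝓘(ℝ, E) 𝓘(ℝ, F) e p :=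
    (he.contMDiffAt (e.open_source.mem_nhds hp)).mdifferentiableAt (by simp)
  have h2 : MDifferentiableAt 𝓘(ℝ, F) 𝓘(ℝ, E) e.symm (e p) :=
    (he'.contMDiffAt (e.open_target.mem_nhds (e.map_source hp))).mdifferentiableAt (by simp)
  have h3 : (e.symm ∘ e) =ᶠ[𝓝 p] id := by
    filter_upwards [e.open_source.mem_nhds hp] with q hq using e.left_inv hq
  have h4 := (mfderiv_comp p h2 h1).symm.trans (h3.mfderiv_eq.trans mfderiv_id)
  exact DFunLike.congr_fun h4 v

variable [IsManifold 𝓘(ℝ, E) ∞ N]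

/-- The structure equations are invariant under changes of coordinates. -/
theorem isSolutionOn_pushData {R : ℝ} {e : OpenPartialHomeomorph N F}
    (he : ContMDiffOn 𝓘(ℝ, E) 𝓘(ℝ, F) ∞ e e.source)
    (he' : ContMDiffOn 𝓘(ℝ, F) 𝓘(ℝ, E) ∞ e.symm e.target) {D : Data E N} {U : Set N}
    (hU : IsOpen U) (h : D.IsSolutionOn R U) :
    (pushData e D).IsSolutionOn R (e.target ∩ e.symm ⁻¹' U) := by
  refine ⟨contDiffOn_pushForm he' h.smooth_M hU, contDiffOn_pushForm he' h.smooth_K hU,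
    contDiffOn_pushForm he' h.smooth_Γ41 hU, contDiffOn_pushForm he' h.smooth_Γ23 hU,
    contDiffOn_pushForm he' h.smooth_Γ12 hU, contDiffOn_pushForm he' h.smooth_Γ34 hU,
    fun p hp v => DFunLike.congr_fun (h.real_K _ hp.2) _,
    fun p hp v => DFunLike.congr_fun (h.conj_Γ12 _ hp.2) _,
    fun p hp v => DFunLike.congr_fun (h.real_Γ34 _ hp.2) _, ?_, ?_, ?_, ?_, ?_, ?_, ?_⟩
  · rintro y ⟨hy, hyU⟩
    by_contra hc
    push Not at hc
    refine h.coframe _ hyU (funext fun u => funext fun v => funext fun w => ?_)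
    have h1 := mfderiv_symm_mfderiv he he' (e.map_target hy)
    rw [e.right_inv hy] at h1
    obtain ⟨u', hu⟩ : ∃ u' : TangentSpace 𝓘(ℝ, F) y, mfderiv 𝓘(ℝ, F) 𝓘(ℝ, E) e.symm y u' = u :=
      ⟨_, h1 u⟩
    obtain ⟨v', hv⟩ : ∃ v' : TangentSpace 𝓘(ℝ, F) y, mfderiv 𝓘(ℝ, F) 𝓘(ℝ, E) e.symm y v' = v :=
      ⟨_, h1 v⟩
    obtain ⟨w', hw⟩ : ∃ w' : TangentSpace 𝓘(ℝ, F) y, mfderiv 𝓘(ℝ, F) 𝓘(ℝ, E) e.symm y w' = w :=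
      ⟨_, h1 w⟩
    rw [← hu, ← hv, ← hw]
    exact hc u' v' w'
  · rintro y ⟨hy, hyU⟩ u v
    refine (flatExtd_pushForm he' h.smooth_M hU hy hyU u v).trans
      ((congrFun₂ (h.first_M _ hyU) _ _).trans ?_)
    set D' := pushData e D with hD'
    change -((-D'.Γ12 y u) * D'.M y v - (-D'.Γ12 y v) * D'.M y u) -
      ((-conj (D'.Γ41 y u)) * D'.K y v - (-conj (D'.Γ41 y v)) * D'.K y u) = _
    ring
  · rintro y ⟨hy, hyU⟩ u v
    exact (congrFun₂ (h.first_L _ hyU) _ _).symm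
  · rintro y ⟨hy, hyU⟩ u v
    refine (flatExtd_pushForm he' h.smooth_K hU hy hyU u v).trans
      ((congrFun₂ (h.first_K _ hyU) _ _).trans ?_)
    set D' := pushData e D with hD'
    change (conj (-D'.Γ23 y u) * D'.M y v - conj (-D'.Γ23 y v) * D'.M y u) +
        ((-D'.Γ23 y u) * conj (D'.M y v) - (-D'.Γ23 y v) * conj (D'.M y u)) +
        (D'.Γ34 y u * D'.K y v - D'.Γ34 y v * D'.K y u) = _
    simp only [map_neg]
    ring
  · rintro y ⟨hy, hyU⟩ u v
    exact (flatExtd_pushForm he' h.smooth_Γ23 hU hy hyU u v).trans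
      (congrFun₂ (h.second_23 _ hyU) _ _)
  · rintro y ⟨hy, hyU⟩ u v
    have h1 := congrFun₂ (h.second_14 _ hyU) (mfderiv 𝓘(ℝ, F) 𝓘(ℝ, E) e.symm y u)
      (mfderiv 𝓘(ℝ, F) 𝓘(ℝ, E) e.symm y v)
    have hs : D.Γ14.SmoothOn U := fun p₀ => (h.smooth_Γ41 p₀).neg
    rw [← flatExtd_pushForm he' hs hU hy hyU] at h1
    have h2 : flatExtd (pushForm e D.Γ14) y u v = -flatExtd (pushForm e D.Γ41) y u v :=
      flatExtd_neg (pushForm e D.Γ41) y u v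
    rw [h2] at h1
    set D' := pushData e D with hD'
    change -flatExtd D'.Γ41 y u v = ((-D'.Γ41 y u) * (D'.Γ12 y v + D'.Γ34 y v) -
      (-D'.Γ41 y v) * (D'.Γ12 y u + D'.Γ34 y u)) +
        D'.Ψ1 y * (D'.M y u * conj (D'.M y v) - D'.M y v * conj (D'.M y u)) -
        D'.Ψ0 y * (D'.K y u * D'.M y v - D'.K y v * D'.M y u) at h1
    linear_combination -h1
  · rintro y ⟨hy, hyU⟩ u v
    have h1 := congrFun₂ (h.second_12_34 _ hyU) (mfderiv 𝓘(ℝ, F) 𝓘(ℝ, E) e.symm y u)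
      (mfderiv 𝓘(ℝ, F) 𝓘(ℝ, E) e.symm y v)
    have h2 := flatExtd_pushForm he' h.smooth_Γ12 hU hy hyU u v
    have h3 := flatExtd_pushForm he' h.smooth_Γ34 hU hy hyU u v
    set D' := pushData e D with hD'
    change (1 / 2) * (extd D.Γ12 _ _ _ + extd D.Γ34 _ _ _) =
        (D'.Γ23 y u * (-D'.Γ41 y v) - D'.Γ23 y v * (-D'.Γ41 y u)) +
        (D'.Ψ2 y - R / 24) * (D'.M y u * conj (D'.M y v) - D'.M y v * conj (D'.M y u)) -
        D'.Ψ1 y * (D'.K y u * D'.M y v - D'.K y v * D'.M y u) at h1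
    rw [← h2, ← h3] at h1
    refine h1.trans ?_
    ring

end

/-! ### Covariance under frame transformations -/

section

variable {F : Type*} [NormedAddCommGroup F] [NormedSpace ℝ F]

lemma dC_eq_fderiv (f : F → ℂ) (p : F) : dC (E := F) f p = fderiv ℝ f p := by
  ext v
  simp only [dC, mvfderiv, mfderiv_eq_fderiv]
  rfl

lemma flatExtd_smul {f : F → ℂ} {η : F → F →L[ℝ] ℂ} {p : F} (hf : DifferentiableAt ℝ f p)
    (hη : DifferentiableAt ℝ η p) (u v : F) :
    flatExtd (fun y => f y • η y) p u v =
      f p * flatExtd η p u v + (fderiv ℝ f p u * η p v - fderiv ℝ f p v * η p u) := by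
  rw [flatExtd, flatExtd, fderiv_fun_smul hf hη]
  simp only [FunLike.coe_add, FunLike.coe_smul, Pi.add_apply, Pi.smul_apply,
    ContinuousLinearMap.smulRight_apply, smul_eq_mul]
  ring

lemma flatExtd_add {η θ : F → F →L[ℝ] ℂ} {p : F} (hη : DifferentiableAt ℝ η p)
    (hθ : DifferentiableAt ℝ θ p) (u v : F) :
    flatExtd (fun y => η y + θ y) p u v = flatExtd η p u v + flatExtd θ p u v := by
  rw [flatExtd, fderiv_fun_add hη hθ]
  simp only [flatExtd, FunLike.coe_add, Pi.add_apply]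
  ring

lemma flatExtd_sub {η θ : F → F →L[ℝ] ℂ} {p : F} (hη : DifferentiableAt ℝ η p)
    (hθ : DifferentiableAt ℝ θ p) (u v : F) :
    flatExtd (fun y => η y - θ y) p u v = flatExtd η p u v - flatExtd θ p u v := by
  rw [flatExtd, fderiv_fun_sub hη hθ]
  simp only [flatExtd, FunLike.coe_sub, Pi.sub_apply]
  ring

lemma flatExtd_fderiv {f : F → ℂ} {p : F} (hf : ContDiffAt ℝ ∞ f p) (u v : F) :
    flatExtd (fun y => fderiv ℝ f y) p u v = 0 := by
  have := (hf.of_le (m := 2) ENat.LEInfty.out).isSymmSndFDerivAt (by simp)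
  rw [flatExtd]
  exact sub_eq_zero.2 (this u v)

/-- The complex conjugate of a one-form. -/
noncomputable def conjForm (η : F → F →L[ℝ] ℂ) : F → F →L[ℝ] ℂ :=
  fun p => (Complex.conjCLE : ℂ →L[ℝ] ℂ) ∘L η p

@[simp] lemma conjForm_apply (η : F → F →L[ℝ] ℂ) (p v : F) : conjForm η p v = conj (η p v) := rfl

lemma flatExtd_conjForm {η : F → F →L[ℝ] ℂ} {p : F} (hη : DifferentiableAt ℝ η p) (u v : F) :
    flatExtd (conjForm η) p u v = conj (flatExtd η p u v) := by
  have h : HasFDerivAt (conjForm η)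
      (ContinuousLinearMap.compL ℝ F ℂ ℂ (Complex.conjCLE : ℂ →L[ℝ] ℂ) ∘L fderiv ℝ η p) p :=
    (ContinuousLinearMap.compL ℝ F ℂ ℂ (Complex.conjCLE : ℂ →L[ℝ] ℂ)).hasFDerivAt.comp p
      hη.hasFDerivAt
  rw [flatExtd, h.fderiv, flatExtd, map_sub]
  rfl

lemma contDiffOn_conjForm {η : F → F →L[ℝ] ℂ} {U : Set F} (hη : ContDiffOn ℝ ∞ η U) :
    ContDiffOn ℝ ∞ (conjForm η) U :=
  (ContinuousLinearMap.compL ℝ F ℂ ℂ (Complex.conjCLE : ℂ →L[ℝ] ℂ)).contDiff.comp_contDiffOn hη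

lemma det_three (a b c d e f g h i : ℂ) : Matrix.det !![a, b, c; d, e, f; g, h, i] =
    a * e * i - a * f * h - b * d * i + b * f * g + c * d * h - c * e * g := by
  rw [Matrix.det_fin_three]
  rfl

lemma differentiableAt_of_contDiffOn {G : Type*} [NormedAddCommGroup G] [NormedSpace ℝ G]
    {f : F → G} {U : Set F} (hU : IsOpen U) (hf : ContDiffOn ℝ ∞ f U) (p : F) (hp : p ∈ U) :
    DifferentiableAt ℝ f p :=
  (hf.contDiffAt (hU.mem_nhds hp)).differentiableAt (by simp)

/-- The frame transformation with parameters `φ`, `A` and `z`. The transformed `Γ₁₂` and `Γ₃₄` are the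
imaginary and the real part of the transformed sum `Γ₁₂ + Γ₃₄`. -/
noncomputable def FlatData.gauge (D : FlatData F) (φ A : F → ℝ) (z : F → ℂ) : FlatData F where
  M p := Complex.exp (Complex.I * φ p) • D.M p
  K p := (A p : ℂ) • (D.K p + z p • conjForm D.M p + conj (z p) • D.M p)
  Γ41 p := ((A p : ℂ)⁻¹ * Complex.exp (-(Complex.I * φ p))) • D.Γ41 p
  Γ23 p := ((A p : ℂ) * Complex.exp (Complex.I * φ p)) •
    (D.Γ23 p + z p • (D.Γ12 p + D.Γ34 p) + z p ^ 2 • D.Γ41 p - fderiv ℝ z p)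
  Γ12 p := D.Γ12 p + z p • D.Γ41 p - conj (z p) • conjForm D.Γ41 p +
    Complex.I • fderiv ℝ (fun q => (φ q : ℂ)) p
  Γ34 p := D.Γ34 p + z p • D.Γ41 p + conj (z p) • conjForm D.Γ41 p +
    fderiv ℝ (fun q => (Real.log (A q) : ℂ)) p
  Ψ0 p := (A p : ℂ)⁻¹ ^ 2 * Complex.exp (-(2 * Complex.I * φ p)) * D.Ψ0 p
  Ψ1 p := (A p : ℂ)⁻¹ * Complex.exp (-(Complex.I * φ p)) * (D.Ψ1 p - z p * D.Ψ0 p)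
  Ψ2 p := D.Ψ2 p - 2 * z p * D.Ψ1 p + z p ^ 2 * D.Ψ0 p
  Ψ3 p := (A p : ℂ) * Complex.exp (Complex.I * φ p) *
    (D.Ψ3 p - 3 * z p * D.Ψ2 p + 3 * z p ^ 2 * D.Ψ1 p - z p ^ 3 * D.Ψ0 p)

/-- On a normed space `Data.gauge` is given by the same formulas with
Fréchet derivatives. -/
lemma FlatData.gauge_toData (D : FlatData F) (φ A : F → ℝ) (z : F → ℂ) :
    D.toData.gauge φ A z = (D.gauge φ A z).toData := by
  have h23 : (D.toData.gauge φ A z).Γ23 = (D.gauge φ A z).toData.Γ23 := by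
    funext p
    let d : F → F →L[ℝ] ℂ := dC z
    have hd : d p = fderiv ℝ z p := dC_eq_fderiv _ p
    change ((A p : ℂ) * Complex.exp (Complex.I * φ p)) •
      (D.Γ23 p + z p • (D.Γ12 p + D.Γ34 p) - z p ^ 2 • (-D.Γ41 p) - d p) =
      ((A p : ℂ) * Complex.exp (Complex.I * φ p)) •
      (D.Γ23 p + z p • (D.Γ12 p + D.Γ34 p) + z p ^ 2 • D.Γ41 p - fderiv ℝ z p)
    rw [hd, smul_neg, sub_neg_eq_add]
  have h12 : (D.toData.gauge φ A z).Γ12 = (D.gauge φ A z).toData.Γ12 := by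
    funext p
    let d : F → F →L[ℝ] ℂ := dC (fun q => (φ q : ℂ))
    have hd : d p = fderiv ℝ (fun q => (φ q : ℂ)) p := dC_eq_fderiv _ p
    change D.Γ12 p + z p • D.Γ41 p - conj (z p) • conjForm D.Γ41 p +
      Complex.I • d p = D.Γ12 p + z p • D.Γ41 p -
      conj (z p) • conjForm D.Γ41 p + Complex.I • fderiv ℝ (fun q => (φ q : ℂ)) p
    rw [hd]
  have h34 : (D.toData.gauge φ A z).Γ34 = (D.gauge φ A z).toData.Γ34 := by
    funext p
    let d : F → F →L[ℝ] ℂ := dC (fun q => (Real.log (A q) : ℂ))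
    have hd : d p = fderiv ℝ (fun q => (Real.log (A q) : ℂ)) p := dC_eq_fderiv _ p
    change D.Γ34 p + z p • D.Γ41 p + conj (z p) • conjForm D.Γ41 p +
      d p = D.Γ34 p + z p • D.Γ41 p +
      conj (z p) • conjForm D.Γ41 p + fderiv ℝ (fun q => (Real.log (A q) : ℂ)) p
    rw [hd]
  have : ∀ X Y : Data F F, X.M = Y.M → X.K = Y.K → X.Γ41 = Y.Γ41 → X.Γ23 = Y.Γ23 →
      X.Γ12 = Y.Γ12 → X.Γ34 = Y.Γ34 → X.Ψ0 = Y.Ψ0 → X.Ψ1 = Y.Ψ1 → X.Ψ2 = Y.Ψ2 → X.Ψ3 = Y.Ψ3 →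
      X = Y := by
    rintro ⟨⟩ ⟨⟩ h1 h2 h3 h4 h5 h6 h7 h8 h9 h10
    congr
  exact this _ _ rfl rfl rfl h23 h12 h34 rfl rfl rfl rfl

lemma conj_fderiv_ofReal {f : F → ℝ} {p : F} (hf : DifferentiableAt ℝ f p) (v : F) :
    conj (fderiv ℝ (fun q => (f q : ℂ)) p v) = fderiv ℝ (fun q => (f q : ℂ)) p v := by
  have : HasFDerivAt (fun q => (f q : ℂ)) (Complex.ofRealCLM ∘L fderiv ℝ f p) p :=
    Complex.ofRealCLM.hasFDerivAt.comp p hf.hasFDerivAt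
  rw [this.fderiv]
  exact Complex.conj_ofReal _

lemma fderiv_conj {f : F → ℂ} {p : F} (hf : DifferentiableAt ℝ f p) (v : F) :
    fderiv ℝ (fun q => conj (f q)) p v = conj (fderiv ℝ f p v) := by
  have : HasFDerivAt (fun q => conj (f q)) ((Complex.conjCLE : ℂ →L[ℝ] ℂ) ∘L fderiv ℝ f p) p :=
    (Complex.conjCLE : ℂ →L[ℝ] ℂ).hasFDerivAt.comp p hf.hasFDerivAt
  rw [this.fderiv]
  rfl

/-- The structure equations are covariant under frame transformations. After the derivatives of the
transformed forms are expanded, each transformed equation is a linear combination of the original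
equations and their complex conjugates. -/
theorem FlatData.isSolutionOn_gauge {R : ℝ} {D : FlatData F} {U : Set F} (hU : IsOpen U)
    (h : D.IsSolutionOn R U) {φ A : F → ℝ} {z : F → ℂ} (hφ : ContDiffOn ℝ ∞ φ U)
    (hA : ContDiffOn ℝ ∞ A U) (hz : ContDiffOn ℝ ∞ z U) (hpos : ∀ p ∈ U, 0 < A p) :
    (D.gauge φ A z).IsSolutionOn R U := by
  have hφ' : ContDiffOn ℝ ∞ (fun p => (φ p : ℂ)) U := Complex.ofRealCLM.contDiff.comp_contDiffOn hφ
  have hA' : ContDiffOn ℝ ∞ (fun p => (A p : ℂ)) U := Complex.ofRealCLM.contDiff.comp_contDiffOn hA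
  have hL : ContDiffOn ℝ ∞ (fun p => Real.log (A p)) U := hA.log fun p hp => (hpos p hp).ne'
  have hL' : ContDiffOn ℝ ∞ (fun p => (Real.log (A p) : ℂ)) U :=
    Complex.ofRealCLM.contDiff.comp_contDiffOn hL
  have hA0 : ∀ p ∈ U, (A p : ℂ) ≠ 0 := fun p hp => by exact_mod_cast (hpos p hp).ne'
  have hzb : ContDiffOn ℝ ∞ (fun p => conj (z p)) U := Complex.conjCLE.contDiff.comp_contDiffOn hz
  have hexp : ContDiffOn ℝ ∞ (fun p => Complex.exp (Complex.I * φ p)) U :=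
    (contDiffOn_const.mul hφ').cexp
  have hexp' : ContDiffOn ℝ ∞ (fun p => Complex.exp (-(Complex.I * φ p))) U :=
    (contDiffOn_const.mul hφ').neg.cexp
  have cM := contDiffOn_conjForm h.smooth_M
  have c41 := contDiffOn_conjForm h.smooth_Γ41
  have ddz : ContDiffOn ℝ ∞ (fun p => fderiv ℝ z p) U := hz.fderiv_of_isOpen hU (by simp)
  have ddφ : ContDiffOn ℝ ∞ (fun p => fderiv ℝ (fun q => (φ q : ℂ)) p) U :=
    hφ'.fderiv_of_isOpen hU (by simp)
  have ddL : ContDiffOn ℝ ∞ (fun p => fderiv ℝ (fun q => (Real.log (A q) : ℂ)) p) U :=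
    hL'.fderiv_of_isOpen hU (by simp)
  have dexp : ∀ p ∈ U, ∀ v, fderiv ℝ (fun p => Complex.exp (Complex.I * φ p)) p v =
      Complex.exp (Complex.I * φ p) * (Complex.I * fderiv ℝ (fun q => (φ q : ℂ)) p v) := by
    intro p hp v
    have := (((differentiableAt_of_contDiffOn hU hφ' p hp).hasFDerivAt.const_mul Complex.I).cexp).fderiv
    rw [this]
    simp only [FunLike.coe_smul, Pi.smul_apply, smul_eq_mul]
  have dA : ∀ p ∈ U, ∀ v, fderiv ℝ (fun p => (A p : ℂ)) p v =
      A p * fderiv ℝ (fun q => (Real.log (A q) : ℂ)) p v := by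
    intro p hp v
    have h1 := (differentiableAt_of_contDiffOn hU hA p hp).hasFDerivAt
    have h2 : HasFDerivAt (fun q => (A q : ℂ)) (Complex.ofRealCLM ∘L fderiv ℝ A p) p :=
      Complex.ofRealCLM.hasFDerivAt.comp p h1
    have h3 : HasFDerivAt (fun q => (Real.log (A q) : ℂ))
        (Complex.ofRealCLM ∘L ((A p)⁻¹ • fderiv ℝ A p)) p :=
      Complex.ofRealCLM.hasFDerivAt.comp p (h1.log (hpos p hp).ne')
    rw [h2.fderiv, h3.fderiv]
    simp only [ContinuousLinearMap.comp_apply, FunLike.coe_smul, Pi.smul_apply, smul_eq_mul,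
      Complex.ofRealCLM_apply, Complex.ofReal_mul, Complex.ofReal_inv]
    rw [mul_inv_cancel_left₀ (hA0 p hp)]
  have hconjexp : ∀ p, conj (Complex.exp (Complex.I * φ p)) = Complex.exp (-(Complex.I * φ p)) := by
    intro p
    rw [← Complex.exp_conj, map_mul, Complex.conj_I, Complex.conj_ofReal, neg_mul]
  have hconjexp' : ∀ p, conj (Complex.exp (-(Complex.I * φ p))) = Complex.exp (Complex.I * φ p) :=
      by
    intro p
    rw [← hconjexp, Complex.conj_conj]
  have hexp2 : ∀ p, Complex.exp (-(2 * Complex.I * φ p)) =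
      Complex.exp (-(Complex.I * φ p)) ^ 2 := by
    intro p
    rw [← Complex.exp_nat_mul]
    congr 1
    push_cast
    ring
  have htti : ∀ p, Complex.exp (Complex.I * φ p) * Complex.exp (-(Complex.I * φ p)) = 1 := by
    intro p
    rw [← Complex.exp_add, add_neg_cancel, Complex.exp_zero]
  have eM : ∀ p ∈ U, ∀ u v, flatExtd (D.gauge φ A z).M p u v = Complex.exp (Complex.I * φ p) *
      (flatExtd D.M p u v + Complex.I * (fderiv ℝ (fun q => (φ q : ℂ)) p u * D.M p v -
        fderiv ℝ (fun q => (φ q : ℂ)) p v * D.M p u)) := by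
    intro p hp u v
    refine (flatExtd_smul (differentiableAt_of_contDiffOn hU hexp p hp)
        (differentiableAt_of_contDiffOn hU h.smooth_M p hp) u v).trans ?_
    rw [dexp p hp, dexp p hp]
    ring
  have sMz := (h.smooth_K.add (hz.smul cM)).add (hzb.smul h.smooth_M)
  have eK : ∀ p ∈ U, ∀ u v, flatExtd (D.gauge φ A z).K p u v =
      A p * (flatExtd D.K p u v + z p * conj (flatExtd D.M p u v) + conj (z p) * flatExtd D.M p u v
        + (fderiv ℝ z p u * conj (D.M p v) - fderiv ℝ z p v * conj (D.M p u))
        + (conj (fderiv ℝ z p u) * D.M p v - conj (fderiv ℝ z p v) * D.M p u)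
        + (fderiv ℝ (fun q => (Real.log (A q) : ℂ)) p u *
            (D.K p v + z p * conj (D.M p v) + conj (z p) * D.M p v)
          - fderiv ℝ (fun q => (Real.log (A q) : ℂ)) p v *
            (D.K p u + z p * conj (D.M p u) + conj (z p) * D.M p u))) := by
    intro p hp u v
    refine (flatExtd_smul (differentiableAt_of_contDiffOn hU hA' p hp)
        (differentiableAt_of_contDiffOn hU sMz p hp) u v).trans ?_
    have e1 := flatExtd_add (differentiableAt_of_contDiffOn hU (h.smooth_K.add (hz.smul cM)) p hp)
      (differentiableAt_of_contDiffOn hU (hzb.smul h.smooth_M) p hp) u v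
    have e2 := flatExtd_add (differentiableAt_of_contDiffOn hU h.smooth_K p hp)
        (differentiableAt_of_contDiffOn hU (hz.smul cM) p hp) u v
    have e3 := flatExtd_smul (differentiableAt_of_contDiffOn hU hz p hp)
        (differentiableAt_of_contDiffOn hU cM p hp) u v
    have e4 := flatExtd_smul (differentiableAt_of_contDiffOn hU hzb p hp)
        (differentiableAt_of_contDiffOn hU h.smooth_M p hp) u v
    refine (congrArg₂ (· + ·) (congrArg _ (e1.trans (congrArg₂ (· + ·) (e2.trans
      (congrArg₂ (· + ·) rfl e3)) e4))) rfl).trans ?_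
    rw [flatExtd_conjForm (differentiableAt_of_contDiffOn hU h.smooth_M p hp),
        fderiv_conj (differentiableAt_of_contDiffOn hU hz p hp),
      fderiv_conj (differentiableAt_of_contDiffOn hU hz p hp), dA p hp, dA p hp]
    simp only [FunLike.coe_add, FunLike.coe_smul, Pi.add_apply, Pi.smul_apply, smul_eq_mul,
      conjForm_apply, Pi.smul_apply']
    ring
  have e41 : ∀ p ∈ U, ∀ u v, flatExtd (D.gauge φ A z).Γ41 p u v =
      ((A p : ℂ)⁻¹ * Complex.exp (-(Complex.I * φ p))) * (flatExtd D.Γ41 p u v -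
        ((fderiv ℝ (fun q => (Real.log (A q) : ℂ)) p u +
          Complex.I * fderiv ℝ (fun q => (φ q : ℂ)) p u) * D.Γ41 p v -
        (fderiv ℝ (fun q => (Real.log (A q) : ℂ)) p v +
          Complex.I * fderiv ℝ (fun q => (φ q : ℂ)) p v) * D.Γ41 p u)) := by
    intro p hp u v
    have hd : ∀ w, fderiv ℝ (fun p => (A p : ℂ)⁻¹ * Complex.exp (-(Complex.I * φ p))) p w =
        -((A p : ℂ)⁻¹ * Complex.exp (-(Complex.I * φ p))) *
        (fderiv ℝ (fun q => (Real.log (A q) : ℂ)) p w +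
          Complex.I * fderiv ℝ (fun q => (φ q : ℂ)) p w) := by
      intro w
      have h1 := ((differentiableAt_of_contDiffOn hU hφ' p hp).hasFDerivAt.const_mul Complex.I).fun_neg.cexp
      have h2 := (hasDerivAt_inv (hA0 p hp)).comp_hasFDerivAt p
          (differentiableAt_of_contDiffOn hU hA' p hp).hasFDerivAt
      have h3 := (h2.mul h1).fderiv
      refine (DFunLike.congr_fun h3 w).trans ?_
      simp only [FunLike.coe_add, FunLike.coe_smul, Pi.add_apply, Pi.smul_apply, smul_eq_mul,
        FunLike.coe_neg, Pi.neg_apply, dA p hp, Function.comp_apply]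
      have := hA0 p hp
      field_simp
      ring
    refine (flatExtd_smul (differentiableAt_of_contDiffOn hU ((hA'.inv hA0).mul hexp') p hp)
      (differentiableAt_of_contDiffOn hU h.smooth_Γ41 p hp) u v).trans ?_
    refine (congrArg₂ (· + ·) rfl (congrArg₂ (· - ·) (congrArg (· * _) (hd u))
      (congrArg (· * _) (hd v)))).trans ?_
    simp only [Pi.inv_apply]
    ring
  have e12 : ∀ p ∈ U, ∀ u v, flatExtd (D.gauge φ A z).Γ12 p u v = flatExtd D.Γ12 p u v +
      z p * flatExtd D.Γ41 p u v - conj (z p) * conj (flatExtd D.Γ41 p u v) +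
      (fderiv ℝ z p u * D.Γ41 p v - fderiv ℝ z p v * D.Γ41 p u) -
      (conj (fderiv ℝ z p u) * conj (D.Γ41 p v) - conj (fderiv ℝ z p v) * conj (D.Γ41 p u)) := by
    intro p hp u v
    have e1 := flatExtd_add (differentiableAt_of_contDiffOn hU
        ((h.smooth_Γ12.add (hz.smul h.smooth_Γ41)).sub (hzb.smul c41)) p hp)
      (differentiableAt_of_contDiffOn hU (ddφ.const_smul Complex.I) p hp) u v
    have e2 := flatExtd_sub (differentiableAt_of_contDiffOn hU
        (h.smooth_Γ12.add (hz.smul h.smooth_Γ41)) p hp)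
      (differentiableAt_of_contDiffOn hU (hzb.smul c41) p hp) u v
    have e3 := flatExtd_add (differentiableAt_of_contDiffOn hU h.smooth_Γ12 p hp)
        (differentiableAt_of_contDiffOn hU (hz.smul h.smooth_Γ41) p hp) u v
    have e4 := flatExtd_smul (differentiableAt_of_contDiffOn hU hz p hp)
        (differentiableAt_of_contDiffOn hU h.smooth_Γ41 p hp) u v
    have e5 := flatExtd_smul (differentiableAt_of_contDiffOn hU hzb p hp)
        (differentiableAt_of_contDiffOn hU c41 p hp) u v
    have e6 := flatExtd_smul (f := fun _ => Complex.I) (differentiableAt_const _)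
      (differentiableAt_of_contDiffOn hU ddφ p hp) u v
    refine (e1.trans (congrArg₂ (· + ·) (e2.trans (congrArg₂ (· - ·) (e3.trans
      (congrArg₂ (· + ·) rfl e4)) e5)) e6)).trans ?_
    rw [flatExtd_conjForm (differentiableAt_of_contDiffOn hU h.smooth_Γ41 p hp),
        fderiv_conj (differentiableAt_of_contDiffOn hU hz p hp),
      fderiv_conj (differentiableAt_of_contDiffOn hU hz p hp),
          flatExtd_fderiv (hφ'.contDiffAt (hU.mem_nhds hp))]
    simp only [conjForm_apply, fderiv_fun_const, Pi.zero_apply, FunLike.coe_zero]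
    ring
  have e34 : ∀ p ∈ U, ∀ u v, flatExtd (D.gauge φ A z).Γ34 p u v = flatExtd D.Γ34 p u v +
      z p * flatExtd D.Γ41 p u v + conj (z p) * conj (flatExtd D.Γ41 p u v) +
      (fderiv ℝ z p u * D.Γ41 p v - fderiv ℝ z p v * D.Γ41 p u) +
      (conj (fderiv ℝ z p u) * conj (D.Γ41 p v) - conj (fderiv ℝ z p v) * conj (D.Γ41 p u)) := by
    intro p hp u v
    have e1 := flatExtd_add (differentiableAt_of_contDiffOn hU
        ((h.smooth_Γ34.add (hz.smul h.smooth_Γ41)).add (hzb.smul c41)) p hp)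
      (differentiableAt_of_contDiffOn hU ddL p hp) u v
    have e2 := flatExtd_add (differentiableAt_of_contDiffOn hU
        (h.smooth_Γ34.add (hz.smul h.smooth_Γ41)) p hp)
      (differentiableAt_of_contDiffOn hU (hzb.smul c41) p hp) u v
    have e3 := flatExtd_add (differentiableAt_of_contDiffOn hU h.smooth_Γ34 p hp)
        (differentiableAt_of_contDiffOn hU (hz.smul h.smooth_Γ41) p hp) u v
    have e4 := flatExtd_smul (differentiableAt_of_contDiffOn hU hz p hp)
        (differentiableAt_of_contDiffOn hU h.smooth_Γ41 p hp) u v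
    have e5 := flatExtd_smul (differentiableAt_of_contDiffOn hU hzb p hp)
        (differentiableAt_of_contDiffOn hU c41 p hp) u v
    refine (e1.trans (congrArg₂ (· + ·) (e2.trans (congrArg₂ (· + ·) (e3.trans
      (congrArg₂ (· + ·) rfl e4)) e5)) rfl)).trans ?_
    rw [flatExtd_conjForm (differentiableAt_of_contDiffOn hU h.smooth_Γ41 p hp),
        fderiv_conj (differentiableAt_of_contDiffOn hU hz p hp),
      fderiv_conj (differentiableAt_of_contDiffOn hU hz p hp),
          flatExtd_fderiv (hL'.contDiffAt (hU.mem_nhds hp))]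
    simp only [conjForm_apply]
    ring
  have s23 := ((h.smooth_Γ23.add (hz.smul (h.smooth_Γ12.add h.smooth_Γ34))).add
      ((hz.pow 2).smul h.smooth_Γ41)).sub ddz
  have e23 : ∀ p ∈ U, ∀ u v, flatExtd (D.gauge φ A z).Γ23 p u v =
      (A p * Complex.exp (Complex.I * φ p)) * (flatExtd D.Γ23 p u v +
        z p * (flatExtd D.Γ12 p u v + flatExtd D.Γ34 p u v) + z p ^ 2 * flatExtd D.Γ41 p u v +
        (fderiv ℝ z p u * (D.Γ12 p v + D.Γ34 p v) - fderiv ℝ z p v * (D.Γ12 p u + D.Γ34 p u)) +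
        2 * z p * (fderiv ℝ z p u * D.Γ41 p v - fderiv ℝ z p v * D.Γ41 p u) +
        ((fderiv ℝ (fun q => (Real.log (A q) : ℂ)) p u +
          Complex.I * fderiv ℝ (fun q => (φ q : ℂ)) p u) *
            (D.Γ23 p v + z p * (D.Γ12 p v + D.Γ34 p v) + z p ^ 2 * D.Γ41 p v - fderiv ℝ z p v) -
        (fderiv ℝ (fun q => (Real.log (A q) : ℂ)) p v +
          Complex.I * fderiv ℝ (fun q => (φ q : ℂ)) p v) *
            (D.Γ23 p u + z p * (D.Γ12 p u + D.Γ34 p u) + z p ^ 2 * D.Γ41 p u -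
              fderiv ℝ z p u))) := by
    intro p hp u v
    have hd : ∀ w, fderiv ℝ (fun p => (A p : ℂ) * Complex.exp (Complex.I * φ p)) p w =
        (A p * Complex.exp (Complex.I * φ p)) *
        (fderiv ℝ (fun q => (Real.log (A q) : ℂ)) p w +
          Complex.I * fderiv ℝ (fun q => (φ q : ℂ)) p w) := by
      intro w
      rw [fderiv_fun_mul (differentiableAt_of_contDiffOn hU hA' p hp)
          (differentiableAt_of_contDiffOn hU hexp p hp)]
      simp only [FunLike.coe_add, FunLike.coe_smul, Pi.add_apply, Pi.smul_apply, smul_eq_mul,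
        dA p hp, dexp p hp]
      ring
    have hd2 : ∀ w, fderiv ℝ (fun p => z p ^ 2) p w = 2 * z p * fderiv ℝ z p w := by
      intro w
      rw [fderiv_fun_pow 2 (differentiableAt_of_contDiffOn hU hz p hp)]
      simp only [FunLike.coe_smul, Pi.smul_apply, smul_eq_mul, nsmul_eq_mul]
      push_cast
      ring
    have e0 := flatExtd_smul (differentiableAt_of_contDiffOn hU (hA'.mul hexp) p hp)
        (differentiableAt_of_contDiffOn hU s23 p hp) u v
    have e1 := flatExtd_sub (differentiableAt_of_contDiffOn hU
        ((h.smooth_Γ23.add (hz.smul (h.smooth_Γ12.add h.smooth_Γ34))).add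
      ((hz.pow 2).smul h.smooth_Γ41)) p hp) (differentiableAt_of_contDiffOn hU ddz p hp) u v
    have e2 := flatExtd_add (differentiableAt_of_contDiffOn hU
        (h.smooth_Γ23.add (hz.smul (h.smooth_Γ12.add h.smooth_Γ34))) p hp)
      (differentiableAt_of_contDiffOn hU ((hz.pow 2).smul h.smooth_Γ41) p hp) u v
    have e3 := flatExtd_add (differentiableAt_of_contDiffOn hU h.smooth_Γ23 p hp)
      (differentiableAt_of_contDiffOn hU (hz.smul (h.smooth_Γ12.add h.smooth_Γ34)) p hp) u v
    have e4 := flatExtd_smul (differentiableAt_of_contDiffOn hU hz p hp)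
        (differentiableAt_of_contDiffOn hU (h.smooth_Γ12.add h.smooth_Γ34) p hp) u v
    have e5 := flatExtd_add (differentiableAt_of_contDiffOn hU h.smooth_Γ12 p hp)
        (differentiableAt_of_contDiffOn hU h.smooth_Γ34 p hp) u v
    have e6 := flatExtd_smul (differentiableAt_of_contDiffOn hU (hz.pow 2) p hp)
        (differentiableAt_of_contDiffOn hU h.smooth_Γ41 p hp) u v
    refine (e0.trans (congrArg₂ (· + ·) (congrArg _ (e1.trans (congrArg₂ (· - ·) (e2.trans
      (congrArg₂ (· + ·) (e3.trans (congrArg₂ (· + ·) rfl (e4.trans (congrArg₂ (· + ·)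
      (congrArg _ e5) rfl)))) e6)) (flatExtd_fderiv (hz.contDiffAt (hU.mem_nhds hp)) u v))))
      (congrArg₂ (· - ·) (congrArg (· * _) (hd u)) (congrArg (· * _) (hd v))))).trans ?_
    have h7 := hd2 u
    have h8 := hd2 v
    change _ * (_ + (_ + (_ * (D.Γ12 p v + D.Γ34 p v) - _ * (D.Γ12 p u + D.Γ34 p u))) +
      (z p ^ 2 * _ + (fderiv ℝ (fun p => z p ^ 2) p u * _ - fderiv ℝ (fun p => z p ^ 2) p v * _))
      - 0) + (_ * (D.Γ23 p v + z p * (D.Γ12 p v + D.Γ34 p v) + z p ^ 2 * D.Γ41 p v - fderiv ℝ z p v)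
      - _ * (D.Γ23 p u + z p * (D.Γ12 p u + D.Γ34 p u) + z p ^ 2 * D.Γ41 p u - fderiv ℝ z p u)) = _
    rw [h7, h8]
    ring
  refine ⟨hexp.smul h.smooth_M, hA'.smul sMz,
    ((hA'.inv hA0).mul hexp').smul h.smooth_Γ41, (hA'.mul hexp).smul s23,
    ((h.smooth_Γ12.add (hz.smul h.smooth_Γ41)).sub (hzb.smul c41)).add (ddφ.const_smul Complex.I),
    ((h.smooth_Γ34.add (hz.smul h.smooth_Γ41)).add (hzb.smul c41)).add ddL,
    ?_, ?_, ?_, ?_, ?_, ?_, ?_, ?_, ?_, ?_⟩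
  · intro p hp v
    have h1 := h.real_K p hp v
    simp only [gauge, FunLike.coe_add, FunLike.coe_smul, Pi.add_apply, Pi.smul_apply, smul_eq_mul,
      conjForm_apply, map_add, map_mul, Complex.conj_conj, Complex.conj_ofReal]
    linear_combination (A p : ℂ) * h1
  · intro p hp v
    have h1 := h.conj_Γ12 p hp v
    have h2 := conj_fderiv_ofReal (differentiableAt_of_contDiffOn hU hφ p hp) v
    simp only [gauge, FunLike.coe_add, FunLike.coe_sub, FunLike.coe_smul, Pi.add_apply,
      Pi.sub_apply, Pi.smul_apply, smul_eq_mul,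
      conjForm_apply, map_add, map_sub, map_mul, Complex.conj_conj, Complex.conj_I]
    linear_combination h1 - Complex.I * h2
  · intro p hp v
    have h1 := h.real_Γ34 p hp v
    have h2 := conj_fderiv_ofReal (differentiableAt_of_contDiffOn hU hL p hp) v
    simp only [gauge, FunLike.coe_add, FunLike.coe_smul, Pi.add_apply, Pi.smul_apply, smul_eq_mul,
      conjForm_apply, map_add, map_mul, Complex.conj_conj]
    linear_combination h1 + h2
  · intro p hp
    obtain ⟨u, v, w, h1⟩ := h.coframe p hp
    refine ⟨u, v, w, ?_⟩
    have key : Matrix.det !![(D.gauge φ A z).M p u, (D.gauge φ A z).M p v, (D.gauge φ A z).M p w;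
        conj ((D.gauge φ A z).M p u), conj ((D.gauge φ A z).M p v), conj ((D.gauge φ A z).M p w);
        (D.gauge φ A z).K p u, (D.gauge φ A z).K p v, (D.gauge φ A z).K p w] =
        A p * Matrix.det !![D.M p u, D.M p v, D.M p w;
        conj (D.M p u), conj (D.M p v), conj (D.M p w); D.K p u, D.K p v, D.K p w] := by
      simp only [gauge, FunLike.coe_add, FunLike.coe_smul, Pi.add_apply, Pi.smul_apply,
        smul_eq_mul, conjForm_apply, map_mul, hconjexp]
      have h2 := htti p
      simp only [det_three] at *
      linear_combination (A p * (D.M p u * conj (D.M p v) * D.K p w -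
        D.M p u * conj (D.M p w) * D.K p v - D.M p v * conj (D.M p u) * D.K p w +
        D.M p v * conj (D.M p w) * D.K p u + D.M p w * conj (D.M p u) * D.K p v -
        D.M p w * conj (D.M p v) * D.K p u)) * h2
    rw [key]
    exact mul_ne_zero (hA0 p hp) h1
  · intro p hp u v
    have hAA : (A p : ℂ) * (A p : ℂ)⁻¹ = 1 := mul_inv_cancel₀ (hA0 p hp)
    have hT := htti p
    rw [eM p hp]
    simp only [gauge, FunLike.coe_add, FunLike.coe_sub, FunLike.coe_smul, Pi.add_apply,
      Pi.sub_apply, Pi.smul_apply, smul_eq_mul, conjForm_apply, map_mul, map_inv₀,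
      Complex.conj_ofReal, hconjexp', hexp2]
    set t := Complex.exp (Complex.I * φ p)
    set s := Complex.exp (-(Complex.I * φ p))
    linear_combination t * h.first_M p hp u v - t * z p * h.first_L p hp u v -
      t * (conj (D.Γ41 p u) * (D.K p v + z p * conj (D.M p v) + conj (z p) * D.M p v) -
        conj (D.Γ41 p v) * (D.K p u + z p * conj (D.M p u) + conj (z p) * D.M p u)) * hAA
  · intro p hp u v
    have hAA : (A p : ℂ) * (A p : ℂ)⁻¹ = 1 := mul_inv_cancel₀ (hA0 p hp)
    have hT := htti p
    simp only [gauge, FunLike.coe_smul, Pi.smul_apply, smul_eq_mul, map_mul, map_inv₀,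
      Complex.conj_ofReal, hconjexp, hconjexp', hexp2]
    set t := Complex.exp (Complex.I * φ p)
    set s := Complex.exp (-(Complex.I * φ p))
    linear_combination (A p : ℂ)⁻¹ * t * s * h.first_L p hp u v
  · intro p hp u v
    have hAA : (A p : ℂ) * (A p : ℂ)⁻¹ = 1 := mul_inv_cancel₀ (hA0 p hp)
    have hT := htti p
    have eqMb : conj (flatExtd D.M p u v) = -(D.Γ12 p u * conj (D.M p v) - D.Γ12 p v *
        conj (D.M p u)) + (D.Γ41 p u * D.K p v - D.Γ41 p v * D.K p u) := by
      rw [h.first_M p hp u v]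
      simp only [map_add, map_sub, map_mul, Complex.conj_conj, h.conj_Γ12 p hp, h.real_K p hp]
      ring
    rw [eK p hp]
    simp only [gauge, FunLike.coe_add, FunLike.coe_sub, FunLike.coe_smul, Pi.add_apply,
      Pi.sub_apply, Pi.smul_apply, smul_eq_mul, conjForm_apply, map_add, map_sub, map_mul, map_pow,
          Complex.conj_ofReal, hconjexp, hexp2,
      h.conj_Γ12 p hp, h.real_Γ34 p hp]
    set t := Complex.exp (Complex.I * φ p)
    set s := Complex.exp (-(Complex.I * φ p))
    linear_combination A p * h.first_K p hp u v + A p * z p * eqMb +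
      A p * conj (z p) * h.first_M p hp u v - A p * z p * conj (z p) * h.first_L p hp u v +
      A p * ((conj (D.Γ23 p u) + conj (z p) * (-D.Γ12 p u + D.Γ34 p u) + conj (z p) ^ 2 *
          conj (D.Γ41 p u) - conj (fderiv ℝ z p u)) * D.M p v -
        (conj (D.Γ23 p v) + conj (z p) * (-D.Γ12 p v + D.Γ34 p v) + conj (z p) ^ 2 *
            conj (D.Γ41 p v) - conj (fderiv ℝ z p v)) * D.M p u +
        (D.Γ23 p u + z p * (D.Γ12 p u + D.Γ34 p u) + z p ^ 2 * D.Γ41 p u - fderiv ℝ z p u) *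
            conj (D.M p v) -
        (D.Γ23 p v + z p * (D.Γ12 p v + D.Γ34 p v) + z p ^ 2 * D.Γ41 p v - fderiv ℝ z p v) *
            conj (D.M p u)) * hT
  · intro p hp u v
    have hAA : (A p : ℂ) * (A p : ℂ)⁻¹ = 1 := mul_inv_cancel₀ (hA0 p hp)
    have hT := htti p
    rw [e23 p hp]
    simp only [gauge, FunLike.coe_add, FunLike.coe_sub, FunLike.coe_smul, Pi.add_apply,
      Pi.sub_apply, Pi.smul_apply, smul_eq_mul, conjForm_apply, map_mul, hconjexp, hexp2]
    set t := Complex.exp (Complex.I * φ p)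
    set s := Complex.exp (-(Complex.I * φ p))
    linear_combination A p * t * h.second_23 p hp u v + 2 * A p * t * z p *
        h.second_12_34 p hp u v +
      A p * t * z p ^ 2 * h.second_14 p hp u v +
      A p * t * (D.Ψ3 p - 3 * z p * D.Ψ2 p + 3 * z p ^ 2 * D.Ψ1 p - z p ^ 3 * D.Ψ0 p) *
        (D.M p u * conj (D.M p v) - D.M p v * conj (D.M p u)) * hT
  · intro p hp u v
    have hAA : (A p : ℂ) * (A p : ℂ)⁻¹ = 1 := mul_inv_cancel₀ (hA0 p hp)
    have hT := htti p
    rw [e41 p hp]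
    simp only [gauge, FunLike.coe_add, FunLike.coe_sub, FunLike.coe_smul, Pi.add_apply,
      Pi.sub_apply, Pi.smul_apply, smul_eq_mul, conjForm_apply, map_mul, hconjexp, hexp2]
    set t := Complex.exp (Complex.I * φ p)
    set s := Complex.exp (-(Complex.I * φ p))
    linear_combination (A p : ℂ)⁻¹ * s * h.second_14 p hp u v +
      (A p : ℂ)⁻¹ * s * (D.Ψ1 p - z p * D.Ψ0 p) *
        (D.M p u * conj (D.M p v) - D.M p v * conj (D.M p u)) * hT -
      (A p : ℂ)⁻¹ * s * D.Ψ0 p *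
        ((D.K p u + z p * conj (D.M p u)) * D.M p v - (D.K p v + z p * conj (D.M p v)) * D.M p u) *
        (t * s * hAA + hT)
  · intro p hp u v
    have hAA : (A p : ℂ) * (A p : ℂ)⁻¹ = 1 := mul_inv_cancel₀ (hA0 p hp)
    have hT := htti p
    rw [e12 p hp, e34 p hp]
    simp only [gauge, FunLike.coe_add, FunLike.coe_sub, FunLike.coe_smul, Pi.add_apply,
      Pi.sub_apply, Pi.smul_apply, smul_eq_mul, conjForm_apply, map_mul, hconjexp, hexp2]
    set t := Complex.exp (Complex.I * φ p)
    set s := Complex.exp (-(Complex.I * φ p))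
    linear_combination h.second_12_34 p hp u v + z p * h.second_14 p hp u v +
      ((D.Γ23 p u + z p * (D.Γ12 p u + D.Γ34 p u) + z p ^ 2 * D.Γ41 p u - fderiv ℝ z p u) *
          D.Γ41 p v -
        (D.Γ23 p v + z p * (D.Γ12 p v + D.Γ34 p v) + z p ^ 2 * D.Γ41 p v - fderiv ℝ z p v) *
            D.Γ41 p u +
        (D.Ψ1 p - z p * D.Ψ0 p) *
          ((D.K p u + z p * conj (D.M p u)) * D.M p v - (D.K p v + z p * conj (D.M p v)) * D.M p u))
              *
        (t * s * hAA + hT) -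
      (D.Ψ2 p - 2 * z p * D.Ψ1 p + z p ^ 2 * D.Ψ0 p - R / 24) *
        (D.M p u * conj (D.M p v) - D.M p v * conj (D.M p u)) * hT

end

/-! ### Components in the coordinates `(ρ, ζ)` -/

section Components

/-- The coefficient of `dρ` of a real-linear form on `ℝ × ℂ` with coordinates `(ρ, ζ)`. -/
noncomputable def cρ (A : ℝ × ℂ →L[ℝ] ℂ) : ℂ := A (1, 0)

/-- The coefficient of `dζ` of a real-linear form on `ℝ × ℂ` with coordinates `(ρ, ζ)`. -/
noncomputable def cζ (A : ℝ × ℂ →L[ℝ] ℂ) : ℂ :=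
  (1 / 2) * (A (0, 1) - Complex.I * A (0, Complex.I))

/-- The coefficient of `dζ̄` of a real-linear form on `ℝ × ℂ` with coordinates `(ρ, ζ)`. -/
noncomputable def cζbar (A : ℝ × ℂ →L[ℝ] ℂ) : ℂ :=
  (1 / 2) * (A (0, 1) + Complex.I * A (0, Complex.I))

lemma clm_apply_eq (A : ℝ × ℂ →L[ℝ] ℂ) (v : ℝ × ℂ) :
    A v = v.1 * cρ A + v.2 * cζ A + conj v.2 * cζbar A := by
  have h := clm_prod_apply A v.1 v.2
  have h1 : (v.2 : ℂ) = v.2.re + v.2.im * Complex.I := (Complex.re_add_im _).symm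
  have h2 : conj v.2 = v.2.re - v.2.im * Complex.I := by apply Complex.ext <;> simp
  have h3 : A v = A (v.1, v.2) := rfl
  rw [h3, h, h2, cρ, cζ, cζbar]
  linear_combination (-(1 / 2) * (A (0, 1) - Complex.I * A (0, Complex.I))) * h1 +
    (v.2.im * A (0, Complex.I)) * Complex.I_mul_I

lemma cζbar_real {A : ℝ × ℂ →L[ℝ] ℂ} (h : ∀ v, conj (A v) = A v) : cζbar A = conj (cζ A) := by
  simp only [cζ, cζbar, map_mul, map_sub, map_div₀, map_one, Complex.conj_I, h, map_ofNat]
  ring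

lemma cζbar_imag {A : ℝ × ℂ →L[ℝ] ℂ} (h : ∀ v, conj (A v) = -A v) : cζbar A = -conj (cζ A) := by
  simp only [cζ, cζbar, map_mul, map_sub, map_div₀, map_one, Complex.conj_I, h, map_ofNat]
  ring

variable {η : ℝ × ℂ → (ℝ × ℂ →L[ℝ] ℂ)} {p : ℝ × ℂ}

lemma fderiv_apply_const (hη : DifferentiableAt ℝ η p) (v u : ℝ × ℂ) :
    fderiv ℝ (fun p => η p v) p u = fderiv ℝ η p u v := by
  rw [fderiv_clm_apply hη (differentiableAt_const v)]
  simp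

lemma fderiv_cρ (hη : DifferentiableAt ℝ η p) (u : ℝ × ℂ) :
    fderiv ℝ (fun p => cρ (η p)) p u = cρ (fderiv ℝ η p u) :=
  fderiv_apply_const hη _ _

lemma fderiv_cζ (hη : DifferentiableAt ℝ η p) (u : ℝ × ℂ) :
    fderiv ℝ (fun p => cζ (η p)) p u = cζ (fderiv ℝ η p u) := by
  have h : ∀ v, HasFDerivAt (fun p => η p v) (fderiv ℝ (fun p => η p v) p) p := fun v =>
    (hη.clm_apply (differentiableAt_const v)).hasFDerivAt
  have := (((h (0, 1)).sub ((h (0, Complex.I)).const_mul Complex.I)).const_mul (1 / 2)).fderiv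
  refine (DFunLike.congr_fun this u).trans ?_
  simp only [FunLike.coe_sub, FunLike.coe_smul, Pi.sub_apply, Pi.smul_apply, smul_eq_mul,
    fderiv_apply_const hη]
  rfl

lemma fderiv_cζbar (hη : DifferentiableAt ℝ η p) (u : ℝ × ℂ) :
    fderiv ℝ (fun p => cζbar (η p)) p u = cζbar (fderiv ℝ η p u) := by
  have h : ∀ v, HasFDerivAt (fun p => η p v) (fderiv ℝ (fun p => η p v) p) p := fun v =>
    (hη.clm_apply (differentiableAt_const v)).hasFDerivAt
  have := (((h (0, 1)).add ((h (0, Complex.I)).const_mul Complex.I)).const_mul (1 / 2)).fderiv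
  refine (DFunLike.congr_fun this u).trans ?_
  simp only [FunLike.coe_add, FunLike.coe_smul, Pi.add_apply, Pi.smul_apply, smul_eq_mul,
    fderiv_apply_const hη]
  rfl

lemma flatExtd_ρζ (hη : DifferentiableAt ℝ η p) :
    cρ (fderiv ℝ (fun p => cζ (η p)) p) - cζ (fderiv ℝ (fun p => cρ (η p)) p) =
      (1 / 2) * (flatExtd η p (1, 0) (0, 1) - Complex.I * flatExtd η p (1, 0) (0, Complex.I)) := by
  rw [cρ, fderiv_cζ hη, cζ, cζ, fderiv_cρ hη, fderiv_cρ hη, flatExtd, flatExtd, cρ, cρ]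
  ring

lemma flatExtd_ρζbar (hη : DifferentiableAt ℝ η p) :
    cρ (fderiv ℝ (fun p => cζbar (η p)) p) - cζbar (fderiv ℝ (fun p => cρ (η p)) p) =
      (1 / 2) * (flatExtd η p (1, 0) (0, 1) + Complex.I * flatExtd η p (1, 0) (0, Complex.I)) := by
  rw [cρ, fderiv_cζbar hη, cζbar, cζbar, fderiv_cρ hη, fderiv_cρ hη, flatExtd, flatExtd, cρ, cρ]
  ring

lemma flatExtd_ζζbar (hη : DifferentiableAt ℝ η p) :
    cζ (fderiv ℝ (fun p => cζbar (η p)) p) - cζbar (fderiv ℝ (fun p => cζ (η p)) p) =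
      (Complex.I / 2) * flatExtd η p (0, 1) (0, Complex.I) := by
  rw [cζ, fderiv_cζbar hη, fderiv_cζbar hη, cζbar, cζbar, cζbar, fderiv_cζ hη, fderiv_cζ hη,
    cζ, cζ, flatExtd]
  ring

lemma contDiffOn_cρ {S : Set (ℝ × ℂ)} (hη : ContDiffOn ℝ ∞ η S) :
    ContDiffOn ℝ ∞ (fun p => cρ (η p)) S := hη.clm_apply contDiffOn_const

lemma contDiffOn_cζ {S : Set (ℝ × ℂ)} (hη : ContDiffOn ℝ ∞ η S) :
    ContDiffOn ℝ ∞ (fun p => cζ (η p)) S :=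
  contDiffOn_const.mul ((hη.clm_apply contDiffOn_const).sub
    (contDiffOn_const.mul (hη.clm_apply contDiffOn_const)))

lemma contDiffOn_cζbar {S : Set (ℝ × ℂ)} (hη : ContDiffOn ℝ ∞ η S) :
    ContDiffOn ℝ ∞ (fun p => cζbar (η p)) S :=
  contDiffOn_const.mul ((hη.clm_apply contDiffOn_const).add
    (contDiffOn_const.mul (hη.clm_apply contDiffOn_const)))

/-- The `ζ`-derivative of a function on `ℝ × ℂ` is the one of its restriction to a slice. -/
lemma cζ_fderiv {f : ℝ × ℂ → ℂ} (hf : DifferentiableAt ℝ f p) :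
    cζ (fderiv ℝ f p) = dζ (fun w => f (p.1, w)) p.2 := by
  have h : HasFDerivAt (fun w => f (p.1, w)) (fderiv ℝ f p ∘L ContinuousLinearMap.inr ℝ ℝ ℂ) p.2 :=
    HasFDerivAt.comp (g := f) p.2 hf.hasFDerivAt (hasFDerivAt_prodMk_right p.1 p.2)
  rw [dζ, h.fderiv]
  rfl

lemma cζbar_fderiv {f : ℝ × ℂ → ℂ} (hf : DifferentiableAt ℝ f p) :
    cζbar (fderiv ℝ f p) = dζbar (fun w => f (p.1, w)) p.2 := by
  have h : HasFDerivAt (fun w => f (p.1, w)) (fderiv ℝ f p ∘L ContinuousLinearMap.inr ℝ ℝ ℂ) p.2 :=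
    HasFDerivAt.comp (g := f) p.2 hf.hasFDerivAt (hasFDerivAt_prodMk_right p.1 p.2)
  rw [dζbar, h.fderiv]
  rfl

lemma hasDerivAt_slice {f : ℝ × ℂ → ℂ} (hf : DifferentiableAt ℝ f p) :
    HasDerivAt (fun t => f (t, p.2)) (cρ (fderiv ℝ f p)) p.1 := by
  have h2 : HasDerivAt (fun t : ℝ => ((t, p.2) : ℝ × ℂ)) (1, 0) p.1 :=
    (hasDerivAt_id p.1).prodMk (hasDerivAt_const p.1 p.2)
  exact HasFDerivAt.comp_hasDerivAt (l := f) p.1 hf.hasFDerivAt h2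

/-- A function whose derivative along a `ρ`-segment vanishes is constant on it. -/
lemma eq_of_cρ_fderiv_eq_zero {f : ℝ × ℂ → ℂ} {a b : ℝ} {w : ℂ}
    (hf : ∀ t ∈ Set.Ioo a b, HasDerivAt (fun t => f (t, w)) 0 t) {t s : ℝ}
    (ht : t ∈ Set.Ioo a b) (hs : s ∈ Set.Ioo a b) : f (t, w) = f (s, w) :=
  isOpen_Ioo.is_const_of_deriv_eq_zero isPreconnected_Ioo
    (fun t ht => (hf t ht).differentiableAt.differentiableWithinAt)
    (fun t ht => (hf t ht).deriv) ht hs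

end Components

section Wirtinger

variable {f g : ℂ → ℂ} {w : ℂ}

lemma dζbar_add (hf : DifferentiableAt ℝ f w) (hg : DifferentiableAt ℝ g w) :
    dζbar (fun t => f t + g t) w = dζbar f w + dζbar g w := by
  rw [dζbar, fderiv_fun_add hf hg]
  simp only [dζbar, FunLike.coe_add, Pi.add_apply]
  ring

lemma dζbar_sub (hf : DifferentiableAt ℝ f w) (hg : DifferentiableAt ℝ g w) :
    dζbar (fun t => f t - g t) w = dζbar f w - dζbar g w := by
  rw [dζbar, fderiv_fun_sub hf hg]
  simp only [dζbar, FunLike.coe_sub, Pi.sub_apply]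
  ring

lemma dζbar_mul (hf : DifferentiableAt ℝ f w) (hg : DifferentiableAt ℝ g w) :
    dζbar (fun t => f t * g t) w = f w * dζbar g w + dζbar f w * g w := by
  rw [dζbar, fderiv_fun_mul hf hg]
  simp only [dζbar, FunLike.coe_add, Pi.add_apply, FunLike.coe_smul, Pi.smul_apply, smul_eq_mul]
  ring

lemma dζbar_const_mul (c : ℂ) (hf : DifferentiableAt ℝ f w) :
    dζbar (fun t => c * f t) w = c * dζbar f w := by
  rw [dζbar, fderiv_const_mul hf]
  simp only [dζbar, FunLike.coe_smul, Pi.smul_apply, smul_eq_mul]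
  ring

lemma dζbar_const (c : ℂ) : dζbar (fun _ => c) w = 0 := by
  simp [dζbar]

lemma dζbar_congr (h : f =ᶠ[𝓝 w] g) : dζbar f w = dζbar g w := by
  rw [dζbar, dζbar, h.fderiv_eq]

lemma dζ_congr (h : f =ᶠ[𝓝 w] g) : dζ f w = dζ g w := by
  rw [dζ, dζ, h.fderiv_eq]

lemma dζ_conj (hf : DifferentiableAt ℝ f w) :
    dζ (fun t => conj (f t)) w = conj (dζbar f w) := by
  rw [dζ, dζbar, fderiv_conj hf, fderiv_conj hf]
  simp only [map_mul, map_add, map_div₀, map_one, Complex.conj_I, map_ofNat]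
  ring

lemma contDiffOn_dζbar {B : Set ℂ} (hB : IsOpen B) (hf : ContDiffOn ℝ ∞ f B) :
    ContDiffOn ℝ ∞ (dζbar f) B := by
  have h := hf.fderiv_of_isOpen hB (m := ∞) (by simp)
  exact contDiffOn_const.mul ((h.clm_apply contDiffOn_const).add
    (contDiffOn_const.mul (h.clm_apply contDiffOn_const)))

end Wirtinger

section NormalFormApply

lemma dC_snd (p : ℝ × ℂ) (v : ℝ × ℂ) : dC (E := ℝ × ℂ) (Prod.snd : ℝ × ℂ → ℂ) p v = v.2 := by
  have := DFunLike.congr_fun (dC_eq_fderiv (Prod.snd : ℝ × ℂ → ℂ) p) v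
  refine this.trans ?_
  rw [fderiv_snd]
  rfl

lemma dR_inv_fst {p : ℝ × ℂ} (hp : p.1 ≠ 0) (v : ℝ × ℂ) :
    dR (E := ℝ × ℂ) (fun q : ℝ × ℂ => (q.1)⁻¹) p v = -(v.1 / (p.1 : ℂ) ^ 2) := by
  have := DFunLike.congr_fun (dC_eq_fderiv (fun q : ℝ × ℂ => (((q.1)⁻¹ : ℝ) : ℂ)) p) v
  refine this.trans ?_
  have h1 : HasFDerivAt (fun q : ℝ × ℂ => (((q.1)⁻¹ : ℝ) : ℂ))
      (Complex.ofRealCLM ∘L (-(p.1 ^ 2)⁻¹ • ContinuousLinearMap.fst ℝ ℝ ℂ)) p :=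
    Complex.ofRealCLM.hasFDerivAt.comp p
      ((hasDerivAt_inv hp).comp_hasFDerivAt p (hasFDerivAt_fst (𝕜 := ℝ)))
  rw [h1.fderiv]
  change ((-(p.1 ^ 2)⁻¹ * v.1 : ℝ) : ℂ) = _
  push_cast
  ring

lemma normalM_apply (p v : ℝ × ℂ) :
    normalM (E := ℝ × ℂ) (Prod.fst : ℝ × ℂ → ℝ) Prod.snd p v = v.2 / p.1 := by
  change (p.1 : ℂ)⁻¹ * dC (E := ℝ × ℂ) (Prod.snd : ℝ × ℂ → ℂ) p v = _
  rw [dC_snd]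
  ring

lemma normalK_apply (x : ℂ → ℂ) {p : ℝ × ℂ} (hp : p.1 ≠ 0) (v : ℝ × ℂ) :
    normalK (E := ℝ × ℂ) (Prod.fst : ℝ × ℂ → ℝ) Prod.snd x p v =
      v.1 / (p.1 : ℂ) ^ 2 + (1 / 2) * p.1 * (x p.2 * v.2 + conj (x p.2) * conj v.2) := by
  change -dR (E := ℝ × ℂ) (fun q : ℝ × ℂ => (q.1)⁻¹) p v + ((1 / 2) * p.1) *
    (x p.2 * dC (E := ℝ × ℂ) (Prod.snd : ℝ × ℂ → ℂ) p v +
      conj (x p.2) * conj (dC (E := ℝ × ℂ) (Prod.snd : ℝ × ℂ → ℂ) p v)) = _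
  rw [dC_snd, dR_inv_fst hp]
  ring

end NormalFormApply

/-! ### Components of the structure equations -/

/-! Each suffix names the coefficient that is compared: `_ρζ`, `_ρζbar` and `_ζζbar` are the
coefficients of `dρ ∧ dζ`, `dρ ∧ dζ̄` and `dζ ∧ dζ̄`. -/

namespace FlatData.IsSolutionOn

variable {R : ℝ} {D : FlatData (ℝ × ℂ)} {S : Set (ℝ × ℂ)} (h : D.IsSolutionOn R S) {p : ℝ × ℂ}
  (hp : p ∈ S)
include h hp

lemma first_M_ρζ : (1 / 2) * (flatExtd D.M p (1, 0) (0, 1) - Complex.I *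
    flatExtd D.M p (1, 0) (0, Complex.I)) =
      (cρ (D.Γ12 p) * cζ (D.M p) - cζ (D.Γ12 p) * cρ (D.M p)) +
          (cρ (conjForm D.Γ41 p) * cζ (D.K p) - cζ (conjForm D.Γ41 p) * cρ (D.K p)) := by
  have h' := h.first_M p hp
  simp only [cρ, cζ, conjForm_apply]
  linear_combination (1 / 2) * h' (1, 0) (0, 1) - Complex.I / 2 * h' (1, 0) (0, Complex.I)

lemma first_M_ζζbar : Complex.I / 2 * flatExtd D.M p (0, 1) (0, Complex.I) =
      (cζ (D.Γ12 p) * cζbar (D.M p) - cζbar (D.Γ12 p) * cζ (D.M p)) +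
          (cζ (conjForm D.Γ41 p) * cζbar (D.K p) - cζbar (conjForm D.Γ41 p) * cζ (D.K p)) := by
  have h' := h.first_M p hp
  simp only [cζ, cζbar, conjForm_apply]
  linear_combination Complex.I / 2 * h' (0, 1) (0, Complex.I)

lemma first_K_ζζbar : Complex.I / 2 * flatExtd D.K p (0, 1) (0, Complex.I) =
      -(cζ (conjForm D.Γ23 p) * cζbar (D.M p) - cζbar (conjForm D.Γ23 p) * cζ (D.M p)) -
        (cζ (D.Γ23 p) * cζbar (conjForm D.M p) - cζbar (D.Γ23 p) * cζ (conjForm D.M p)) +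
        (cζ (D.Γ34 p) * cζbar (D.K p) - cζbar (D.Γ34 p) * cζ (D.K p)) := by
  have h' := h.first_K p hp
  simp only [cζ, cζbar, conjForm_apply]
  linear_combination Complex.I / 2 * h' (0, 1) (0, Complex.I)

lemma second_23_ρζ : (1 / 2) * (flatExtd D.Γ23 p (1, 0) (0, 1) - Complex.I *
    flatExtd D.Γ23 p (1, 0) (0, Complex.I)) =
      (cρ (D.Γ12 p) * cζ (D.Γ23 p) - cζ (D.Γ12 p) * cρ (D.Γ23 p)) +
          (cρ (D.Γ34 p) * cζ (D.Γ23 p) - cζ (D.Γ34 p) * cρ (D.Γ23 p)) -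
        D.Ψ3 p * (cρ (D.M p) * cζ (conjForm D.M p) - cζ (D.M p) * cρ (conjForm D.M p)) +
        (D.Ψ2 p + R / 12) * (cρ (D.K p) * cζ (D.M p) - cζ (D.K p) * cρ (D.M p)) := by
  have h' := h.second_23 p hp
  simp only [cρ, cζ, conjForm_apply]
  linear_combination (1 / 2) * h' (1, 0) (0, 1) - Complex.I / 2 * h' (1, 0) (0, Complex.I)

lemma second_23_ρζbar : (1 / 2) * (flatExtd D.Γ23 p (1, 0) (0, 1) + Complex.I *
    flatExtd D.Γ23 p (1, 0) (0, Complex.I)) =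
      (cρ (D.Γ12 p) * cζbar (D.Γ23 p) - cζbar (D.Γ12 p) * cρ (D.Γ23 p)) +
          (cρ (D.Γ34 p) * cζbar (D.Γ23 p) - cζbar (D.Γ34 p) * cρ (D.Γ23 p)) -
        D.Ψ3 p * (cρ (D.M p) * cζbar (conjForm D.M p) - cζbar (D.M p) * cρ (conjForm D.M p)) +
        (D.Ψ2 p + R / 12) * (cρ (D.K p) * cζbar (D.M p) - cζbar (D.K p) * cρ (D.M p)) := by
  have h' := h.second_23 p hp
  simp only [cρ, cζbar, conjForm_apply]
  linear_combination (1 / 2) * h' (1, 0) (0, 1) + Complex.I / 2 * h' (1, 0) (0, Complex.I)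

lemma second_23_ζζbar : Complex.I / 2 * flatExtd D.Γ23 p (0, 1) (0, Complex.I) =
      (cζ (D.Γ12 p) * cζbar (D.Γ23 p) - cζbar (D.Γ12 p) * cζ (D.Γ23 p)) +
          (cζ (D.Γ34 p) * cζbar (D.Γ23 p) - cζbar (D.Γ34 p) * cζ (D.Γ23 p)) -
        D.Ψ3 p * (cζ (D.M p) * cζbar (conjForm D.M p) - cζbar (D.M p) * cζ (conjForm D.M p)) +
        (D.Ψ2 p + R / 12) * (cζ (D.K p) * cζbar (D.M p) - cζbar (D.K p) * cζ (D.M p)) := by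
  have h' := h.second_23 p hp
  simp only [cζ, cζbar, conjForm_apply]
  linear_combination Complex.I / 2 * h' (0, 1) (0, Complex.I)

lemma second_14_ρζ : (1 / 2) * (flatExtd D.Γ41 p (1, 0) (0, 1) - Complex.I *
    flatExtd D.Γ41 p (1, 0) (0, Complex.I)) =
      (cρ (D.Γ41 p) * cζ (D.Γ12 p) - cζ (D.Γ41 p) * cρ (D.Γ12 p)) +
          (cρ (D.Γ41 p) * cζ (D.Γ34 p) - cζ (D.Γ41 p) * cρ (D.Γ34 p)) -
        D.Ψ1 p * (cρ (D.M p) * cζ (conjForm D.M p) - cζ (D.M p) * cρ (conjForm D.M p)) +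
        D.Ψ0 p * (cρ (D.K p) * cζ (D.M p) - cζ (D.K p) * cρ (D.M p)) := by
  have h' := h.second_14 p hp
  simp only [cρ, cζ, conjForm_apply]
  linear_combination (1 / 2) * h' (1, 0) (0, 1) - Complex.I / 2 * h' (1, 0) (0, Complex.I)

lemma second_14_ρζbar : (1 / 2) * (flatExtd D.Γ41 p (1, 0) (0, 1) + Complex.I *
    flatExtd D.Γ41 p (1, 0) (0, Complex.I)) =
      (cρ (D.Γ41 p) * cζbar (D.Γ12 p) - cζbar (D.Γ41 p) * cρ (D.Γ12 p)) +
          (cρ (D.Γ41 p) * cζbar (D.Γ34 p) - cζbar (D.Γ41 p) * cρ (D.Γ34 p)) -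
        D.Ψ1 p * (cρ (D.M p) * cζbar (conjForm D.M p) - cζbar (D.M p) * cρ (conjForm D.M p)) +
        D.Ψ0 p * (cρ (D.K p) * cζbar (D.M p) - cζbar (D.K p) * cρ (D.M p)) := by
  have h' := h.second_14 p hp
  simp only [cρ, cζbar, conjForm_apply]
  linear_combination (1 / 2) * h' (1, 0) (0, 1) + Complex.I / 2 * h' (1, 0) (0, Complex.I)

lemma second_14_ζζbar : Complex.I / 2 * flatExtd D.Γ41 p (0, 1) (0, Complex.I) =
      (cζ (D.Γ41 p) * cζbar (D.Γ12 p) - cζbar (D.Γ41 p) * cζ (D.Γ12 p)) +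
          (cζ (D.Γ41 p) * cζbar (D.Γ34 p) - cζbar (D.Γ41 p) * cζ (D.Γ34 p)) -
        D.Ψ1 p * (cζ (D.M p) * cζbar (conjForm D.M p) - cζbar (D.M p) * cζ (conjForm D.M p)) +
        D.Ψ0 p * (cζ (D.K p) * cζbar (D.M p) - cζbar (D.K p) * cζ (D.M p)) := by
  have h' := h.second_14 p hp
  simp only [cζ, cζbar, conjForm_apply]
  linear_combination Complex.I / 2 * h' (0, 1) (0, Complex.I)

lemma second_12_34_ρζ : (1 / 2) * ((1 / 2) * (flatExtd D.Γ12 p (1, 0) (0, 1) - Complex.I *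
    flatExtd D.Γ12 p (1, 0) (0, Complex.I)) +
      (1 / 2) * (flatExtd D.Γ34 p (1, 0) (0, 1) - Complex.I *
          flatExtd D.Γ34 p (1, 0) (0, Complex.I))) =
      -(cρ (D.Γ23 p) * cζ (D.Γ41 p) - cζ (D.Γ23 p) * cρ (D.Γ41 p)) +
        (D.Ψ2 p - R / 24) * (cρ (D.M p) * cζ (conjForm D.M p) - cζ (D.M p) * cρ (conjForm D.M p)) -
        D.Ψ1 p * (cρ (D.K p) * cζ (D.M p) - cζ (D.K p) * cρ (D.M p)) := by
  have h' := h.second_12_34 p hp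
  simp only [cρ, cζ, conjForm_apply]
  linear_combination (1 / 2) * h' (1, 0) (0, 1) - Complex.I / 2 * h' (1, 0) (0, Complex.I)

lemma second_12_34_ρζbar : (1 / 2) * ((1 / 2) *
    (flatExtd D.Γ12 p (1, 0) (0, 1) + Complex.I * flatExtd D.Γ12 p (1, 0) (0, Complex.I)) +
      (1 / 2) * (flatExtd D.Γ34 p (1, 0) (0, 1) + Complex.I *
          flatExtd D.Γ34 p (1, 0) (0, Complex.I))) =
      -(cρ (D.Γ23 p) * cζbar (D.Γ41 p) - cζbar (D.Γ23 p) * cρ (D.Γ41 p)) +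
        (D.Ψ2 p - R / 24) * (cρ (D.M p) * cζbar (conjForm D.M p) - cζbar (D.M p) *
            cρ (conjForm D.M p)) -
        D.Ψ1 p * (cρ (D.K p) * cζbar (D.M p) - cζbar (D.K p) * cρ (D.M p)) := by
  have h' := h.second_12_34 p hp
  simp only [cρ, cζbar, conjForm_apply]
  linear_combination (1 / 2) * h' (1, 0) (0, 1) + Complex.I / 2 * h' (1, 0) (0, Complex.I)

lemma second_12_34_ζζbar : (1 / 2) * (Complex.I / 2 * flatExtd D.Γ12 p (0, 1) (0, Complex.I) +
      Complex.I / 2 * flatExtd D.Γ34 p (0, 1) (0, Complex.I)) =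
      -(cζ (D.Γ23 p) * cζbar (D.Γ41 p) - cζbar (D.Γ23 p) * cζ (D.Γ41 p)) +
        (D.Ψ2 p - R / 24) * (cζ (D.M p) * cζbar (conjForm D.M p) - cζbar (D.M p) *
            cζ (conjForm D.M p)) -
        D.Ψ1 p * (cζ (D.K p) * cζbar (D.M p) - cζbar (D.K p) * cζ (D.M p)) := by
  have h' := h.second_12_34 p hp
  simp only [cζ, cζbar, conjForm_apply]
  linear_combination Complex.I / 2 * h' (0, 1) (0, Complex.I)

end FlatData.IsSolutionOn

/-! ### Pointwise consequences of the gauge conditions -/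

lemma cρ_conjForm (η : ℝ × ℂ → (ℝ × ℂ →L[ℝ] ℂ)) (p : ℝ × ℂ) :
    cρ (conjForm η p) = conj (cρ (η p)) := rfl

lemma cζ_conjForm (η : ℝ × ℂ → (ℝ × ℂ →L[ℝ] ℂ)) (p : ℝ × ℂ) :
    cζ (conjForm η p) = conj (cζbar (η p)) := by
  simp only [cζ, cζbar, conjForm_apply, map_mul, map_add, map_div₀, map_one, Complex.conj_I,
    map_ofNat]
  ring

lemma cζbar_conjForm (η : ℝ × ℂ → (ℝ × ℂ →L[ℝ] ℂ)) (p : ℝ × ℂ) :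
    cζbar (conjForm η p) = conj (cζ (η p)) := by
  simp only [cζ, cζbar, conjForm_apply, map_mul, map_sub, map_div₀, map_one, Complex.conj_I,
    map_ofNat]
  ring

lemma flatExtd_const (L : ℝ × ℂ →L[ℝ] ℂ) (p u v : ℝ × ℂ) : flatExtd (fun _ => L) p u v = 0 := by
  simp [flatExtd]

/-- The algebraic consequences of `M = dζ / ρ`, `Γ₄₁ = dζ̄` and the vanishing of the `dζ̄`-component of
`Γ₁₂ + Γ₃₄`. Both `Γ₁₂` and `Γ₃₄`, and then also `Ψ₁` and `K`, are determined by one function, the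
`dζ`-component of `Γ₁₂`. -/
theorem rigidity_pointwise {R : ℝ} {D : FlatData (ℝ × ℂ)} {S : Set (ℝ × ℂ)} (hS : IsOpen S)
    (hρ : ∀ p ∈ S, p.1 ≠ 0) (h : D.IsSolutionOn R S) (hM : ∀ p ∈ S, ∀ v, D.M p v = v.2 / p.1)
    (h41 : ∀ p ∈ S, ∀ v, D.Γ41 p v = conj v.2)
    (hω : ∀ p ∈ S, cζbar (D.Γ12 p) + cζbar (D.Γ34 p) = 0) {p : ℝ × ℂ} (hp : p ∈ S) :
    D.Ψ0 p = 0 ∧ D.Ψ1 p = -(p.1 : ℂ) ^ 2 * (2 * cζ (D.Γ12 p)) ∧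
    cρ (D.Γ12 p) = 0 ∧ cρ (D.Γ34 p) = 0 ∧ cζ (D.Γ34 p) = cζ (D.Γ12 p) ∧
    cζbar (D.Γ12 p) = -conj (cζ (D.Γ12 p)) ∧ cζbar (D.Γ34 p) = conj (cζ (D.Γ12 p)) ∧
    cρ (D.K p) = 1 / (p.1 : ℂ) ^ 2 ∧ cζ (D.K p) = -cζ (D.Γ12 p) / p.1 ∧
    cζbar (D.K p) = -conj (cζ (D.Γ12 p)) / p.1 := by
  have hp0 : (p.1 : ℂ) ≠ 0 := by exact_mod_cast hρ p hp
  have m0 : cρ (D.M p) = 0 := by rw [cρ, hM p hp]; simp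
  have m1 : cζ (D.M p) = 1 / p.1 := by
    rw [cζ, hM p hp, hM p hp]; linear_combination -(1 / (2 * p.1)) * Complex.I_mul_I
  have m2 : cζbar (D.M p) = 0 := by
    rw [cζbar, hM p hp, hM p hp]; linear_combination (1 / (2 * p.1)) * Complex.I_mul_I
  have g0 : cρ (D.Γ41 p) = 0 := by rw [cρ, h41 p hp]; simp
  have g1 : cζ (D.Γ41 p) = 0 := by
    rw [cζ, h41 p hp, h41 p hp, map_one, Complex.conj_I]
    linear_combination (1 / 2) * Complex.I_mul_I
  have g2 : cζbar (D.Γ41 p) = 1 := by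
    rw [cζbar, h41 p hp, h41 p hp, map_one, Complex.conj_I]
    linear_combination -(1 / 2) * Complex.I_mul_I
  have k2 := cζbar_real (h.real_K p hp)
  have c2 := cζbar_imag (h.conj_Γ12 p hp)
  have d2 := cζbar_real (h.real_Γ34 p hp)
  have k0 : cρ (D.K p) ≠ 0 := by
    intro hk
    obtain ⟨u, v, w, hdet⟩ := h.coframe p hp
    apply hdet
    simp only [det_three, hM p hp, clm_apply_eq (D.K p), hk, map_div₀, Complex.conj_ofReal]
    ring
  have hd41 : ∀ u v, flatExtd D.Γ41 p u v = 0 := by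
    intro u v
    have : D.Γ41 =ᶠ[𝓝 p] fun _ =>
        (Complex.conjCLE : ℂ →L[ℝ] ℂ) ∘L ContinuousLinearMap.snd ℝ ℝ ℂ := by
      filter_upwards [hS.mem_nhds hp] with q hq
      exact ContinuousLinearMap.ext fun v => h41 q hq v
    rw [flatExtd_congr this, flatExtd_const]
  have hdM : ∀ u v, flatExtd D.M p u v = -(u.1 * v.2 - v.1 * u.2) / (p.1 : ℂ) ^ 2 := by
    intro u v
    have h1 : D.M =ᶠ[𝓝 p] fun q => (((q.1)⁻¹ : ℝ) : ℂ) • ContinuousLinearMap.snd ℝ ℝ ℂ := by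
      filter_upwards [hS.mem_nhds hp] with q hq
      refine ContinuousLinearMap.ext fun v => (hM q hq v).trans ?_
      change _ = (((q.1)⁻¹ : ℝ) : ℂ) * v.2
      push_cast
      ring
    have h2 : HasFDerivAt (fun q : ℝ × ℂ => (((q.1)⁻¹ : ℝ) : ℂ))
        (Complex.ofRealCLM ∘L (-(p.1 ^ 2)⁻¹ • ContinuousLinearMap.fst ℝ ℝ ℂ)) p :=
      Complex.ofRealCLM.hasFDerivAt.comp p
        ((hasDerivAt_inv (hρ p hp)).comp_hasFDerivAt p (hasFDerivAt_fst (𝕜 := ℝ)))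
    rw [flatExtd_congr h1, flatExtd_smul h2.differentiableAt (differentiableAt_const _),
      flatExtd_const, h2.fderiv]
    change _ * 0 + (((-(p.1 ^ 2)⁻¹ * u.1 : ℝ) : ℂ) * v.2 - ((-(p.1 ^ 2)⁻¹ * v.1 : ℝ) : ℂ) * u.2) = _
    push_cast
    ring
  have e1 := h.second_14_ρζ hp
  have e2 := h.second_14_ρζbar hp
  have e3 := h.second_14_ζζbar hp
  have e4 := h.first_M_ρζ hp
  have e5 := h.first_M_ζζbar hp
  simp only [cρ_conjForm, cζ_conjForm, cζbar_conjForm, m0, m1, m2, g0, g1, g2, hd41, hdM, map_zero,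
    map_one, map_div₀, Complex.conj_ofReal] at e1 e2 e3 e4 e5
  have p0 : D.Ψ0 p = 0 := by
    have : D.Ψ0 p * cρ (D.K p) = 0 := by
      have e1' : 0 = D.Ψ0 p * (cρ (D.K p) * (1 / p.1)) := by linear_combination e1
      field_simp at e1'
      linear_combination -e1'
    exact (mul_eq_zero.1 this).resolve_right k0
  rw [p0] at e3
  have hcd := hω p hp
  rw [c2, d2] at hcd
  have hcd' : cζ (D.Γ34 p) = cζ (D.Γ12 p) := by
    have := congrArg conj hcd
    simp only [map_add, map_neg, Complex.conj_conj, map_zero] at this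
    linear_combination this
  have hcr : cρ (D.Γ12 p) + cρ (D.Γ34 p) = 0 := by linear_combination e2
  have hcr2 : -cρ (D.Γ12 p) + cρ (D.Γ34 p) = 0 := by
    have := congrArg conj hcr
    rw [map_add, map_zero] at this
    have i1 : conj (cρ (D.Γ12 p)) = -cρ (D.Γ12 p) := h.conj_Γ12 p hp _
    have i2 : conj (cρ (D.Γ34 p)) = cρ (D.Γ34 p) := h.real_Γ34 p hp _
    rwa [i1, i2] at this
  have hc0 : cρ (D.Γ12 p) = 0 := by linear_combination (1 / 2) * hcr - (1 / 2) * hcr2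
  have hd0 : cρ (D.Γ34 p) = 0 := by linear_combination (1 / 2) * hcr + (1 / 2) * hcr2
  have hk0 : cρ (D.K p) = 1 / (p.1 : ℂ) ^ 2 := by
    rw [hc0] at e4
    simp only [Complex.ofReal_zero, Complex.ofReal_one] at e4
    linear_combination e4 - (1 / (2 * (p.1 : ℂ) ^ 2)) * Complex.I_mul_I
  have hk2 : cζbar (D.K p) = -conj (cζ (D.Γ12 p)) / p.1 := by
    rw [c2] at e5
    simp only [Complex.ofReal_zero] at e5
    linear_combination -e5
  have hk1 : cζ (D.K p) = -cζ (D.Γ12 p) / p.1 := by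
    rw [k2] at hk2
    have := congrArg conj hk2
    simpa only [map_div₀, map_neg, Complex.conj_conj, Complex.conj_ofReal] using this
  refine ⟨p0, ?_, hc0, hd0, hcd', c2, ?_, hk0, hk1, hk2⟩
  · rw [hcd'] at e3
    field_simp at e3
    linear_combination (1 / 2) * e3
  · rw [d2, hcd']

/-! ### Integration along the null direction -/

lemma normal_frameComb_apply (x : ℂ → ℂ) (c₁ c₂ : ℝ × ℂ → ℂ) (p v : ℝ × ℂ) :
    frameComb (E := ℝ × ℂ) (normalM (Prod.fst : ℝ × ℂ → ℝ) Prod.snd)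
      (normalK (Prod.fst : ℝ × ℂ → ℝ) Prod.snd x) c₁ c₂ (fun _ => 0) p v =
      (c₁ p * v.2 + c₂ p * conj v.2) / p.1 := by
  have h1 := normalM_apply p v
  have h2 : (normalM (E := ℝ × ℂ) (Prod.fst : ℝ × ℂ → ℝ) Prod.snd).bar p v = conj (v.2 / p.1) :=
    congrArg conj h1
  change c₁ p * normalM (E := ℝ × ℂ) (Prod.fst : ℝ × ℂ → ℝ) Prod.snd p v +
    c₂ p * (normalM (E := ℝ × ℂ) (Prod.fst : ℝ × ℂ → ℝ) Prod.snd).bar p v + 0 * _ = _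
  rw [h1, h2, map_div₀, Complex.conj_ofReal]
  ring

/-- Data whose components are those of the normal form is the normal form. -/
lemma eqOn_normalForm_of_components {R : ℝ} {D : FlatData (ℝ × ℂ)} {S : Set (ℝ × ℂ)}
    {x q : ℂ → ℂ} {α : ℂ → ℝ} (hρ : ∀ p ∈ S, p.1 ≠ 0)
    (hM : ∀ p ∈ S, ∀ v, D.M p v = v.2 / p.1)
    (h41 : ∀ p ∈ S, ∀ v, D.Γ41 p v = conj v.2)
    (k0 : ∀ p ∈ S, cρ (D.K p) = 1 / (p.1 : ℂ) ^ 2)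
    (k1 : ∀ p ∈ S, cζ (D.K p) = (1 / 2) * p.1 * x p.2)
    (k2 : ∀ p ∈ S, cζbar (D.K p) = (1 / 2) * p.1 * conj (x p.2))
    (b0 : ∀ p ∈ S, cρ (D.Γ23 p) = 0)
    (b1 : ∀ p ∈ S, p.1 * cζ (D.Γ23 p) = -normalΓ421 R x α p.1 p.2)
    (b2 : ∀ p ∈ S, cζbar (D.Γ23 p) = q p.2)
    (c0 : ∀ p ∈ S, cρ (D.Γ12 p) = 0)
    (c1 : ∀ p ∈ S, cζ (D.Γ12 p) = -(1 / 2) * x p.2 * (p.1 : ℂ) ^ 2)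
    (c2 : ∀ p ∈ S, cζbar (D.Γ12 p) = -conj (cζ (D.Γ12 p)))
    (d0 : ∀ p ∈ S, cρ (D.Γ34 p) = 0) (d1 : ∀ p ∈ S, cζ (D.Γ34 p) = cζ (D.Γ12 p))
    (d2 : ∀ p ∈ S, cζbar (D.Γ34 p) = conj (cζ (D.Γ12 p)))
    (h0 : ∀ p ∈ S, D.Ψ0 p = 0) (h1 : ∀ p ∈ S, D.Ψ1 p = x p.2 * (p.1 : ℂ) ^ 4)
    (h2 : ∀ p ∈ S, D.Ψ2 p = normalΨ2 x α p.1 p.2)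
    (h3 : ∀ p ∈ S, D.Ψ3 p = normalΨ3 R x q α p.1 p.2) :
    D.toData.EqOn (normalForm R Prod.fst Prod.snd x q α) S := by
  have hρ' : ∀ p ∈ S, (p.1 : ℂ) ≠ 0 := fun p hp => by exact_mod_cast hρ p hp
  constructor
  · intro p hp
    ext1 v
    exact (hM p hp v).trans (normalM_apply p v).symm
  · intro p hp
    ext1 v
    refine Eq.trans ?_ (normalK_apply x (hρ p hp) v).symm
    refine (clm_apply_eq (D.K p) v).trans ?_
    rw [k0 p hp, k1 p hp, k2 p hp]
    ring
  · intro p hp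
    ext1 v
    refine (h41 p hp v).trans ?_
    refine Eq.trans ?_ (congrArg Neg.neg (normal_frameComb_apply x _ _ p v)).symm
    have := hρ' p hp
    field_simp
    ring
  · intro p hp
    ext1 v
    refine (clm_apply_eq (D.Γ23 p) v).trans ?_
    refine Eq.trans ?_ (congrArg Neg.neg (normal_frameComb_apply x _ _ p v)).symm
    have := hρ' p hp
    rw [b0 p hp, b2 p hp, eq_comm, neg_eq_iff_eq_neg, div_eq_iff this]
    linear_combination v.2 * b1 p hp
  · intro p hp
    ext1 v
    refine (clm_apply_eq (D.Γ12 p) v).trans ?_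
    refine Eq.trans ?_ (normal_frameComb_apply x (fun p => -(1 / 2) * x p.2 * (p.1 : ℂ) ^ 3)
      (fun p => (1 / 2) * conj (x p.2) * (p.1 : ℂ) ^ 3) p v).symm
    have := hρ' p hp
    rw [c0 p hp, c2 p hp, c1 p hp]
    simp only [map_mul, map_neg, map_div₀, map_one, map_pow, Complex.conj_ofReal, map_ofNat]
    field_simp
    ring
  · intro p hp
    ext1 v
    refine (clm_apply_eq (D.Γ34 p) v).trans ?_
    refine Eq.trans ?_ (normal_frameComb_apply x (fun p => -(1 / 2) * x p.2 * (p.1 : ℂ) ^ 3)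
      (fun p => -(1 / 2) * conj (x p.2) * (p.1 : ℂ) ^ 3) p v).symm
    have := hρ' p hp
    rw [d0 p hp, d1 p hp, d2 p hp, c1 p hp]
    simp only [map_mul, map_neg, map_div₀, map_one, map_pow, Complex.conj_ofReal, map_ofNat]
    field_simp
    ring
  · exact h0
  · exact h1
  · exact h2
  · exact h3

set_option maxHeartbeats 1000000 in
/-- A solution with `M = dζ / ρ`, `Γ₄₁ = dζ̄` and no `dζ̄`-component of `Γ₁₂ + Γ₃₄` is a normal form.
The structure equations are ordinary differential equations in `ρ` for the components; the functions
`x`, `q` and `α` are the constants of integration, read off on the slice `ρ = ρ₀`. -/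
theorem exists_eqOn_normalForm {R : ℝ} {D : FlatData (ℝ × ℂ)} {a b : ℝ} {B : Set ℂ} (hab : a < b)
    (hB : IsOpen B) (h0 : ∀ t ∈ Set.Ioo a b, t ≠ 0) (h : D.IsSolutionOn R (Set.Ioo a b ×ˢ B))
    (hM : ∀ p ∈ Set.Ioo a b ×ˢ B, ∀ v, D.M p v = v.2 / p.1)
    (h41 : ∀ p ∈ Set.Ioo a b ×ˢ B, ∀ v, D.Γ41 p v = conj v.2)
    (hω : ∀ p ∈ Set.Ioo a b ×ˢ B, cζbar (D.Γ12 p) + cζbar (D.Γ34 p) = 0) :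
    ∃ (x q : ℂ → ℂ) (α : ℂ → ℝ), ContDiffOn ℝ ∞ x B ∧ ContDiffOn ℝ ∞ q B ∧ ContDiffOn ℝ ∞ α B ∧
      D.toData.EqOn (normalForm R Prod.fst Prod.snd x q α) (Set.Ioo a b ×ˢ B) := by
  set S := Set.Ioo a b ×ˢ B with hSdef
  have hS : IsOpen S := isOpen_Ioo.prod hB
  have hρ : ∀ p ∈ S, p.1 ≠ 0 := fun p hp => h0 _ hp.1
  have hρ' : ∀ p ∈ S, (p.1 : ℂ) ≠ 0 := fun p hp => by exact_mod_cast hρ p hp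
  have key := fun p hp => rigidity_pointwise hS hρ h hM h41 hω (p := p) hp
  obtain ⟨ρ₀, hρ₀⟩ : ∃ t, t ∈ Set.Ioo a b := ⟨(a + b) / 2, by constructor <;> linarith⟩
  have hslice : ContDiffOn ℝ ∞ (fun w : ℂ => ((ρ₀, w) : ℝ × ℂ)) B :=
    (contDiff_const.prodMk contDiff_id).contDiffOn
  have hslmap : ∀ w ∈ B, ((ρ₀, w) : ℝ × ℂ) ∈ S := fun w hw => ⟨hρ₀, hw⟩
  have dAt : ∀ {f : ℝ × ℂ → ℂ}, ContDiffOn ℝ ∞ f S → ∀ p ∈ S, DifferentiableAt ℝ f p :=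
    fun hf p hp => differentiableAt_of_contDiffOn hS hf p hp
  have fAt : ∀ {η : ℝ × ℂ → (ℝ × ℂ →L[ℝ] ℂ)}, ContDiffOn ℝ ∞ η S → ∀ p ∈ S,
      DifferentiableAt ℝ η p := fun hf p hp => differentiableAt_of_contDiffOn hS hf p hp
  have dcongr : ∀ {f g : ℝ × ℂ → ℂ}, (∀ p ∈ S, f p = g p) → ∀ p ∈ S, fderiv ℝ f p = fderiv ℝ g p :=
      by
    intro f g hfg p hp
    refine Filter.EventuallyEq.fderiv_eq ?_
    filter_upwards [hS.mem_nhds hp] with y hy using hfg y hy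
  have d0 : ∀ {f : ℝ × ℂ → ℂ}, (∀ p ∈ S, f p = 0) → ∀ p ∈ S, fderiv ℝ f p = 0 := by
    intro f hf p hp
    rw [dcongr (g := fun _ => 0) hf p hp]
    simp
  -- coefficients of the known forms
  have m0 : ∀ p ∈ S, cρ (D.M p) = 0 := fun p hp => by rw [cρ, hM p hp]; simp
  have m1 : ∀ p ∈ S, cζ (D.M p) = 1 / p.1 := fun p hp => by
    rw [cζ, hM p hp, hM p hp]; linear_combination -(1 / (2 * p.1)) * Complex.I_mul_I
  have m2 : ∀ p ∈ S, cζbar (D.M p) = 0 := fun p hp => by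
    rw [cζbar, hM p hp, hM p hp]; linear_combination (1 / (2 * p.1)) * Complex.I_mul_I
  have g0 : ∀ p ∈ S, cρ (D.Γ41 p) = 0 := fun p hp => by rw [cρ, h41 p hp]; simp
  have g1 : ∀ p ∈ S, cζ (D.Γ41 p) = 0 := fun p hp => by
    rw [cζ, h41 p hp, h41 p hp, map_one, Complex.conj_I]
    linear_combination (1 / 2) * Complex.I_mul_I
  have g2 : ∀ p ∈ S, cζbar (D.Γ41 p) = 1 := fun p hp => by
    rw [cζbar, h41 p hp, h41 p hp, map_one, Complex.conj_I]
    linear_combination -(1 / 2) * Complex.I_mul_I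
  have hc : ContDiffOn ℝ ∞ (fun p => cζ (D.Γ12 p)) S := contDiffOn_cζ h.smooth_Γ12
  have hb0 : ContDiffOn ℝ ∞ (fun p => cρ (D.Γ23 p)) S := contDiffOn_cρ h.smooth_Γ23
  have hb1 : ContDiffOn ℝ ∞ (fun p => cζ (D.Γ23 p)) S := contDiffOn_cζ h.smooth_Γ23
  have hb2 : ContDiffOn ℝ ∞ (fun p => cζbar (D.Γ23 p)) S := contDiffOn_cζbar h.smooth_Γ23
  have hcb : ContDiffOn ℝ ∞ (fun p => conj (cζ (D.Γ12 p))) S :=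
    Complex.conjCLE.contDiff.comp_contDiffOn hc
  -- derivatives of the coefficients of `Γ₁₂` and `Γ₃₄`
  have a1 : ∀ p ∈ S, fderiv ℝ (fun p => cρ (D.Γ12 p)) p = 0 := d0 fun p hp => (key p hp).2.2.1
  have a2 : ∀ p ∈ S, fderiv ℝ (fun p => cρ (D.Γ34 p)) p = 0 := d0 fun p hp => (key p hp).2.2.2.1
  have a3 : ∀ p ∈ S, fderiv ℝ (fun p => cζ (D.Γ34 p)) p = fderiv ℝ (fun p => cζ (D.Γ12 p)) p :=
    dcongr fun p hp => (key p hp).2.2.2.2.1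
  have a4 : ∀ p ∈ S, fderiv ℝ (fun p => cζbar (D.Γ12 p)) p =
      -fderiv ℝ (fun p => conj (cζ (D.Γ12 p))) p := by
    intro p hp
    rw [dcongr (g := fun p => -conj (cζ (D.Γ12 p))) (fun p hp => (key p hp).2.2.2.2.2.1) p hp,
      fderiv_fun_neg]
  have a5 : ∀ p ∈ S, fderiv ℝ (fun p => cζbar (D.Γ34 p)) p =
      fderiv ℝ (fun p => conj (cζ (D.Γ12 p))) p :=
    dcongr fun p hp => (key p hp).2.2.2.2.2.2.1
  have cneg : ∀ L : ℝ × ℂ →L[ℝ] ℂ, cρ (-L) = -cρ L ∧ cζ (-L) = -cζ L := by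
    intro L
    simp only [cρ, cζ, FunLike.coe_neg, Pi.neg_apply]
    exact ⟨trivial, by ring⟩
  have c0 : cρ (0 : ℝ × ℂ →L[ℝ] ℂ) = 0 ∧ cζ (0 : ℝ × ℂ →L[ℝ] ℂ) = 0 ∧
      cζbar (0 : ℝ × ℂ →L[ℝ] ℂ) = 0 := by simp [cρ, cζ, cζbar]
  -- the `dζ`-component `c` of `Γ₁₂` satisfies `∂c/∂ρ = 2 c / ρ`, hence `c = - x ρ² / 2`
  have r1 : ∀ p ∈ S, cρ (fderiv ℝ (fun p => cζ (D.Γ12 p)) p) = 2 * cζ (D.Γ12 p) / p.1 := by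
    intro p hp
    obtain ⟨k1, k2, k3, k4, k5, k6, k7, k8, k9, k10⟩ := key p hp
    have e := h.second_12_34_ρζ hp
    rw [← flatExtd_ρζ (fAt h.smooth_Γ12 p hp), ← flatExtd_ρζ (fAt h.smooth_Γ34 p hp), a1 p hp,
      a2 p hp, a3 p hp] at e
    simp only [cρ_conjForm, cζ_conjForm, m0 p hp, m1 p hp, m2 p hp, g0 p hp, g1 p hp, k8, k2,
      c0.2.1, map_zero] at e
    have := hρ' p hp
    field_simp at e ⊢
    linear_combination (1 / 48) * e
  have r2 : ∀ p ∈ S, cρ (D.Γ23 p) = 0 := by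
    intro p hp
    obtain ⟨k1, k2, k3, k4, k5, k6, k7, k8, k9, k10⟩ := key p hp
    have e := h.second_12_34_ρζbar hp
    rw [← flatExtd_ρζbar (fAt h.smooth_Γ12 p hp), ← flatExtd_ρζbar (fAt h.smooth_Γ34 p hp), a1 p hp,
      a2 p hp, a4 p hp, a5 p hp, (cneg _).1] at e
    simp only [cρ_conjForm, cζbar_conjForm, m0 p hp, m1 p hp, m2 p hp, g0 p hp, g2 p hp,
      c0.2.2, map_zero] at e
    linear_combination e
  -- the factor `-2` is the normalization of `x` in the normal form
  let x : ℂ → ℂ := fun w => -2 * cζ (D.Γ12 (ρ₀, w)) / (ρ₀ : ℂ) ^ 2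
  have hρ₀' : (ρ₀ : ℂ) ≠ 0 := by exact_mod_cast h0 _ hρ₀
  have hx : ContDiffOn ℝ ∞ x B := by
    have : ContDiffOn ℝ ∞ (fun w => cζ (D.Γ12 (ρ₀, w))) B := hc.comp hslice hslmap
    exact contDiffOn_div (contDiffOn_const.mul this) contDiffOn_const
      (fun _ _ => pow_ne_zero 2 hρ₀')
  have hofReal : ∀ t : ℝ, HasDerivAt (fun t : ℝ => (t : ℂ)) 1 t := fun t =>
    (Complex.ofRealCLM.hasDerivAt (x := t))
  have hcx : ∀ p ∈ S, cζ (D.Γ12 p) = -(1 / 2) * x p.2 * (p.1 : ℂ) ^ 2 := by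
    intro p hp
    have h1 : -2 * cζ (D.Γ12 (p.1, p.2)) / (p.1 : ℂ) ^ 2 = x p.2 := by
      refine eq_of_cρ_fderiv_eq_zero (f := fun p => -2 * cζ (D.Γ12 p) / (p.1 : ℂ) ^ 2) ?_ hp.1 hρ₀
      intro t ht
      have hq : ((t, p.2) : ℝ × ℂ) ∈ S := ⟨ht, hp.2⟩
      have h2 := hasDerivAt_slice (dAt hc _ hq)
      rw [r1 _ hq] at h2
      have h4 : HasDerivAt (fun t : ℝ => (t : ℂ) ^ 2) (2 * t) t := by
        simpa using (hofReal t).fun_pow 2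
      have h3 := (h2.const_mul (-2)).fun_div h4 (pow_ne_zero 2 (hρ' _ hq))
      refine h3.congr_deriv ?_
      have := hρ' _ hq
      simp only at this
      field_simp
      ring
    rw [← h1]
    have := hρ' p hp
    field_simp
  clear_value x
  have dx : ∀ p ∈ S, DifferentiableAt ℝ x p.2 := fun p hp =>
    (hx.contDiffAt (hB.mem_nhds hp.2)).differentiableAt (by simp)
  -- derivatives along slices
  have slice : ∀ {f : ℝ × ℂ → ℂ} {g : ℝ → ℂ → ℂ}, (∀ p ∈ S, f p = g p.1 p.2) → ∀ p ∈ S,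
      (fun w => f (p.1, w)) =ᶠ[𝓝 p.2] fun w => g p.1 w := by
    intro f g hfg p hp
    filter_upwards [hB.mem_nhds hp.2] with w hw using hfg (p.1, w) ⟨hp.1, hw⟩
  have r3 : ∀ p ∈ S, cζbar (fderiv ℝ (fun p => cζ (D.Γ12 p)) p) =
      -(1 / 2) * (p.1 : ℂ) ^ 2 * dζbar x p.2 := by
    intro p hp
    rw [cζbar_fderiv (dAt hc p hp), dζbar_congr (slice (f := fun p => cζ (D.Γ12 p))
      (g := fun t w => (-(1 / 2) * (t : ℂ) ^ 2) * x w)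
      (fun p hp => by rw [hcx p hp]; ring) p hp), dζbar_const_mul _ (dx p hp)]
  have hΨ2 : ∀ p ∈ S, D.Ψ2 p = R / 24 + (p.1 : ℂ) ^ 2 * cζ (D.Γ23 p) +
      (1 / 2) * (p.1 : ℂ) ^ 4 * dζbar x p.2 -
      (1 / 2) * (p.1 : ℂ) ^ 6 * (x p.2 * conj (x p.2)) := by
    intro p hp
    obtain ⟨k1, k2, k3, k4, k5, k6, k7, k8, k9, k10⟩ := key p hp
    have e := h.second_12_34_ζζbar hp
    rw [← flatExtd_ζζbar (fAt h.smooth_Γ12 p hp), ← flatExtd_ζζbar (fAt h.smooth_Γ34 p hp),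
      a3 p hp, a4 p hp, a5 p hp, (cneg _).2, r3 p hp] at e
    simp only [cζ_conjForm, cζbar_conjForm, m1 p hp, m2 p hp, g1 p hp, g2 p hp, k2, k10,
      hcx p hp, map_mul, map_neg, map_div₀, map_one, map_pow, map_zero, Complex.conj_ofReal,
      map_ofNat] at e
    have := hρ' p hp
    field_simp at e
    linear_combination -(1 / 96) * e
  -- the coefficients of `Γ₂₃`
  have b0 : ∀ p ∈ S, fderiv ℝ (fun p => cρ (D.Γ23 p)) p = 0 := d0 r2
  have n0 : ∀ p ∈ S, cρ (conjForm D.M p) = 0 := fun p hp => by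
    rw [cρ_conjForm, m0 p hp, map_zero]
  have n1 : ∀ p ∈ S, cζ (conjForm D.M p) = 0 := fun p hp => by
    rw [cζ_conjForm, m2 p hp, map_zero]
  have n2 : ∀ p ∈ S, cζbar (conjForm D.M p) = 1 / p.1 := fun p hp => by
    rw [cζbar_conjForm, m1 p hp, map_div₀, map_one, Complex.conj_ofReal]
  have r4 : ∀ p ∈ S, cρ (fderiv ℝ (fun p => cζ (D.Γ23 p)) p) =
      (D.Ψ2 p + R / 12) / (p.1 : ℂ) ^ 3 := by
    intro p hp
    obtain ⟨k1, k2, k3, k4, k5, k6, k7, k8, k9, k10⟩ := key p hp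
    have e := h.second_23_ρζ hp
    rw [← flatExtd_ρζ (fAt h.smooth_Γ23 p hp), b0 p hp, c0.2.1, k3, k4, r2 p hp, n0 p hp, n1 p hp,
      m0 p hp, m1 p hp, k8] at e
    have := hρ' p hp
    rw [eq_div_iff (pow_ne_zero 3 this)]
    field_simp at e
    linear_combination (1 / 12) * e
  have r5 : ∀ p ∈ S, cρ (fderiv ℝ (fun p => cζbar (D.Γ23 p)) p) = 0 := by
    intro p hp
    obtain ⟨k1, k2, k3, k4, k5, k6, k7, k8, k9, k10⟩ := key p hp
    have e := h.second_23_ρζbar hp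
    rw [← flatExtd_ρζbar (fAt h.smooth_Γ23 p hp), b0 p hp, c0.2.2, k3, k4, r2 p hp, n0 p hp,
      m0 p hp, m2 p hp] at e
    linear_combination e
  obtain ⟨q, hqdef⟩ : ∃ q : ℂ → ℂ, q = fun w => cζbar (D.Γ23 (ρ₀, w)) := ⟨_, rfl⟩
  have hq : ContDiffOn ℝ ∞ q B := by rw [hqdef]; exact hb2.comp hslice hslmap
  have hb2q : ∀ p ∈ S, cζbar (D.Γ23 p) = q p.2 := by
    intro p hp
    rw [hqdef]
    refine eq_of_cρ_fderiv_eq_zero (f := fun p => cζbar (D.Γ23 p)) (t := p.1) (w := p.2) ?_ hp.1 hρ₀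
    intro t ht
    have hq : ((t, p.2) : ℝ × ℂ) ∈ S := ⟨ht, hp.2⟩
    exact (hasDerivAt_slice (dAt hb2 _ hq)).congr_deriv (r5 _ hq)
  have hxb : ContDiffOn ℝ ∞ (dζbar x) B := contDiffOn_dζbar hB hx
  have hxc : ContDiffOn ℝ ∞ (fun w => conj (x w)) B := Complex.conjCLE.contDiff.comp_contDiffOn hx
  have k1x : ∀ p ∈ S, cζ (D.K p) = (1 / 2) * p.1 * x p.2 := by
    intro p hp
    have := hρ' p hp
    rw [(key p hp).2.2.2.2.2.2.2.2.1, hcx p hp]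
    field_simp
  have k2x : ∀ p ∈ S, cζbar (D.K p) = (1 / 2) * p.1 * conj (x p.2) := by
    intro p hp
    have := cζbar_real (h.real_K p hp)
    rw [this, k1x p hp]
    simp only [map_mul, map_div₀, map_one, Complex.conj_ofReal, map_ofNat]
  have dxc : ∀ p ∈ S, DifferentiableAt ℝ (fun w => conj (x w)) p.2 := fun p hp =>
    (hxc.contDiffAt (hB.mem_nhds hp.2)).differentiableAt (by simp)
  -- the reality of `K` determines the imaginary part of the `dζ`-component of `Γ₂₃`, so that the
  -- remaining constant of integration `α` is real
  have him : ∀ p ∈ S, (1 / 2) * (p.1 : ℂ) ^ 2 * (conj (dζbar x p.2) - dζbar x p.2) =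
      conj (cζ (D.Γ23 p)) - cζ (D.Γ23 p) := by
    intro p hp
    obtain ⟨k1, k2, k3, k4, k5, k6, k7, k8, k9, k10⟩ := key p hp
    have hk1 : ContDiffOn ℝ ∞ (fun p => cζ (D.K p)) S := contDiffOn_cζ h.smooth_K
    have hk2 : ContDiffOn ℝ ∞ (fun p => cζbar (D.K p)) S := contDiffOn_cζbar h.smooth_K
    have e := h.first_K_ζζbar hp
    rw [← flatExtd_ζζbar (fAt h.smooth_K p hp), cζ_fderiv (dAt hk2 p hp),
      cζbar_fderiv (dAt hk1 p hp),
      dζbar_congr (slice (f := fun p => cζ (D.K p)) (g := fun t w => ((1 / 2) * (t : ℂ)) * x w)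
        k1x p hp), dζbar_const_mul _ (dx p hp),
      dζ_congr (slice (f := fun p => cζbar (D.K p))
        (g := fun t w => conj (((1 / 2) * (t : ℂ)) * x w))
        (fun p hp => by
          rw [k2x p hp]
          simp only [map_mul, map_div₀, map_one, Complex.conj_ofReal, map_ofNat]) p hp),
      dζ_conj ((dx p hp).const_mul _), dζbar_const_mul _ (dx p hp), n1 p hp, n2 p hp, m1 p hp,
      m2 p hp, k5, k7, k1x p hp, k2x p hp, hcx p hp, cζbar_conjForm] at e
    simp only [map_mul, map_neg, map_div₀, map_one, map_pow, Complex.conj_ofReal,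
      map_ofNat] at e
    have := hρ' p hp
    field_simp at e
    linear_combination (1 / 4) * e
  -- the `dζ`-component of `Γ₂₃` solves a linear equation in `ρ`; this combination is constant
  have hα : ∀ p ∈ S, ∀ t ∈ Set.Ioo a b,
      cζ (D.Γ23 p) / p.1 + R / (24 * (p.1 : ℂ) ^ 3) - (1 / 2) * p.1 * dζbar x p.2 +
        (1 / 6) * (p.1 : ℂ) ^ 3 * (x p.2 * conj (x p.2)) =
      cζ (D.Γ23 (t, p.2)) / t + R / (24 * (t : ℂ) ^ 3) - (1 / 2) * t * dζbar x p.2 +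
        (1 / 6) * (t : ℂ) ^ 3 * (x p.2 * conj (x p.2)) := by
    intro p hp t ht
    refine eq_of_cρ_fderiv_eq_zero (t := p.1) (w := p.2) (f := fun p =>
      cζ (D.Γ23 p) / p.1 + R / (24 * (p.1 : ℂ) ^ 3) - (1 / 2) * p.1 * dζbar x p.2 +
        (1 / 6) * (p.1 : ℂ) ^ 3 * (x p.2 * conj (x p.2))) ?_ hp.1 ht
    intro t ht
    have hq : ((t, p.2) : ℝ × ℂ) ∈ S := ⟨ht, hp.2⟩
    have ht0 := hρ' _ hq
    have h1 := hasDerivAt_slice (dAt hb1 _ hq)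
    rw [r4 _ hq, hΨ2 _ hq] at h1
    have h3 : HasDerivAt (fun t : ℝ => (t : ℂ) ^ 3) (3 * (t : ℂ) ^ 2) t := by
      simpa using (hofReal t).fun_pow 3
    have h4 := (((h1.fun_div (hofReal t) ht0).fun_add ((hasDerivAt_const t (R : ℂ)).fun_div
      (h3.const_mul 24) (mul_ne_zero (by norm_num) (pow_ne_zero 3 ht0)))).fun_sub
      (((hofReal t).const_mul (1 / 2)).mul_const (dζbar x p.2))).fun_add
      ((h3.const_mul (1 / 6)).mul_const (x p.2 * conj (x p.2)))
    refine h4.congr_deriv ?_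
    simp only at ht0 ⊢
    field_simp
    ring
  obtain ⟨α, hαdef⟩ : ∃ α : ℂ → ℝ, α = fun w => (cζ (D.Γ23 (ρ₀, w)) / ρ₀ + R / (24 * (ρ₀ : ℂ) ^ 3) -
      (1 / 2) * ρ₀ * dζbar x w + (1 / 6) * (ρ₀ : ℂ) ^ 3 * (x w * conj (x w))).re := ⟨_, rfl⟩
  have hαs : ContDiffOn ℝ ∞ α B := by
    rw [hαdef]
    refine ContDiff.comp_contDiffOn (g := Complex.re) Complex.reCLM.contDiff ?_
    refine ((ContDiffOn.add ?_ contDiffOn_const).sub (contDiffOn_const.mul hxb)).add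
      (contDiffOn_const.mul (hx.mul hxc))
    exact contDiffOn_div (hb1.comp hslice hslmap) contDiffOn_const (fun _ _ => hρ₀')
  have hαc : ContDiffOn ℝ ∞ (fun w => (α w : ℂ)) B := Complex.ofRealCLM.contDiff.comp_contDiffOn hαs
  have hb1α : ∀ p ∈ S, cζ (D.Γ23 p) = p.1 * α p.2 - R / (24 * (p.1 : ℂ) ^ 2) +
      (1 / 2) * (p.1 : ℂ) ^ 2 * dζbar x p.2 -
      (1 / 6) * (p.1 : ℂ) ^ 4 * (x p.2 * conj (x p.2)) := by
    intro p hp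
    have hreal : (α p.2 : ℂ) = cζ (D.Γ23 (ρ₀, p.2)) / ρ₀ + R / (24 * (ρ₀ : ℂ) ^ 3) -
        (1 / 2) * ρ₀ * dζbar x p.2 + (1 / 6) * (ρ₀ : ℂ) ^ 3 * (x p.2 * conj (x p.2)) := by
      rw [hαdef]
      refine Complex.conj_eq_iff_re.1 ?_
      have e := him (ρ₀, p.2) ⟨hρ₀, hp.2⟩
      simp only [map_add, map_sub, map_mul, map_div₀, map_one, map_pow, Complex.conj_ofReal,
        map_ofNat, Complex.conj_conj]
      simp only at e
      rw [← sub_eq_zero] at e ⊢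
      field_simp
      linear_combination (-288 * (ρ₀ : ℂ) ^ 2) * e
    have h2 := hα p hp ρ₀ hρ₀
    rw [← hreal] at h2
    have := hρ' p hp
    rw [← h2]
    field_simp
    ring
  refine ⟨x, q, α, hx, hq, hαs, ?_⟩
  have hΨ2' : ∀ p ∈ S, D.Ψ2 p = normalΨ2 x α p.1 p.2 := by
    intro p hp
    have := hρ' p hp
    rw [hΨ2 p hp, hb1α p hp, normalΨ2]
    field_simp
    ring
  have dαc : ∀ p ∈ S, DifferentiableAt ℝ (fun w => (α w : ℂ)) p.2 := fun p hp =>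
    (hαc.contDiffAt (hB.mem_nhds hp.2)).differentiableAt (by simp)
  have dxb : ∀ p ∈ S, DifferentiableAt ℝ (dζbar x) p.2 := fun p hp =>
    (hxb.contDiffAt (hB.mem_nhds hp.2)).differentiableAt (by simp)
  have r6 : ∀ p ∈ S, cζbar (fderiv ℝ (fun p => cζ (D.Γ23 p)) p) =
      p.1 * dζbar (fun w => (α w : ℂ)) p.2 + (1 / 2) * (p.1 : ℂ) ^ 2 * dζbar (dζbar x) p.2 -
      (1 / 6) * (p.1 : ℂ) ^ 4 * (x p.2 * dζbar (fun w => conj (x w)) p.2 +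
        dζbar x p.2 * conj (x p.2)) := by
    intro p hp
    have d1 := (dαc p hp).const_mul (p.1 : ℂ)
    have d2 := (dxb p hp).const_mul ((1 / 2) * (p.1 : ℂ) ^ 2)
    have d3 := ((dx p hp).fun_mul (dxc p hp)).const_mul ((1 / 6) * (p.1 : ℂ) ^ 4)
    have d4 : DifferentiableAt ℝ (fun _ : ℂ => (R / (24 * (p.1 : ℂ) ^ 2) : ℂ)) p.2 :=
      differentiableAt_const _
    rw [cζbar_fderiv (dAt hb1 p hp), dζbar_congr (slice (f := fun p => cζ (D.Γ23 p))
      (g := fun t w => t * α w - R / (24 * (t : ℂ) ^ 2) +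
        ((1 / 2) * (t : ℂ) ^ 2) * dζbar x w -
        ((1 / 6) * (t : ℂ) ^ 4) * (x w * conj (x w))) hb1α p hp),
      dζbar_sub ((d1.fun_sub d4).fun_add d2) d3, dζbar_add (d1.fun_sub d4) d2,
      dζbar_sub d1 d4, dζbar_const, dζbar_const_mul _ (dαc p hp),
      dζbar_const_mul _ (dxb p hp), dζbar_const_mul _ ((dx p hp).fun_mul (dxc p hp)),
      dζbar_mul (dx p hp) (dxc p hp), sub_zero]
  have hΨ3 : ∀ p ∈ S, D.Ψ3 p = normalΨ3 R x q α p.1 p.2 := by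
    intro p hp
    obtain ⟨k1, k2, k3, k4, k5, k6, k7, k8, k9, k10⟩ := key p hp
    have e := h.second_23_ζζbar hp
    rw [← flatExtd_ζζbar (fAt h.smooth_Γ23 p hp), r6 p hp, cζ_fderiv (dAt hb2 p hp),
      dζ_congr (slice (f := fun p => cζbar (D.Γ23 p)) (g := fun _ w => q w) hb2q p hp),
      n1 p hp, n2 p hp, m1 p hp, m2 p hp, k5, k6, k7, hΨ2' p hp, k2x p hp, hb2q p hp] at e
    have := hρ' p hp
    have e' : D.Ψ3 p = (p.1 : ℂ) ^ 2 * (2 * cζ (D.Γ12 p) * q p.2 -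
        (normalΨ2 x α p.1 p.2 + R / 12) * ((1 / 2) * conj (x p.2)) -
        (dζ q p.2 - (p.1 * dζbar (fun w => (α w : ℂ)) p.2 +
          (1 / 2) * (p.1 : ℂ) ^ 2 * dζbar (dζbar x) p.2 -
          (1 / 6) * (p.1 : ℂ) ^ 4 * (x p.2 * dζbar (fun w => conj (x w)) p.2 +
            dζbar x p.2 * conj (x p.2))))) := by
      rw [show dζ (fun w => q w) p.2 = dζ q p.2 from rfl] at e
      rw [e]
      field_simp
      ring
    rw [e', hcx p hp, normalΨ3, normalΨ2]
    ring
  refine eqOn_normalForm_of_components hρ hM h41 (fun p hp => (key p hp).2.2.2.2.2.2.2.1) k1x k2x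
    r2 (fun p hp => ?_) hb2q (fun p hp => (key p hp).2.2.1) hcx
    (fun p hp => (key p hp).2.2.2.2.2.1) (fun p hp => (key p hp).2.2.2.1)
    (fun p hp => (key p hp).2.2.2.2.1) (fun p hp => (key p hp).2.2.2.2.2.2.1)
    (fun p hp => (key p hp).1) (fun p hp => ?_) hΨ2' hΨ3
  · have := hρ' p hp
    rw [hb1α p hp, normalΓ421]
    field_simp
    ring
  · rw [(key p hp).2.1, hcx p hp]
    ring

/-! ### Every normal form is a solution -/

/-- The form `f dρ + g dζ + h dζ̄` on `ℝ × ℂ`. -/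
noncomputable def compForm (f g h : ℝ × ℂ → ℂ) (p : ℝ × ℂ) : ℝ × ℂ →L[ℝ] ℂ :=
  f p • (Complex.ofRealCLM ∘L ContinuousLinearMap.fst ℝ ℝ ℂ) +
    g p • ContinuousLinearMap.snd ℝ ℝ ℂ +
    h p • ((Complex.conjCLE : ℂ →L[ℝ] ℂ) ∘L ContinuousLinearMap.snd ℝ ℝ ℂ)

lemma compForm_apply (f g h : ℝ × ℂ → ℂ) (p v : ℝ × ℂ) :
    compForm f g h p v = f p * v.1 + g p * v.2 + h p * conj v.2 := rfl

lemma cρ_compForm (f g h : ℝ × ℂ → ℂ) (p : ℝ × ℂ) : cρ (compForm f g h p) = f p := by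
  simp [cρ, compForm_apply]

lemma cζ_compForm (f g h : ℝ × ℂ → ℂ) (p : ℝ × ℂ) : cζ (compForm f g h p) = g p := by
  simp only [cζ, compForm_apply, Complex.ofReal_zero, map_one, Complex.conj_I]
  linear_combination (-(1 / 2) * g p + (1 / 2) * h p) * Complex.I_mul_I

lemma cζbar_compForm (f g h : ℝ × ℂ → ℂ) (p : ℝ × ℂ) : cζbar (compForm f g h p) = h p := by
  simp only [cζbar, compForm_apply, Complex.ofReal_zero, map_one, Complex.conj_I]
  linear_combination ((1 / 2) * g p - (1 / 2) * h p) * Complex.I_mul_I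

lemma contDiffOn_compForm {f g h : ℝ × ℂ → ℂ} {S : Set (ℝ × ℂ)} (hf : ContDiffOn ℝ ∞ f S)
    (hg : ContDiffOn ℝ ∞ g S) (hh : ContDiffOn ℝ ∞ h S) : ContDiffOn ℝ ∞ (compForm f g h) S :=
  ((hf.smul contDiffOn_const).add (hg.smul contDiffOn_const)).add (hh.smul contDiffOn_const)

lemma flatExtd_compForm {f g h : ℝ × ℂ → ℂ} {p : ℝ × ℂ} (hf : DifferentiableAt ℝ f p)
    (hg : DifferentiableAt ℝ g p) (hh : DifferentiableAt ℝ h p) (u v : ℝ × ℂ) :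
    flatExtd (compForm f g h) p u v =
      (fderiv ℝ f p u * v.1 - fderiv ℝ f p v * u.1) +
      (fderiv ℝ g p u * v.2 - fderiv ℝ g p v * u.2) +
      (fderiv ℝ h p u * conj v.2 - fderiv ℝ h p v * conj u.2) := by
  have hd := ((hf.hasFDerivAt.smul (hasFDerivAt_const
    (Complex.ofRealCLM ∘L ContinuousLinearMap.fst ℝ ℝ ℂ) p)).add
    (hg.hasFDerivAt.smul (hasFDerivAt_const (ContinuousLinearMap.snd ℝ ℝ ℂ) p))).add
    (hh.hasFDerivAt.smul (hasFDerivAt_const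
      ((Complex.conjCLE : ℂ →L[ℝ] ℂ) ∘L ContinuousLinearMap.snd ℝ ℝ ℂ) p))
  have hd' : ∀ u v : ℝ × ℂ, fderiv ℝ (compForm f g h) p u v =
      fderiv ℝ f p u * v.1 + fderiv ℝ g p u * v.2 + fderiv ℝ h p u * conj v.2 := by
    intro u v
    have := DFunLike.congr_fun (DFunLike.congr_fun hd.fderiv u) v
    refine Eq.trans this ?_
    simp
  rw [flatExtd, hd', hd']
  ring

lemma fderiv_fst_slice {g : ℝ → ℂ} {g' : ℂ} {p : ℝ × ℂ} (hg : HasDerivAt g g' p.1) (u : ℝ × ℂ) :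
    fderiv ℝ (fun p => g p.1) p u = g' * u.1 := by
  have h1 : HasFDerivAt (fun p : ℝ × ℂ => g p.1) _ p :=
    HasFDerivAt.comp (g := g) p hg.hasFDerivAt hasFDerivAt_fst
  rw [h1.fderiv]
  simp [mul_comm]

/-- The derivative of a product of a function of `ρ` and a function of `ζ`. -/
lemma fderiv_mul_slice {g : ℝ → ℂ} {g' : ℂ} {y : ℂ → ℂ} {p : ℝ × ℂ} (hg : HasDerivAt g g' p.1)
    (hy : DifferentiableAt ℝ y p.2) (u : ℝ × ℂ) :
    fderiv ℝ (fun p => g p.1 * y p.2) p u =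
      g' * u.1 * y p.2 + g p.1 * (dζ y p.2 * u.2 + dζbar y p.2 * conj u.2) := by
  have h1 : HasFDerivAt (fun p : ℝ × ℂ => g p.1) _ p :=
    HasFDerivAt.comp (g := g) p hg.hasFDerivAt hasFDerivAt_fst
  have h2 : HasFDerivAt (fun p : ℝ × ℂ => y p.2) _ p :=
    HasFDerivAt.comp (g := y) p hy.hasFDerivAt hasFDerivAt_snd
  have h3 : fderiv ℝ y p.2 u.2 = dζ y p.2 * u.2 + dζbar y p.2 * conj u.2 := by
    have e1 : (u.2 : ℂ) = u.2.re + u.2.im * Complex.I := (Complex.re_add_im _).symm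
    have e2 : conj u.2 = u.2.re - u.2.im * Complex.I := by apply Complex.ext <;> simp
    have e3 : u.2 = u.2.re • (1 : ℂ) + u.2.im • Complex.I := by simp
    have e4 : fderiv ℝ y p.2 u.2 = u.2.re * fderiv ℝ y p.2 1 + u.2.im * fderiv ℝ y p.2 Complex.I :=
        by
      conv_lhs => rw [e3]
      rw [map_add, map_smul, map_smul, Complex.real_smul, Complex.real_smul]
    rw [e4, e2, dζ, dζbar]
    linear_combination (-(1 / 2) * (fderiv ℝ y p.2 1 - Complex.I * fderiv ℝ y p.2 Complex.I)) * e1 +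
      (u.2.im * fderiv ℝ y p.2 Complex.I) * Complex.I_mul_I
  have h4 := DFunLike.congr_fun (h1.fun_mul h2).fderiv u
  refine h4.trans ?_
  rw [← h3]
  simp
  ring

lemma dζbar_conj {f : ℂ → ℂ} {w : ℂ} (hf : DifferentiableAt ℝ f w) :
    dζbar (fun t => conj (f t)) w = conj (dζ f w) := by
  rw [dζ, dζbar, fderiv_conj hf, fderiv_conj hf]
  simp only [map_mul, map_sub, map_div₀, map_one, Complex.conj_I, map_ofNat]
  ring

lemma FlatData.IsSolutionOn.congr {R : ℝ} {F : Type*} [NormedAddCommGroup F] [NormedSpace ℝ F]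
    {D E : FlatData F} {U : Set F} (hU : IsOpen U)
    (hE : E.IsSolutionOn R U) (h : E.toData.EqOn D.toData U) : D.IsSolutionOn R U := by
  have hd : ∀ {η θ : F → F →L[ℝ] ℂ}, (∀ p ∈ U, η p = θ p) → ∀ p ∈ U, ∀ u v,
      flatExtd θ p u v = flatExtd η p u v := by
    intro η θ hηθ p hp u v
    refine flatExtd_congr ?_ u v
    filter_upwards [hU.mem_nhds hp] with y hy using (hηθ y hy).symm
  have e1 : ∀ p ∈ U, E.M p = D.M p := h.M
  have e2 : ∀ p ∈ U, E.K p = D.K p := h.K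
  have e3 : ∀ p ∈ U, E.Γ41 p = D.Γ41 p := h.Γ41
  have e4 : ∀ p ∈ U, E.Γ23 p = D.Γ23 p := h.Γ23
  have e5 : ∀ p ∈ U, E.Γ12 p = D.Γ12 p := h.Γ12
  have e6 : ∀ p ∈ U, E.Γ34 p = D.Γ34 p := h.Γ34
  have f0 : ∀ p ∈ U, E.Ψ0 p = D.Ψ0 p := h.Ψ0
  have f1 : ∀ p ∈ U, E.Ψ1 p = D.Ψ1 p := h.Ψ1
  have f2 : ∀ p ∈ U, E.Ψ2 p = D.Ψ2 p := h.Ψ2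
  have f3 : ∀ p ∈ U, E.Ψ3 p = D.Ψ3 p := h.Ψ3
  constructor
  · exact hE.smooth_M.congr fun p hp => (e1 p hp).symm
  · exact hE.smooth_K.congr fun p hp => (e2 p hp).symm
  · exact hE.smooth_Γ41.congr fun p hp => (e3 p hp).symm
  · exact hE.smooth_Γ23.congr fun p hp => (e4 p hp).symm
  · exact hE.smooth_Γ12.congr fun p hp => (e5 p hp).symm
  · exact hE.smooth_Γ34.congr fun p hp => (e6 p hp).symm
  · intro p hp; rw [← e2 p hp]; exact hE.real_K p hp
  · intro p hp; rw [← e5 p hp]; exact hE.conj_Γ12 p hp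
  · intro p hp; rw [← e6 p hp]; exact hE.real_Γ34 p hp
  · intro p hp; rw [← e1 p hp, ← e2 p hp]; exact hE.coframe p hp
  · intro p hp u v
    rw [hd e1 p hp, ← e1 p hp, ← e5 p hp, ← e3 p hp, ← e2 p hp]; exact hE.first_M p hp u v
  · intro p hp u v
    rw [← e1 p hp, ← e3 p hp]; exact hE.first_L p hp u v
  · intro p hp u v
    rw [hd e2 p hp, ← e1 p hp, ← e4 p hp, ← e6 p hp, ← e2 p hp]; exact hE.first_K p hp u v
  · intro p hp u v
    rw [hd e4 p hp, ← e1 p hp, ← e4 p hp, ← e5 p hp, ← e6 p hp, ← e2 p hp, ← f2 p hp, ← f3 p hp]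
    exact hE.second_23 p hp u v
  · intro p hp u v
    rw [hd e3 p hp, ← e1 p hp, ← e3 p hp, ← e5 p hp, ← e6 p hp, ← e2 p hp, ← f0 p hp, ← f1 p hp]
    exact hE.second_14 p hp u v
  · intro p hp u v
    rw [hd e5 p hp, hd e6 p hp, ← e1 p hp, ← e3 p hp, ← e4 p hp, ← e2 p hp, ← f1 p hp, ← f2 p hp]
    exact hE.second_12_34 p hp u v

/-- The coefficient of `dζ` of `Γ₂₃` in the normal form. -/
noncomputable def normalB (R : ℝ) (x : ℂ → ℂ) (a : ℂ → ℝ) (p : ℝ × ℂ) : ℂ :=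
  (p.1 : ℂ) * a p.2 + -(R / 24) * ((p.1 : ℂ) ^ 2)⁻¹ + (1 / 2) * (p.1 : ℂ) ^ 2 * dζbar x p.2 +
    -(1 / 6) * (p.1 : ℂ) ^ 4 * (x p.2 * conj (x p.2))

/-- The normal form, with its forms written in the coordinates `(ρ, ζ)`. -/
noncomputable def normalFlat (R : ℝ) (x q : ℂ → ℂ) (a : ℂ → ℝ) : FlatData (ℝ × ℂ) where
  M := compForm (fun _ => 0) (fun p => (p.1 : ℂ)⁻¹) (fun _ => 0)
  K := compForm (fun p => ((p.1 : ℂ) ^ 2)⁻¹) (fun p => (1 / 2) * p.1 * x p.2)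
    (fun p => (1 / 2) * p.1 * conj (x p.2))
  Γ41 := compForm (fun _ => 0) (fun _ => 0) (fun _ => 1)
  Γ23 := compForm (fun _ => 0) (normalB R x a) (fun p => q p.2)
  Γ12 := compForm (fun _ => 0) (fun p => -(1 / 2) * (p.1 : ℂ) ^ 2 * x p.2)
    (fun p => (1 / 2) * (p.1 : ℂ) ^ 2 * conj (x p.2))
  Γ34 := compForm (fun _ => 0) (fun p => -(1 / 2) * (p.1 : ℂ) ^ 2 * x p.2)
    (fun p => -(1 / 2) * (p.1 : ℂ) ^ 2 * conj (x p.2))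
  Ψ0 _ := 0
  Ψ1 p := x p.2 * (p.1 : ℂ) ^ 4
  Ψ2 p := normalΨ2 x a p.1 p.2
  Ψ3 p := normalΨ3 R x q a p.1 p.2

lemma normalFlat_eqOn {R : ℝ} {x q : ℂ → ℂ} {a : ℂ → ℝ} {S : Set (ℝ × ℂ)}
    (hρ : ∀ p ∈ S, p.1 ≠ 0) :
    (normalFlat R x q a).toData.EqOn (normalForm R Prod.fst Prod.snd x q a) S := by
  refine eqOn_normalForm_of_components hρ ?_ ?_ ?_ ?_ ?_ ?_ ?_ ?_ ?_ ?_ ?_ ?_ ?_ ?_ ?_ ?_ ?_ ?_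
  case refine_7 =>
    intro p hp
    have : (p.1 : ℂ) ≠ 0 := by exact_mod_cast hρ p hp
    simp only [normalFlat, cζ_compForm, normalB, normalΓ421]
    field_simp
    ring
  all_goals
    intro p hp
    try intro v
    simp only [normalFlat, cρ_compForm, cζ_compForm, cζbar_compForm, compForm_apply, map_neg,
      map_mul, map_div₀, map_one, map_pow, Complex.conj_ofReal, map_ofNat]
    try ring

/-- The normal form is a solution of the structure equations. -/
theorem normalFlat_isSolutionOn {R : ℝ} {x q : ℂ → ℂ} {a : ℂ → ℝ} {V : Set ℂ} (hV : IsOpen V)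
    (hx : ContDiffOn ℝ ∞ x V) (hq : ContDiffOn ℝ ∞ q V) (ha : ContDiffOn ℝ ∞ a V) :
    (normalFlat R x q a).IsSolutionOn R {p | p.1 ≠ 0 ∧ p.2 ∈ V} := by
  set S : Set (ℝ × ℂ) := {p | p.1 ≠ 0 ∧ p.2 ∈ V} with hSdef
  have hρ' : ∀ p ∈ S, (p.1 : ℂ) ≠ 0 := fun p hp => by exact_mod_cast hp.1
  have hxc : ContDiffOn ℝ ∞ (fun w => conj (x w)) V := Complex.conjCLE.contDiff.comp_contDiffOn hx
  have hac : ContDiffOn ℝ ∞ (fun w => (a w : ℂ)) V := Complex.ofRealCLM.contDiff.comp_contDiffOn ha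
  have hxb : ContDiffOn ℝ ∞ (dζbar x) V := contDiffOn_dζbar hV hx
  have s1 : ContDiffOn ℝ ∞ (fun p : ℝ × ℂ => (p.1 : ℂ)) S :=
    (Complex.ofRealCLM.contDiff.comp contDiff_fst).contDiffOn
  have sl : ∀ {y : ℂ → ℂ}, ContDiffOn ℝ ∞ y V → ContDiffOn ℝ ∞ (fun p : ℝ × ℂ => y p.2) S :=
    fun hy => hy.comp contDiff_snd.contDiffOn fun p hp => hp.2
  have sd : ∀ {y : ℂ → ℂ}, ContDiffOn ℝ ∞ y V → ∀ p ∈ S, DifferentiableAt ℝ y p.2 :=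
    fun hy p hp => (hy.contDiffAt (hV.mem_nhds hp.2)).differentiableAt (by simp)
  have hS : IsOpen S := (isOpen_ne_fun continuous_fst continuous_const).inter
    (hV.preimage continuous_snd)
  have dAt : ∀ {f : ℝ × ℂ → ℂ}, ContDiffOn ℝ ∞ f S → ∀ p ∈ S, DifferentiableAt ℝ f p :=
    fun hf p hp => differentiableAt_of_contDiffOn hS hf p hp
  have i1 : ContDiffOn ℝ ∞ (fun p : ℝ × ℂ => (p.1 : ℂ)⁻¹) S := s1.inv hρ'
  have i2 : ContDiffOn ℝ ∞ (fun p : ℝ × ℂ => ((p.1 : ℂ) ^ 2)⁻¹) S :=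
    (s1.pow 2).inv fun p hp => pow_ne_zero 2 (hρ' p hp)
  have k1 : ContDiffOn ℝ ∞ (fun p : ℝ × ℂ => (1 / 2) * (p.1 : ℂ) * x p.2) S :=
    (contDiffOn_const.mul s1).mul (sl hx)
  have k2 : ContDiffOn ℝ ∞ (fun p : ℝ × ℂ => (1 / 2) * (p.1 : ℂ) * conj (x p.2)) S :=
    (contDiffOn_const.mul s1).mul (sl hxc)
  have c1 : ContDiffOn ℝ ∞ (fun p : ℝ × ℂ => -(1 / 2) * (p.1 : ℂ) ^ 2 * x p.2) S :=
    (contDiffOn_const.mul (s1.pow 2)).mul (sl hx)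
  have c2 : ContDiffOn ℝ ∞ (fun p : ℝ × ℂ => (1 / 2) * (p.1 : ℂ) ^ 2 * conj (x p.2)) S :=
    (contDiffOn_const.mul (s1.pow 2)).mul (sl hxc)
  have c3 : ContDiffOn ℝ ∞ (fun p : ℝ × ℂ => -(1 / 2) * (p.1 : ℂ) ^ 2 * conj (x p.2)) S :=
    (contDiffOn_const.mul (s1.pow 2)).mul (sl hxc)
  have b1 : ContDiffOn ℝ ∞ (fun p : ℝ × ℂ => (p.1 : ℂ) * a p.2) S := s1.mul (sl hac)
  have b2 : ContDiffOn ℝ ∞ (fun p : ℝ × ℂ => -(R / 24) * ((p.1 : ℂ) ^ 2)⁻¹) S :=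
    contDiffOn_const.mul i2
  have b3 : ContDiffOn ℝ ∞ (fun p : ℝ × ℂ => (1 / 2) * (p.1 : ℂ) ^ 2 * dζbar x p.2) S :=
    (contDiffOn_const.mul (s1.pow 2)).mul (sl hxb)
  have b4 : ContDiffOn ℝ ∞
      (fun p : ℝ × ℂ => -(1 / 6) * (p.1 : ℂ) ^ 4 * (x p.2 * conj (x p.2))) S :=
    (contDiffOn_const.mul (s1.pow 4)).mul (sl (hx.mul hxc))
  have hb : ContDiffOn ℝ ∞ (normalB R x a) S := ((b1.add b2).add b3).add b4
  have z0 : ∀ (c : ℂ), ContDiffOn ℝ ∞ (fun _ : ℝ × ℂ => c) S := fun c => contDiffOn_const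
  -- derivatives of the powers of `ρ`
  have hofReal : ∀ t : ℝ, HasDerivAt (fun t : ℝ => (t : ℂ)) 1 t := fun t =>
    (Complex.ofRealCLM.hasDerivAt (x := t))
  have p2 : ∀ (c : ℂ) (t : ℝ), HasDerivAt (fun t : ℝ => c * (t : ℂ) ^ 2) (c * (2 * t)) t :=
    fun c t => HasDerivAt.const_mul c (by simpa using (hofReal t).fun_pow 2)
  have p4 : ∀ (c : ℂ) (t : ℝ), HasDerivAt (fun t : ℝ => c * (t : ℂ) ^ 4) (c * (4 * t ^ 3)) t :=
    fun c t => HasDerivAt.const_mul c (by simpa using (hofReal t).fun_pow 4)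
  have pi2 : ∀ p ∈ S, HasDerivAt (fun t : ℝ => -(R / 24) * ((t : ℂ) ^ 2)⁻¹)
      ((R / 12) / (p.1 : ℂ) ^ 3) p.1 := by
    intro p hp
    have := hρ' p hp
    have h2 : HasDerivAt (fun t : ℝ => (t : ℂ) ^ 2) (2 * p.1) p.1 := by
      simpa using (hofReal p.1).fun_pow 2
    refine ((h2.fun_inv (pow_ne_zero 2 this)).const_mul (-(R / 24 : ℂ))).congr_deriv ?_
    field_simp
    ring
  have pi1 : ∀ p ∈ S, HasDerivAt (fun t : ℝ => (t : ℂ)⁻¹) (-1 / (p.1 : ℂ) ^ 2) p.1 := fun p hp =>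
    (hofReal p.1).fun_inv (hρ' p hp)
  have p1 : ∀ (c : ℂ) (t : ℝ), HasDerivAt (fun t : ℝ => c * (t : ℂ)) c t :=
    fun c t => by simpa using (hofReal t).const_mul c
  have pin : ∀ p ∈ S, HasDerivAt (fun t : ℝ => ((t : ℂ) ^ 2)⁻¹) (-2 / (p.1 : ℂ) ^ 3) p.1 := by
    intro p hp
    have := hρ' p hp
    have h2 : HasDerivAt (fun t : ℝ => (t : ℂ) ^ 2) (2 * p.1) p.1 := by
      simpa using (hofReal p.1).fun_pow 2
    refine (h2.fun_inv (pow_ne_zero 2 this)).congr_deriv ?_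
    field_simp
  have one : ∀ w : ℂ, DifferentiableAt ℝ (fun _ : ℂ => (1 : ℂ)) w := fun w =>
    differentiableAt_const _
  have hconst : ∀ (c : ℂ) (p u : ℝ × ℂ), fderiv ℝ (fun _ : ℝ × ℂ => c) p u = 0 := fun c p u => by
    simp
  have fB : ∀ p ∈ S, ∀ u, fderiv ℝ (normalB R x a) p u =
      (u.1 * a p.2 + p.1 * (dζ (fun w => (a w : ℂ)) p.2 * u.2 +
        dζbar (fun w => (a w : ℂ)) p.2 * conj u.2)) +
      (R / 12) / (p.1 : ℂ) ^ 3 * u.1 +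
      (p.1 * u.1 * dζbar x p.2 + (1 / 2) * (p.1 : ℂ) ^ 2 * (dζ (dζbar x) p.2 * u.2 +
        dζbar (dζbar x) p.2 * conj u.2)) +
      (-(2 / 3) * (p.1 : ℂ) ^ 3 * u.1 * (x p.2 * conj (x p.2)) +
        -(1 / 6) * (p.1 : ℂ) ^ 4 * (dζ (fun w => x w * conj (x w)) p.2 * u.2 +
          (x p.2 * conj (dζ x p.2) + dζbar x p.2 * conj (x p.2)) * conj u.2)) := by
    intro p hp u
    have e : fderiv ℝ (normalB R x a) p = _ :=
      ((((dAt b1 p hp).hasFDerivAt.fun_add (dAt b2 p hp).hasFDerivAt).fun_add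
        (dAt b3 p hp).hasFDerivAt).fun_add (dAt b4 p hp).hasFDerivAt).fderiv
    rw [e]
    simp only [FunLike.coe_add, Pi.add_apply]
    rw [fderiv_mul_slice (g := fun t => (t : ℂ)) (y := fun w => (a w : ℂ)) (hofReal p.1)
        (sd hac p hp),
      fderiv_fst_slice (g := fun t => -(R / 24) * ((t : ℂ) ^ 2)⁻¹) (pi2 p hp),
      fderiv_mul_slice (g := fun t => (1 / 2) * (t : ℂ) ^ 2) (p2 _ _) (sd hxb p hp),
      fderiv_mul_slice (g := fun t => -(1 / 6) * (t : ℂ) ^ 4) (y := fun w => x w * conj (x w))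
        (p4 _ _) (sd (hx.mul hxc) p hp), dζbar_mul (sd hx p hp) (sd hxc p hp),
      dζbar_conj (sd hx p hp)]
    ring
  constructor
  · exact contDiffOn_compForm (z0 0) i1 (z0 0)
  · exact contDiffOn_compForm i2 k1 k2
  · exact contDiffOn_compForm (z0 0) (z0 0) (z0 1)
  · exact contDiffOn_compForm (z0 0) hb (sl hq)
  · exact contDiffOn_compForm (z0 0) c1 c2
  · exact contDiffOn_compForm (z0 0) c1 c3
  · intro p hp v
    simp only [normalFlat, compForm_apply, map_add, map_mul, map_div₀, map_one, map_pow, map_inv₀,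
      Complex.conj_ofReal, map_ofNat, Complex.conj_conj]
    ring
  · intro p hp v
    simp only [normalFlat, compForm_apply, map_add, map_mul, map_div₀, map_one, map_pow, map_neg,
      Complex.conj_ofReal, map_ofNat, Complex.conj_conj, map_zero]
    ring
  · intro p hp v
    simp only [normalFlat, compForm_apply, map_add, map_mul, map_div₀, map_one, map_pow, map_neg,
      Complex.conj_ofReal, map_ofNat, Complex.conj_conj, map_zero]
    ring
  · intro p hp
    refine ⟨(1, 0), (0, 1), (0, Complex.I), ?_⟩
    simp only [normalFlat, det_three, compForm_apply, map_add, map_mul, map_one, map_inv₀,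
      Complex.conj_ofReal, map_zero, Complex.conj_I, Complex.ofReal_zero, Complex.ofReal_one]
    have := hρ' p hp
    field_simp
    ring_nf
    simpa using hp.1
  · intro p hp u v
    have e := flatExtd_compForm (dAt (z0 0) p hp) (dAt i1 p hp) (dAt (z0 0) p hp) u v
    refine Eq.trans e ?_
    rw [fderiv_fst_slice (g := fun t => (t : ℂ)⁻¹) (pi1 p hp),
      fderiv_fst_slice (g := fun t => (t : ℂ)⁻¹) (pi1 p hp)]
    simp only [normalFlat, compForm_apply, hconst, map_add, map_mul, map_one, map_zero,
      Complex.conj_conj]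
    have := hρ' p hp
    field_simp
    ring
  · intro p hp u v
    simp only [normalFlat, compForm_apply, map_add, map_mul, map_one, map_zero, map_inv₀,
      Complex.conj_conj, Complex.conj_ofReal]
    ring
  · intro p hp u v
    have e := flatExtd_compForm (dAt i2 p hp) (dAt k1 p hp) (dAt k2 p hp) u v
    refine Eq.trans e ?_
    have f1 := fderiv_mul_slice (p := p) (g := fun t => (1 / 2) * (t : ℂ)) (p1 _ _) (sd hx p hp)
    have f2 := fderiv_mul_slice (p := p) (g := fun t => (1 / 2) * (t : ℂ)) (p1 _ _) (sd hxc p hp)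
    have f3 := fderiv_fst_slice (g := fun t => ((t : ℂ) ^ 2)⁻¹) (pin p hp)
    rw [f1, f1, f2, f2, f3, f3, dζbar_conj (sd hx p hp), dζ_conj (sd hx p hp)]
    simp only [normalFlat, compForm_apply, normalB, map_add, map_mul, map_one, map_zero, map_inv₀,
      map_pow, map_neg, map_div₀, map_ofNat, Complex.conj_conj, Complex.conj_ofReal]
    have := hρ' p hp
    field_simp
    ring
  · intro p hp u v
    have e := flatExtd_compForm (dAt (z0 0) p hp) (dAt hb p hp) (dAt (sl hq) p hp) u v
    refine Eq.trans e ?_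
    have f1 := fderiv_mul_slice (p := p) (g := fun _ => 1) (hasDerivAt_const _ _) (sd hq p hp)
    simp only [one_mul] at f1
    rw [f1, f1, fB p hp, fB p hp]
    simp only [normalFlat, compForm_apply, hconst, normalB, normalΨ2, normalΨ3,
      dζbar_conj (sd hx p hp), map_add, map_mul, map_zero, map_inv₀, Complex.conj_conj,
      Complex.conj_ofReal]
    have := hρ' p hp
    field_simp
    ring
  · intro p hp u v
    have e := flatExtd_compForm (dAt (z0 0) p hp) (dAt (z0 0) p hp) (dAt (z0 1) p hp) u v
    refine Eq.trans e ?_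
    simp only [normalFlat, compForm_apply, hconst, map_add, map_mul, map_zero, map_inv₀,
      Complex.conj_conj, Complex.conj_ofReal]
    have := hρ' p hp
    field_simp
    ring
  · intro p hp u v
    have f1 := fderiv_mul_slice (p := p) (g := fun t => -(1 / 2) * (t : ℂ) ^ 2) (p2 _ _)
        (sd hx p hp)
    have f2 := fderiv_mul_slice (p := p) (g := fun t => (1 / 2) * (t : ℂ) ^ 2) (p2 _ _)
        (sd hxc p hp)
    have f3 := fderiv_mul_slice (p := p) (g := fun t => -(1 / 2) * (t : ℂ) ^ 2) (p2 _ _)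
      (sd hxc p hp)
    have e1 : flatExtd (normalFlat R x q a).Γ12 p u v = _ :=
      flatExtd_compForm (dAt (z0 0) p hp) (dAt c1 p hp) (dAt c2 p hp) u v
    have e2 : flatExtd (normalFlat R x q a).Γ34 p u v = _ :=
      flatExtd_compForm (dAt (z0 0) p hp) (dAt c1 p hp) (dAt c3 p hp) u v
    rw [e1, e2, f1, f1, f2, f2, f3, f3]
    simp only [normalFlat, compForm_apply, hconst, normalB, normalΨ2, map_add, map_mul, map_zero,
      map_inv₀, Complex.conj_conj, Complex.conj_ofReal]
    have := hρ' p hp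
    field_simp
    ring

/-- Every choice of the functions `x`, `q`, `a` gives a solution of the structure equations. -/
theorem normalForm_isSolutionOn {R : ℝ} {x q : ℂ → ℂ} {a : ℂ → ℝ} {V : Set ℂ} (hV : IsOpen V)
    (hx : ContDiffOn ℝ ∞ x V) (hq : ContDiffOn ℝ ∞ q V) (ha : ContDiffOn ℝ ∞ a V) :
    (normalForm (E := ℝ × ℂ) (N := ℝ × ℂ) R Prod.fst Prod.snd x q a).IsSolutionOn R
      {p | p.1 ≠ 0 ∧ p.2 ∈ V} := by
  have hS : IsOpen {p : ℝ × ℂ | p.1 ≠ 0 ∧ p.2 ∈ V} :=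
    (isOpen_ne_fun continuous_fst continuous_const).inter (hV.preimage continuous_snd)
  let N := normalForm (E := ℝ × ℂ) (N := ℝ × ℂ) R Prod.fst Prod.snd x q a
  let D : FlatData (ℝ × ℂ) := ⟨N.M, N.K, N.Γ41, N.Γ23, N.Γ12, N.Γ34, N.Ψ0, N.Ψ1, N.Ψ2, N.Ψ3⟩
  have h : D.IsSolutionOn R {p | p.1 ≠ 0 ∧ p.2 ∈ V} :=
    (normalFlat_isSolutionOn hV hx hq ha).congr hS (normalFlat_eqOn fun p hp => hp.1)
  exact (FlatData.isSolutionOn_toData hS).2 h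

lemma normalForm_hasSpinCoeffs {R : ℝ} {x q : ℂ → ℂ} {a : ℂ → ℝ} {S : Set (ℝ × ℂ)} :
    (normalForm (E := ℝ × ℂ) (N := ℝ × ℂ) R Prod.fst Prod.snd x q a).HasSpinCoeffs S
      (fun _ => 0) (fun p => (p.1 : ℂ)) (fun _ => 0) := by
  intro p _
  ext1 v
  refine Eq.trans (congrArg Neg.neg (normal_frameComb_apply x _ _ p v)) ?_
  refine Eq.trans ?_ (normal_frameComb_apply x _ _ p v).symm
  ring

/-! ### Pull-back of a gauge equivalence -/

section PullBack

variable {E : Type*} [NormedAddCommGroup E] [NormedSpace ℝ E]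
  {F : Type*} [NormedAddCommGroup F] [NormedSpace ℝ F]
  {N : Type*} [TopologicalSpace N] [ChartedSpace E N]

lemma pushForm_mfderiv {e : OpenPartialHomeomorph N F}
    (he : ContMDiffOn 𝓘(ℝ, E) 𝓘(ℝ, F) ∞ e e.source)
    (he' : ContMDiffOn 𝓘(ℝ, F) 𝓘(ℝ, E) ∞ e.symm e.target) (η : OneForm E N) {p : N}
    (hp : p ∈ e.source) (v : TangentSpace 𝓘(ℝ, E) p) :
    pushForm e η (e p) (mfderiv 𝓘(ℝ, E) 𝓘(ℝ, F) e p v) = η p v := by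
  have h1 := mfderiv_symm_mfderiv he he' hp v
  have h2 : ∀ (q : N) (w : E), q = p → (w = v) → η q w = η p v := by
    rintro q w rfl rfl; rfl
  exact h2 _ _ (e.left_inv hp) h1

lemma dC_comp {e : N → F} {f : F → ℂ} {p : N} (hf : DifferentiableAt ℝ f (e p))
    (he : MDifferentiableAt 𝓘(ℝ, E) 𝓘(ℝ, F) e p) (v : TangentSpace 𝓘(ℝ, E) p) :
    dC (E := E) (fun q => f (e q)) p v =
      dC (E := F) f (e p) (mfderiv 𝓘(ℝ, E) 𝓘(ℝ, F) e p v) := by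
  have hf' : MDifferentiableAt 𝓘(ℝ, F) 𝓘(ℝ, ℂ) f (e p) := hf.mdifferentiableAt
  have h := mfderiv_comp p hf' he
  exact DFunLike.congr_fun h v

set_option maxHeartbeats 800000 in
/-- If the expression of `D` in the coordinates `e` is gauge equivalent to a normal form, then so
is `D` itself. -/
theorem eqOn_of_pushData {R : ℝ} {e : OpenPartialHomeomorph N F}
    (he : ContMDiffOn 𝓘(ℝ, E) 𝓘(ℝ, F) ∞ e e.source)
    (he' : ContMDiffOn 𝓘(ℝ, F) 𝓘(ℝ, E) ∞ e.symm e.target) {D : Data E N} {S : Set F}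
    (hS : IsOpen S) {φ A ρ : F → ℝ} {z ζ : F → ℂ} {x q : ℂ → ℂ} {a : ℂ → ℝ}
    (hφ : ContDiffOn ℝ ∞ φ S) (hA : ContDiffOn ℝ ∞ A S) (hz : ContDiffOn ℝ ∞ z S)
    (hpos : ∀ y ∈ S, 0 < A y) (hρ : ContDiffOn ℝ ∞ ρ S) (hζ : ContDiffOn ℝ ∞ ζ S)
    (hρ0 : ∀ y ∈ S, ρ y ≠ 0)
    (h : ((pushData e D).toData.gauge φ A z).EqOn (normalForm R ρ ζ x q a) S) :
    (D.gauge (fun p => φ (e p)) (fun p => A (e p)) (fun p => z (e p))).EqOn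
      (normalForm R (fun p => ρ (e p)) (fun p => ζ (e p)) x q a) (e.source ∩ e ⁻¹' S) := by
  have hd : ∀ p ∈ e.source, MDifferentiableAt 𝓘(ℝ, E) 𝓘(ℝ, F) e p := fun p hp =>
    (he.contMDiffAt (e.open_source.mem_nhds hp)).mdifferentiableAt (by simp)
  have hpf := fun (η : OneForm E N) (p : N) (hp : p ∈ e.source) (v : TangentSpace 𝓘(ℝ, E) p) =>
    pushForm_mfderiv he he' η hp v
  have hζ' : ∀ p ∈ e.source ∩ e ⁻¹' S, ∀ v : TangentSpace 𝓘(ℝ, E) p,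
      dC (E := E) (fun q => ζ (e q)) p v =
        dC (E := F) ζ (e p) (mfderiv 𝓘(ℝ, E) 𝓘(ℝ, F) e p v) := fun p hp v =>
    dC_comp (differentiableAt_of_contDiffOn hS hζ _ hp.2) (hd p hp.1) v
  have hz' : ∀ p ∈ e.source ∩ e ⁻¹' S, ∀ v : TangentSpace 𝓘(ℝ, E) p,
      dC (E := E) (fun q => z (e q)) p v =
        dC (E := F) z (e p) (mfderiv 𝓘(ℝ, E) 𝓘(ℝ, F) e p v) := fun p hp v =>
    dC_comp (differentiableAt_of_contDiffOn hS hz _ hp.2) (hd p hp.1) v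
  have hreal : ∀ f : F → ℝ, ContDiffOn ℝ ∞ f S → ∀ p ∈ e.source ∩ e ⁻¹' S,
      ∀ v : TangentSpace 𝓘(ℝ, E) p, dR (E := E) (fun q => f (e q)) p v =
        dR (E := F) f (e p) (mfderiv 𝓘(ℝ, E) 𝓘(ℝ, F) e p v) := fun f hf p hp v =>
    dC_comp (f := fun y => (f y : ℂ)) (differentiableAt_of_contDiffOn hS
      (Complex.ofRealCLM.contDiff.comp_contDiffOn hf) _ hp.2) (hd p hp.1) v
  have hφ' := hreal φ hφ
  have hA' := hreal (fun y => Real.log (A y)) (hA.log fun y hy => (hpos y hy).ne')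
  have hρ' := hreal (fun y => (ρ y)⁻¹) (hρ.inv hρ0)
  have nM : ∀ p ∈ e.source ∩ e ⁻¹' S, ∀ v : TangentSpace 𝓘(ℝ, E) p,
      normalM (E := E) (fun p => ρ (e p)) (fun p => ζ (e p)) p v =
        normalM (E := F) ρ ζ (e p) (mfderiv 𝓘(ℝ, E) 𝓘(ℝ, F) e p v) := fun p hp v =>
    congrArg (fun t => (ρ (e p) : ℂ)⁻¹ * t) (hζ' p hp v)
  have nK : ∀ p ∈ e.source ∩ e ⁻¹' S, ∀ v : TangentSpace 𝓘(ℝ, E) p,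
      normalK (E := E) (fun p => ρ (e p)) (fun p => ζ (e p)) x p v =
        normalK (E := F) ρ ζ x (e p) (mfderiv 𝓘(ℝ, E) 𝓘(ℝ, F) e p v) := fun p hp v =>
    congrArg₂ (fun s t => -s + ((1 / 2 : ℂ) * ρ (e p)) * (x (ζ (e p)) * t +
      conj (x (ζ (e p))) * conj t)) (hρ' p hp v) (hζ' p hp v)
  have nF : ∀ (c₁ c₂ : F → ℂ), ∀ p ∈ e.source ∩ e ⁻¹' S, ∀ v : TangentSpace 𝓘(ℝ, E) p,
      frameComb (E := E) (normalM (fun p => ρ (e p)) (fun p => ζ (e p)))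
        (normalK (fun p => ρ (e p)) (fun p => ζ (e p)) x) (fun p => c₁ (e p)) (fun p => c₂ (e p))
        (fun _ => 0) p v =
      frameComb (E := F) (normalM ρ ζ) (normalK ρ ζ x) c₁ c₂ (fun _ => 0) (e p)
        (mfderiv 𝓘(ℝ, E) 𝓘(ℝ, F) e p v) := fun c₁ c₂ p hp v =>
    congrArg₂ (fun s t => c₁ (e p) * s + c₂ (e p) * conj s + 0 * t) (nM p hp v) (nK p hp v)
  have hΨ : ∀ (f : N → ℂ) (p : N), p ∈ e.source → f (e.symm (e p)) = f p := fun f p hp => by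
    rw [e.left_inv hp]
  constructor
  · intro p hp
    ext1 v
    refine Eq.trans ?_ (nM p hp v).symm
    refine Eq.trans ?_ (DFunLike.congr_fun (h.M (e p) hp.2) (mfderiv 𝓘(ℝ, E) 𝓘(ℝ, F) e p v))
    exact congrArg (fun t => Complex.exp (Complex.I * φ (e p)) * t) (hpf D.M p hp.1 v).symm
  · intro p hp
    ext1 v
    refine Eq.trans ?_ (nK p hp v).symm
    refine Eq.trans ?_ (DFunLike.congr_fun (h.K (e p) hp.2) (mfderiv 𝓘(ℝ, E) 𝓘(ℝ, F) e p v))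
    exact congrArg₂ (fun s t => (A (e p) : ℂ) * (s + z (e p) * conj t + conj (z (e p)) * t))
      (hpf D.K p hp.1 v).symm (hpf D.M p hp.1 v).symm
  · intro p hp
    ext1 v
    refine Eq.trans ?_ (congrArg Neg.neg (nF (fun _ => 0) (fun y => -(ρ y : ℂ)) p hp v)).symm
    refine Eq.trans ?_ (DFunLike.congr_fun (h.Γ41 (e p) hp.2) (mfderiv 𝓘(ℝ, E) 𝓘(ℝ, F) e p v))
    exact congrArg (fun t => ((A (e p) : ℂ)⁻¹ * Complex.exp (-(Complex.I * φ (e p)))) * t)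
      (hpf D.Γ41 p hp.1 v).symm
  · intro p hp
    ext1 v
    refine Eq.trans ?_ (congrArg Neg.neg (nF (fun y => normalΓ421 R x a (ρ y) (ζ y))
      (fun y => -(ρ y : ℂ) * q (ζ y)) p hp v)).symm
    refine Eq.trans ?_ (DFunLike.congr_fun (h.Γ23 (e p) hp.2) (mfderiv 𝓘(ℝ, E) 𝓘(ℝ, F) e p v))
    have e1 := (hpf D.Γ23 p hp.1 v).symm
    have e2 := (hpf D.Γ12 p hp.1 v).symm
    have e3 := (hpf D.Γ34 p hp.1 v).symm
    have e4 := (hpf D.Γ41 p hp.1 v).symm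
    have e5 := hz' p hp v
    change ((A (e p) : ℂ) * Complex.exp (Complex.I * φ (e p))) *
      (D.Γ23 p v + z (e p) * (D.Γ12 p v + D.Γ34 p v) - z (e p) ^ 2 * (-D.Γ41 p v) -
        dC (E := E) (fun q => z (e q)) p v) = _
    rw [e1, e2, e3, e4, e5]
    rfl
  · intro p hp
    ext1 v
    refine Eq.trans ?_ (nF (fun y => -(1 / 2) * x (ζ y) * (ρ y : ℂ) ^ 3)
      (fun y => (1 / 2) * conj (x (ζ y)) * (ρ y : ℂ) ^ 3) p hp v).symm
    refine Eq.trans ?_ (DFunLike.congr_fun (h.Γ12 (e p) hp.2) (mfderiv 𝓘(ℝ, E) 𝓘(ℝ, F) e p v))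
    have e2 := (hpf D.Γ12 p hp.1 v).symm
    have e4 := (hpf D.Γ41 p hp.1 v).symm
    have e5 := hφ' p hp v
    change D.Γ12 p v + z (e p) * D.Γ41 p v - conj (z (e p)) * conj (D.Γ41 p v) +
      Complex.I * dR (E := E) (fun q => φ (e q)) p v = _
    rw [e2, e4, e5]
    rfl
  · intro p hp
    ext1 v
    refine Eq.trans ?_ (nF (fun y => -(1 / 2) * x (ζ y) * (ρ y : ℂ) ^ 3)
      (fun y => -(1 / 2) * conj (x (ζ y)) * (ρ y : ℂ) ^ 3) p hp v).symm
    refine Eq.trans ?_ (DFunLike.congr_fun (h.Γ34 (e p) hp.2) (mfderiv 𝓘(ℝ, E) 𝓘(ℝ, F) e p v))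
    have e2 := (hpf D.Γ34 p hp.1 v).symm
    have e4 := (hpf D.Γ41 p hp.1 v).symm
    have e5 := hA' p hp v
    change D.Γ34 p v + z (e p) * D.Γ41 p v + conj (z (e p)) * conj (D.Γ41 p v) +
      dR (E := E) (fun q => Real.log (A (e q))) p v = _
    rw [e2, e4, e5]
    rfl
  · intro p hp
    exact (congrArg (fun t => (A (e p) : ℂ)⁻¹ ^ 2 * Complex.exp (-(2 * Complex.I * φ (e p))) * t)
      (hΨ D.Ψ0 p hp.1).symm).trans (h.Ψ0 (e p) hp.2)
  · intro p hp
    exact (congrArg₂ (fun s t => (A (e p) : ℂ)⁻¹ * Complex.exp (-(Complex.I * φ (e p))) *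
      (t - z (e p) * s)) (hΨ D.Ψ0 p hp.1).symm (hΨ D.Ψ1 p hp.1).symm).trans (h.Ψ1 (e p) hp.2)
  · intro p hp
    refine Eq.trans ?_ (h.Ψ2 (e p) hp.2)
    change D.Ψ2 p - 2 * z (e p) * D.Ψ1 p + z (e p) ^ 2 * D.Ψ0 p = _
    rw [← hΨ D.Ψ0 p hp.1, ← hΨ D.Ψ1 p hp.1, ← hΨ D.Ψ2 p hp.1]
    rfl
  · intro p hp
    refine Eq.trans ?_ (h.Ψ3 (e p) hp.2)
    change (A (e p) : ℂ) * Complex.exp (Complex.I * φ (e p)) *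
      (D.Ψ3 p - 3 * z (e p) * D.Ψ2 p + 3 * z (e p) ^ 2 * D.Ψ1 p - z (e p) ^ 3 * D.Ψ0 p) = _
    rw [← hΨ D.Ψ0 p hp.1, ← hΨ D.Ψ1 p hp.1, ← hΨ D.Ψ2 p hp.1, ← hΨ D.Ψ3 p hp.1]
    rfl

end PullBack

/-! ### Adapted coordinates and frame -/

section Adapted

/-- The first structure equation along the null direction forces `κ = 0` and `ρ` real when the
shear `σ` vanishes. -/
lemma FlatData.IsSolutionOn.spinCoeffs {F : Type*} [NormedAddCommGroup F] [NormedSpace ℝ F]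
    {R : ℝ} {D : FlatData F} {U : Set F} (h : D.IsSolutionOn R U) {p : F} (hp : p ∈ U)
    {ρ κ : ℂ} (hΓ : ∀ v, D.Γ41 p v = ρ * conj (D.M p v) + κ * D.K p v) :
    κ = 0 ∧ conj ρ = ρ := by
  obtain ⟨u, v, w, hdet⟩ := h.coframe p hp
  have e1 := h.first_L p hp u v
  have e2 := h.first_L p hp u w
  have e3 := h.first_L p hp v w
  simp only [hΓ, map_add, map_mul, Complex.conj_conj, h.real_K p hp] at e1 e2 e3
  rw [det_three] at hdet
  constructor
  · refine (mul_eq_zero.1 (?_ : κ * _ = 0)).resolve_right hdet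
    linear_combination conj (D.M p w) * e1 - conj (D.M p v) * e2 + conj (D.M p u) * e3
  · refine sub_eq_zero.1 ((mul_eq_zero.1 (?_ : (conj ρ - ρ) * _ = 0)).resolve_right hdet)
    linear_combination D.K p w * e1 - D.K p v * e2 + D.K p u * e3

/-- Near a point where the shear vanishes and the expansion `r` does not, `M` is the product of a
function and an exact form: since `r` is real, the first structure equation gives `M ∧ dM = 0`. The
factor is written as `ε exp g`, where `ε` is the sign of `r`, to serve as the boost and rotation. -/
theorem exists_exponential_factor {R : ℝ} {D : FlatData (ℝ × ℂ)} {U : Set (ℝ × ℂ)} (hU : IsOpen U)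
    (h0U : (0 : ℝ × ℂ) ∈ U) (h : D.IsSolutionOn R U) (hM0 : ∀ v, D.M 0 v = v.2)
    (hΓ : ∀ p ∈ U, ∃ ρ κ : ℂ, ρ ≠ 0 ∧ ∀ v, D.Γ41 p v = ρ * conj (D.M p v) + κ * D.K p v) :
    ∃ (W : Set (ℝ × ℂ)) (ε : ℝ) (r : ℝ × ℂ → ℝ) (ζ g : ℝ × ℂ → ℂ), IsOpen W ∧ 0 ∈ W ∧ W ⊆ U ∧
      ε * ε = 1 ∧ ContDiffOn ℝ ∞ r W ∧ ContDiffOn ℝ ∞ ζ W ∧ ContDiffOn ℝ ∞ g W ∧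
      (∀ p ∈ W, 0 < ε * r p) ∧ (∀ p ∈ W, ∀ v, D.Γ41 p v = r p * conj (D.M p v)) ∧
      ∀ p ∈ W, ∀ v, fderiv ℝ ζ p v = ε * Complex.exp (g p) * D.M p v := by
  have hΓ' : ∀ p ∈ U, ∃ ρ : ℂ, ρ ≠ 0 ∧ conj ρ = ρ ∧ ∀ v, D.Γ41 p v = ρ * conj (D.M p v) := by
    intro p hp
    obtain ⟨ρ, κ, h1, h2⟩ := hΓ p hp
    obtain ⟨h3, h4⟩ := h.spinCoeffs hp h2
    exact ⟨ρ, h1, h4, fun v => by rw [h2, h3, zero_mul, add_zero]⟩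
  obtain ⟨W₀, ζ, F, hW₀, h0W₀, hW₀U, hζ, hF, hζF⟩ :=
    exists_integrating_factor hU h0U h.smooth_M hM0 (by
      intro p hp u v w
      obtain ⟨ρ, -, h2, h3⟩ := hΓ' p hp
      rw [h.first_M p hp, h.first_M p hp, h.first_M p hp]
      simp only [h3, map_mul, h2, Complex.conj_conj]
      ring)
  -- the expansion is a smooth real function where `M (∂ / ∂ re ζ)` does not vanish
  let m : ℝ × ℂ → ℂ := fun p => D.M p (0, 1)
  have hm : ContDiffOn ℝ ∞ m W₀ := (h.smooth_M.mono hW₀U).clm_apply contDiffOn_const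
  let W₁ : Set (ℝ × ℂ) := W₀ ∩ m ⁻¹' {0}ᶜ
  have hW₁ : IsOpen W₁ := hm.continuousOn.isOpen_inter_preimage hW₀ isOpen_compl_singleton
  have h0W₁ : (0 : ℝ × ℂ) ∈ W₁ := ⟨h0W₀, by simp [m, hM0]⟩
  let r : ℝ × ℂ → ℝ := fun p => (D.Γ41 p (0, 1) / conj (m p)).re
  have hr : ContDiffOn ℝ ∞ r W₁ := by
    refine Complex.reCLM.contDiff.comp_contDiffOn (g := Complex.re) (contDiffOn_div ?_ ?_ ?_)
    · exact (h.smooth_Γ41.mono (Set.inter_subset_left.trans hW₀U)).clm_apply contDiffOn_const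
    · exact Complex.conjCLE.contDiff.comp_contDiffOn (hm.mono Set.inter_subset_left)
    · intro p hp
      simpa using hp.2
  have hr' : ∀ p ∈ W₁, r p ≠ 0 ∧ ∀ v, D.Γ41 p v = r p * conj (D.M p v) := by
    intro p hp
    obtain ⟨ρ, h1, h2, h3⟩ := hΓ' p (hW₀U hp.1)
    have hmp : m p ≠ 0 := hp.2
    have h4 : (r p : ℂ) = ρ := by
      have h5 : r p = ρ.re := by
        simp only [r, h3]
        rw [mul_div_assoc]
        change (ρ * (conj (m p) / conj (m p))).re = _
        rw [div_self (by simpa using hmp), mul_one]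
      rw [h5]
      exact Complex.conj_eq_iff_re.1 h2
    refine ⟨fun h0 => h1 ?_, fun v => by rw [h3, h4]⟩
    rw [← h4, h0, Complex.ofReal_zero]
  let ε : ℝ := SignType.sign (r 0)
  have hε : ε * ε = 1 := by
    rcases (hr' 0 h0W₁).1.lt_or_gt with h1 | h1 <;> simp [ε, h1]
  have hεr : 0 < ε * r 0 := by
    rcases (hr' 0 h0W₁).1.lt_or_gt with h1 | h1 <;> simp [ε, h1]
  have hε0 : (ε : ℂ) ≠ 0 := by
    intro h0
    rw [Complex.ofReal_eq_zero] at h0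
    simp [h0] at hε
  have hεC : (ε : ℂ) * ε = 1 := by exact_mod_cast hε
  -- dividing by the value at the origin places the factor in the domain of the logarithm
  let G : ℝ × ℂ → ℂ := fun p => F p / F 0
  have hG : ContDiffOn ℝ ∞ G W₁ := by
    simpa only [G, div_eq_mul_inv] using (hF.mono Set.inter_subset_left).mul contDiffOn_const
  let W : Set (ℝ × ℂ) := (W₁ ∩ (fun p => ε * r p) ⁻¹' Set.Ioi 0) ∩ (W₁ ∩ G ⁻¹' Complex.slitPlane)
  have hWW : W ⊆ W₁ := fun p hp => hp.1.1
  have hF0 : F 0 ≠ 0 := (hζF 0 h0W₀).1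
  refine ⟨W, ε, r, fun p => (ε / F 0) * ζ p, fun p => Complex.log (G p), ?_, ?_, ?_, hε,
    hr.mono hWW, ?_, ?_, fun p hp => hp.1.2, fun p hp => (hr' p (hWW hp)).2, ?_⟩
  · exact ((contDiffOn_const.mul hr).continuousOn.isOpen_inter_preimage hW₁ isOpen_Ioi).inter
      (hG.continuousOn.isOpen_inter_preimage hW₁ Complex.isOpen_slitPlane)
  · refine ⟨⟨h0W₁, hεr⟩, h0W₁, ?_⟩
    simp [G, hF0]
  · exact fun p hp => hW₀U hp.1.1.1
  · exact contDiffOn_const.mul (hζ.mono fun p hp => hp.1.1.1)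
  · intro p hp
    exact ((Complex.contDiffAt_log hp.2.2).restrict_scalars ℝ).comp_contDiffWithinAt p
      ((hG p hp.2.1).mono hWW)
  · intro p hp v
    have hG0 : G p ≠ 0 := div_ne_zero (hζF p hp.1.1.1).1 hF0
    have hd := differentiableAt_of_contDiffOn hW₀ hζ p hp.1.1.1
    rw [fderiv_const_mul hd, (hζF p hp.1.1.1).2, Complex.exp_log hG0]
    simp only [FunLike.coe_smul, Pi.smul_apply, smul_eq_mul, G]
    ring

end Adapted

section Adapted

lemma hasFDerivAt_exp_re {g : ℝ × ℂ → ℂ} {p : ℝ × ℂ} (hg : DifferentiableAt ℝ g p) (ε : ℝ) :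
    HasFDerivAt (fun p => ε * Real.exp (g p).re)
      ((ε * Real.exp (g p).re) • (Complex.reCLM ∘L fderiv ℝ g p)) p := by
  have h1 : HasFDerivAt (fun p => (g p).re) (Complex.reCLM ∘L fderiv ℝ g p) p :=
    Complex.reCLM.hasFDerivAt.comp p hg.hasFDerivAt
  have h2 := h1.exp.const_mul ε
  rwa [smul_smul] at h2

/-- If `dζ = ε exp g M`, then `(ε exp (re g), ζ)` is a coordinate system: by the first structure
equation, a vector killed by both differentials is also killed by `r K`, where `r` is the
expansion. -/
lemma exists_equiv_fderiv {R : ℝ} {D : FlatData (ℝ × ℂ)} {W : Set (ℝ × ℂ)} (hW : IsOpen W)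
    (h0W : (0 : ℝ × ℂ) ∈ W) (h : D.IsSolutionOn R W) (hM0 : ∀ v, D.M 0 v = v.2)
    {ε : ℝ} {r : ℝ × ℂ → ℝ} {ζ g : ℝ × ℂ → ℂ} (hε : ε ≠ 0) (hr : ∀ p ∈ W, r p ≠ 0)
    (hζ : ContDiffOn ℝ ∞ ζ W) (hg : ContDiffOn ℝ ∞ g W)
    (hΓ : ∀ p ∈ W, ∀ v, D.Γ41 p v = r p * conj (D.M p v))
    (hdζ : ∀ p ∈ W, ∀ v, fderiv ℝ ζ p v = ε * Complex.exp (g p) * D.M p v) :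
    ∃ e : (ℝ × ℂ) ≃L[ℝ] ℝ × ℂ,
      fderiv ℝ (fun p => ((ε * Real.exp (g p).re, ζ p) : ℝ × ℂ)) 0 = e := by
  have hgd := differentiableAt_of_contDiffOn hW hg 0 h0W
  have hζd := differentiableAt_of_contDiffOn hW hζ 0 h0W
  have hεC : (ε : ℂ) ≠ 0 := by exact_mod_cast hε
  set L := fderiv ℝ (fun p => ((ε * Real.exp (g p).re, ζ p) : ℝ × ℂ)) 0 with hL
  have hLv : ∀ v, L v = (ε * Real.exp (g 0).re * (fderiv ℝ g 0 v).re, fderiv ℝ ζ 0 v) := by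
    intro v
    rw [hL, ((hasFDerivAt_exp_re hgd ε).prodMk hζd.hasFDerivAt).fderiv]
    rfl
  -- `(dg + Γ₁₂ - r K) ∧ M = 0`
  have hdd : ∀ u v : ℝ × ℂ, fderiv ℝ g 0 u * v.2 - fderiv ℝ g 0 v * u.2 +
      (D.Γ12 0 u * v.2 - D.Γ12 0 v * u.2) + r 0 * (u.2 * D.K 0 v - v.2 * D.K 0 u) = 0 := by
    intro u v
    have h1 : (fun p => fderiv ℝ ζ p) =ᶠ[𝓝 0] fun p => (ε * Complex.exp (g p)) • D.M p := by
      filter_upwards [hW.mem_nhds h0W] with p hp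
      refine ContinuousLinearMap.ext fun v => ?_
      exact hdζ p hp v
    have h2 := flatExtd_fderiv (hζ.contDiffAt (hW.mem_nhds h0W)) u v
    have h3 : HasFDerivAt (fun p => (ε : ℂ) * Complex.exp (g p)) _ 0 :=
      hgd.hasFDerivAt.cexp.const_mul (ε : ℂ)
    rw [flatExtd_congr h1, flatExtd_smul h3.differentiableAt
      (differentiableAt_of_contDiffOn hW h.smooth_M 0 h0W), h3.fderiv, h.first_M 0 h0W] at h2
    simp only [hΓ 0 h0W, hM0, map_mul, Complex.conj_conj, Complex.conj_ofReal, FunLike.coe_smul,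
      Pi.smul_apply, smul_eq_mul] at h2
    refine (mul_eq_zero.1 (?_ : (ε * Complex.exp (g 0)) * _ = 0)).resolve_left
      (mul_ne_zero hεC (Complex.exp_ne_zero _))
    linear_combination h2
  have hK : D.K 0 (1, 0) ≠ 0 := by
    intro hk
    obtain ⟨u, v, w, hdet⟩ := h.coframe 0 h0W
    apply hdet
    have hk' : cρ (D.K 0) = 0 := hk
    simp only [det_three, hM0, clm_apply_eq (D.K 0), hk']
    ring
  have hinj : Function.Injective L := by
    refine (injective_iff_map_eq_zero L).2 fun v hv => ?_
    rw [hLv] at hv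
    have h1 : fderiv ℝ ζ 0 v = 0 := congrArg Prod.snd hv
    have h2 : (fderiv ℝ g 0 v).re = 0 := by
      have : ε * Real.exp (g 0).re * (fderiv ℝ g 0 v).re = 0 := congrArg Prod.fst hv
      exact (mul_eq_zero.1 this).resolve_left (mul_ne_zero hε (Real.exp_ne_zero _))
    have h3 : v.2 = 0 := by
      rw [hdζ 0 h0W, hM0] at h1
      exact (mul_eq_zero.1 h1).resolve_left (mul_ne_zero hεC (Complex.exp_ne_zero _))
    have h4 := hdd (0, 1) v
    rw [h3] at h4
    have h5 : (D.Γ12 0 v).re = 0 := by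
      have := congrArg Complex.re (h.conj_Γ12 0 h0W v)
      simp only [Complex.conj_re, Complex.neg_re] at this
      linarith
    have h6 : r 0 * (D.K 0 v).re = 0 := by
      have := congrArg Complex.re h4
      simp only [mul_zero, zero_sub, mul_one, zero_mul, sub_zero, one_mul, Complex.add_re,
        Complex.neg_re, Complex.re_ofReal_mul, Complex.zero_re] at this
      linarith
    have h7 : D.K 0 v = 0 := by
      rw [← Complex.conj_eq_iff_re.1 (h.real_K 0 h0W v),
        (mul_eq_zero.1 h6).resolve_left (hr 0 h0W), Complex.ofReal_zero]
    have h8 : v.1 = 0 := by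
      have h9 := clm_apply_eq (D.K 0) v
      rw [h7, h3, map_zero, zero_mul, zero_mul, add_zero, add_zero] at h9
      exact_mod_cast (mul_eq_zero.1 h9.symm).resolve_right hK
    exact Prod.ext h8 h3
  refine ⟨(LinearEquiv.ofInjectiveEndo (L : ℝ × ℂ →ₗ[ℝ] ℝ × ℂ) hinj).toContinuousLinearEquiv, ?_⟩
  refine ContinuousLinearMap.ext fun v => ?_
  rfl

end Adapted

section Adapted

lemma FlatData.IsSolutionOn.mono {R : ℝ} {F : Type*} [NormedAddCommGroup F]
    [NormedSpace ℝ F] {D : FlatData F} {U V : Set F}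
    (h : D.IsSolutionOn R U) (hVU : V ⊆ U) : D.IsSolutionOn R V :=
  ⟨h.smooth_M.mono hVU, h.smooth_K.mono hVU, h.smooth_Γ41.mono hVU, h.smooth_Γ23.mono hVU,
    h.smooth_Γ12.mono hVU, h.smooth_Γ34.mono hVU, fun p hp => h.real_K p (hVU hp),
    fun p hp => h.conj_Γ12 p (hVU hp), fun p hp => h.real_Γ34 p (hVU hp),
    fun p hp => h.coframe p (hVU hp), fun p hp => h.first_M p (hVU hp),
    fun p hp => h.first_L p (hVU hp), fun p hp => h.first_K p (hVU hp),
    fun p hp => h.second_23 p (hVU hp), fun p hp => h.second_14 p (hVU hp),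
    fun p hp => h.second_12_34 p (hVU hp)⟩

lemma pushForm_apply_fderiv {F G : Type*} [NormedAddCommGroup F] [NormedSpace ℝ F]
    [NormedAddCommGroup G] [NormedSpace ℝ G] (e : OpenPartialHomeomorph F G)
    (η : F → F →L[ℝ] ℂ) (y v : G) :
    pushForm (E := F) e η y v = η (e.symm y) (fderiv ℝ e.symm y v) := by
  rw [← mfderiv_eq_fderiv]
  rfl

lemma cζbar_add (A B : ℝ × ℂ →L[ℝ] ℂ) : cζbar (A + B) = cζbar A + cζbar B := by
  simp only [cζbar, FunLike.coe_add, Pi.add_apply]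
  ring

lemma cζbar_sub (A B : ℝ × ℂ →L[ℝ] ℂ) : cζbar (A - B) = cζbar A - cζbar B := by
  simp only [cζbar, FunLike.coe_sub, Pi.sub_apply]
  ring

lemma cζbar_smul (c : ℂ) (A : ℝ × ℂ →L[ℝ] ℂ) : cζbar (c • A) = c * cζbar A := by
  simp only [cζbar, FunLike.coe_smul, Pi.smul_apply, smul_eq_mul]
  ring

/-- Near a point where the shear vanishes and the expansion does not, there are coordinates and a
frame transformation which bring a solution to the normal form. The rotation and the boost make
`M = dζ / ρ` and `Γ₄₁ = dζ̄`; the null rotation removes the `dζ̄`-component of `Γ₁₂ + Γ₃₄`. -/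
theorem exists_gauge_eqOn_normalForm {R : ℝ} {D : FlatData (ℝ × ℂ)} {U : Set (ℝ × ℂ)}
    (hU : IsOpen U) (h0U : (0 : ℝ × ℂ) ∈ U) (h : D.IsSolutionOn R U) (hM0 : ∀ v, D.M 0 v = v.2)
    (hΓ : ∀ p ∈ U, ∃ ρ κ : ℂ, ρ ≠ 0 ∧ ∀ v, D.Γ41 p v = ρ * conj (D.M p v) + κ * D.K p v) :
    ∃ (Ψ : OpenPartialHomeomorph (ℝ × ℂ) (ℝ × ℂ)) (I : Set ℝ) (B : Set ℂ) (φ A : ℝ × ℂ → ℝ)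
      (z : ℝ × ℂ → ℂ) (x q : ℂ → ℂ) (α : ℂ → ℝ),
      0 ∈ Ψ.source ∧ Ψ.source ⊆ U ∧ ContDiffOn ℝ ∞ Ψ Ψ.source ∧
      ContDiffOn ℝ ∞ Ψ.symm Ψ.target ∧ IsOpen I ∧ IsOpen B ∧ I ×ˢ B ⊆ Ψ.target ∧ Ψ 0 ∈ I ×ˢ B ∧
      (∀ t ∈ I, t ≠ 0) ∧ ContDiffOn ℝ ∞ φ (I ×ˢ B) ∧ ContDiffOn ℝ ∞ A (I ×ˢ B) ∧
      ContDiffOn ℝ ∞ z (I ×ˢ B) ∧ (∀ y ∈ I ×ˢ B, 0 < A y) ∧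
      ContDiffOn ℝ ∞ x B ∧ ContDiffOn ℝ ∞ q B ∧ ContDiffOn ℝ ∞ α B ∧
      ((pushData Ψ D.toData).toData.gauge φ A z).EqOn
        (normalForm R Prod.fst Prod.snd x q α) (I ×ˢ B) := by
  obtain ⟨W, ε, r, ζ, g, hW, h0W, hWU, hε, hr, hζ, hg, hεr, h41, hdζ⟩ :=
    exists_exponential_factor hU h0U h hM0 hΓ
  have hε0 : ε ≠ 0 := fun h0 => by simp [h0] at hε
  have hr0 : ∀ p ∈ W, r p ≠ 0 := fun p hp h0 => by
    have := hεr p hp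
    simp [h0] at this
  have hDW := h.mono hWU
  obtain ⟨e, he⟩ := exists_equiv_fderiv hW h0W hDW hM0 hε0 hr0 hζ hg h41 hdζ
  have hf : ContDiffOn ℝ ∞ (fun p => ((ε * Real.exp (g p).re, ζ p) : ℝ × ℂ)) W :=
    (contDiffOn_const.mul (ContDiff.comp_contDiffOn (g := Complex.re)
      Complex.reCLM.contDiff hg).exp).prodMk hζ
  obtain ⟨Ψ, h0Ψ, hΨW, hΨf, hΨs⟩ := exists_openPartialHomeomorph_contDiffOn hW hf h0W e he
  have hΨ : ContDiffOn ℝ ∞ Ψ Ψ.source := (hf.mono hΨW).congr fun p _ => hΨf p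
  set T := Ψ.target with hT
  have hTo : IsOpen T := Ψ.open_target
  have hs : ∀ y ∈ T, Ψ.symm y ∈ W := fun y hy => hΨW (Ψ.map_target hy)
  have hy12 : ∀ y ∈ T, ((ε * Real.exp (g (Ψ.symm y)).re, ζ (Ψ.symm y)) : ℝ × ℂ) = y :=
    fun y hy => (hΨf _).symm.trans (Ψ.right_inv hy)
  have hsd : ∀ y ∈ T, DifferentiableAt ℝ Ψ.symm y := fun y hy =>
    differentiableAt_of_contDiffOn hTo hΨs y hy
  set D₁ := pushData Ψ D.toData with hD₁
  have hD₁s : D₁.IsSolutionOn R T := by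
    have h1 := isSolutionOn_pushData (E := ℝ × ℂ) (contMDiffOn_iff_contDiffOn.2 hΨ)
      (contMDiffOn_iff_contDiffOn.2 hΨs) hW ((FlatData.isSolutionOn_toData hW).2 hDW)
    exact h1.mono fun y hy => ⟨hy, hs y hy⟩
  have hM₁ : ∀ y ∈ T, ∀ v, D₁.M y v = v.2 / (ε * Complex.exp (g (Ψ.symm y))) := by
    intro y hy v
    have h1 : D₁.M y v = D.M (Ψ.symm y) (fderiv ℝ Ψ.symm y v) := pushForm_apply_fderiv Ψ D.M y v
    have h2 : (fun y => ζ (Ψ.symm y)) =ᶠ[𝓝 y] Prod.snd := by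
      filter_upwards [hTo.mem_nhds hy] with t ht using congrArg Prod.snd (hy12 t ht)
    have h3 := (((differentiableAt_of_contDiffOn hW hζ _ (hs y hy)).hasFDerivAt.comp y
      (hsd y hy).hasFDerivAt).congr_of_eventuallyEq h2.symm).unique
      (hasFDerivAt_snd (𝕜 := ℝ) (E := ℝ) (F := ℂ))
    have h4 := (hdζ _ (hs y hy) (fderiv ℝ Ψ.symm y v)).symm.trans (DFunLike.congr_fun h3 v)
    have hne : (ε * Complex.exp (g (Ψ.symm y)) : ℂ) ≠ 0 :=
      mul_ne_zero (by exact_mod_cast hε0) (Complex.exp_ne_zero _)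
    rw [h1, eq_div_iff hne, mul_comm]
    exact h4
  have h41₁ : ∀ y ∈ T, ∀ v, D₁.Γ41 y v = r (Ψ.symm y) * conj (D₁.M y v) := by
    intro y hy v
    have h1 : D₁.M y v = D.M (Ψ.symm y) (fderiv ℝ Ψ.symm y v) := pushForm_apply_fderiv Ψ D.M y v
    have h2 : D₁.Γ41 y v = D.Γ41 (Ψ.symm y) (fderiv ℝ Ψ.symm y v) :=
      pushForm_apply_fderiv Ψ D.Γ41 y v
    rw [h1, h2, h41 _ (hs y hy)]
  -- `φ` makes the factor of `M` real, `A` then normalizes `Γ₄₁`, and `z` solves the linear equation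
  -- for the vanishing of the `dζ̄`-component of the transformed `Γ₁₂ + Γ₃₄`
  let φ : ℝ × ℂ → ℝ := fun y => (g (Ψ.symm y)).im
  let A : ℝ × ℂ → ℝ := fun y => ε * r (Ψ.symm y) * Real.exp (-(g (Ψ.symm y)).re)
  let z : ℝ × ℂ → ℂ := fun y => -(cζbar (D₁.Γ12 y) + cζbar (D₁.Γ34 y) +
    Complex.I * cζbar (fderiv ℝ (fun q => (φ q : ℂ)) y) +
    cζbar (fderiv ℝ (fun q => (Real.log (A q) : ℂ)) y)) / (2 * cζbar (D₁.Γ41 y))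
  have hgs : ContDiffOn ℝ ∞ (fun y => g (Ψ.symm y)) T := hg.comp hΨs hs
  have hφ : ContDiffOn ℝ ∞ φ T :=
    ContDiff.comp_contDiffOn (g := Complex.im) Complex.imCLM.contDiff hgs
  have hA : ContDiffOn ℝ ∞ A T := by
    refine (contDiffOn_const.mul (hr.comp hΨs hs)).mul (ContDiffOn.exp (ContDiffOn.neg ?_))
    exact ContDiff.comp_contDiffOn (g := Complex.re) Complex.reCLM.contDiff hgs
  have hpos : ∀ y ∈ T, 0 < A y := fun y hy => mul_pos (hεr _ (hs y hy)) (Real.exp_pos _)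
  have hc41 : ∀ y ∈ T, cζbar (D₁.Γ41 y) ≠ 0 := by
    intro y hy
    have h1 : cζbar (D₁.Γ41 y) = r (Ψ.symm y) * conj (1 / (ε * Complex.exp (g (Ψ.symm y)))) := by
      rw [cζbar, h41₁ y hy, h41₁ y hy, hM₁ y hy, hM₁ y hy, map_div₀ conj Complex.I,
        Complex.conj_I, map_div₀, map_one]
      linear_combination -(1 / 2 * r (Ψ.symm y) / conj (ε * Complex.exp (g (Ψ.symm y)))) *
        Complex.I_mul_I
    rw [h1]
    refine mul_ne_zero (by exact_mod_cast hr0 _ (hs y hy)) ?_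
    rw [map_ne_zero]
    exact one_div_ne_zero (mul_ne_zero (by exact_mod_cast hε0) (Complex.exp_ne_zero _))
  have hz : ContDiffOn ℝ ∞ z T := by
    have hφ' : ContDiffOn ℝ ∞ (fun y => (φ y : ℂ)) T :=
      Complex.ofRealCLM.contDiff.comp_contDiffOn hφ
    have hL : ContDiffOn ℝ ∞ (fun y => (Real.log (A y) : ℂ)) T :=
      Complex.ofRealCLM.contDiff.comp_contDiffOn (hA.log fun y hy => (hpos y hy).ne')
    refine contDiffOn_div (ContDiffOn.neg ?_)
      (contDiffOn_const.mul (contDiffOn_cζbar hD₁s.smooth_Γ41))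
      (fun y hy => mul_ne_zero two_ne_zero (hc41 y hy))
    exact (((contDiffOn_cζbar hD₁s.smooth_Γ12).add (contDiffOn_cζbar hD₁s.smooth_Γ34)).add
      (contDiffOn_const.mul (contDiffOn_cζbar (hφ'.fderiv_of_isOpen hTo (by simp))))).add
      (contDiffOn_cζbar (hL.fderiv_of_isOpen hTo (by simp)))
  have hD₂ := FlatData.isSolutionOn_gauge hTo hD₁s hφ hA hz hpos
  have hexp : ∀ y : ℝ × ℂ, Complex.exp (g (Ψ.symm y)) =
      Complex.exp (g (Ψ.symm y)).re * Complex.exp (Complex.I * φ y) := by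
    intro y
    rw [← Complex.exp_add]
    congr 1
    rw [mul_comm Complex.I]
    exact (Complex.re_add_im _).symm
  have hy1 : ∀ y ∈ T, (y.1 : ℂ) = ε * Complex.exp (g (Ψ.symm y)).re := by
    intro y hy
    rw [← Complex.ofReal_exp, ← Complex.ofReal_mul]
    exact congrArg (fun y : ℝ × ℂ => (y.1 : ℂ)) (hy12 y hy).symm
  have hεC : (ε : ℂ) ≠ 0 := by exact_mod_cast hε0
  have hM₂ : ∀ y ∈ T, ∀ v, (D₁.gauge φ A z).M y v = v.2 / y.1 := by
    intro y hy v
    change Complex.exp (Complex.I * φ y) * D₁.M y v = _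
    rw [hM₁ y hy, hexp, hy1 y hy]
    have h1 := Complex.exp_ne_zero (Complex.I * φ y)
    have h2 := Complex.exp_ne_zero (g (Ψ.symm y)).re
    field_simp
  have h41₂ : ∀ y ∈ T, ∀ v, (D₁.gauge φ A z).Γ41 y v = conj v.2 := by
    intro y hy v
    change ((A y : ℂ)⁻¹ * Complex.exp (-(Complex.I * φ y))) * D₁.Γ41 y v = _
    have h3 : Complex.exp (-(Complex.I * φ y)) * conj (Complex.exp (Complex.I * φ y))⁻¹ = 1 := by
      rw [map_inv₀, ← Complex.exp_conj, map_mul, Complex.conj_I, Complex.conj_ofReal, neg_mul]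
      exact mul_inv_cancel₀ (Complex.exp_ne_zero _)
    have h4 : (A y : ℂ) = ε * r (Ψ.symm y) * (Complex.exp (g (Ψ.symm y)).re)⁻¹ := by
      simp only [A]
      push_cast
      rw [Complex.exp_neg]
    have h5 : conj (Complex.exp (g (Ψ.symm y)).re) = Complex.exp (g (Ψ.symm y)).re := by
      rw [← Complex.exp_conj, Complex.conj_ofReal]
    have h6 : (ε : ℂ) * ε = 1 := by exact_mod_cast hε
    have h7 : (r (Ψ.symm y) : ℂ) ≠ 0 := by exact_mod_cast hr0 _ (hs y hy)
    have h2 := Complex.exp_ne_zero (g (Ψ.symm y)).re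
    rw [h41₁ y hy, hM₁ y hy, hexp, h4, map_div₀, map_mul, map_mul, h5, Complex.conj_ofReal]
    rw [map_inv₀] at h3
    have h8 : Complex.exp (-(Complex.I * φ y)) = conj (Complex.exp (Complex.I * φ y)) :=
      (mul_inv_eq_one₀ (by simp [Complex.exp_ne_zero])).1 h3
    have h9 : conj (Complex.exp (Complex.I * φ y)) ≠ 0 := by simp [Complex.exp_ne_zero]
    rw [h8]
    field_simp
    linear_combination (-conj v.2) * h6
  have hω : ∀ y ∈ T, cζbar ((D₁.gauge φ A z).Γ12 y) + cζbar ((D₁.gauge φ A z).Γ34 y) = 0 := by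
    intro y hy
    simp only [FlatData.gauge, cζbar_add, cζbar_sub, cζbar_smul]
    have hzy : z y * (2 * cζbar (D₁.Γ41 y)) = -(cζbar (D₁.Γ12 y) + cζbar (D₁.Γ34 y) +
        Complex.I * cζbar (fderiv ℝ (fun q => (φ q : ℂ)) y) +
        cζbar (fderiv ℝ (fun q => (Real.log (A q) : ℂ)) y)) :=
      div_mul_cancel₀ _ (mul_ne_zero two_ne_zero (hc41 y hy))
    linear_combination hzy
  obtain ⟨I, B, hI, h0I, hB, h0B, hIB⟩ := mem_nhds_prod_iff'.1 (hTo.mem_nhds (Ψ.map_source h0Ψ))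
  obtain ⟨a, b, hab, hIoo⟩ := mem_nhds_iff_exists_Ioo_subset.1 (hI.mem_nhds h0I)
  have hbox : Set.Ioo a b ×ˢ B ⊆ T := (Set.prod_mono hIoo subset_rfl).trans hIB
  have hne : ∀ t ∈ Set.Ioo a b, t ≠ 0 := by
    intro t ht h0
    have h1 := hy12 (t, (Ψ 0).2) (hbox ⟨ht, h0B⟩)
    have h2 := congrArg Prod.fst h1
    simp only [h0, mul_eq_zero, Real.exp_ne_zero, or_false] at h2
    exact hε0 h2
  obtain ⟨x, q, α, hx, hq, hα, hEq⟩ := exists_eqOn_normalForm (hab.1.trans hab.2) hB hne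
    (hD₂.mono hbox) (fun y hy => hM₂ y (hbox hy)) (fun y hy => h41₂ y (hbox hy))
    (fun y hy => hω y (hbox hy))
  refine ⟨Ψ, Set.Ioo a b, B, φ, A, z, x, q, α, h0Ψ, hΨW.trans hWU, hΨ, hΨs, isOpen_Ioo, hB, hbox,
    ⟨hab, h0B⟩, hne, hφ.mono hbox, hA.mono hbox, hz.mono hbox, fun y hy => hpos y (hbox hy),
    hx, hq, hα, ?_⟩
  rw [FlatData.gauge_toData]
  exact hEq

end Adapted

/-! ### Gauge equivalence to the normal form on a manifold -/

section Global

/-- A coframe `(M, M̄, K)` at a point of a three-dimensional space gives a linear coordinate system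
in which `M` is the second projection. -/
lemma exists_linear_equiv {E : Type*} [NormedAddCommGroup E] [NormedSpace ℝ E]
    [FiniteDimensional ℝ E] (hE : Module.finrank ℝ E = 3) (m k : E →L[ℝ] ℂ)
    (hk : ∀ v, conj (k v) = k v)
    (h : ∃ u v w, Matrix.det !![m u, m v, m w; conj (m u), conj (m v), conj (m w);
      k u, k v, k w] ≠ 0) :
    ∃ L : E ≃L[ℝ] ℝ × ℂ, ∀ v, (L v).2 = m v := by
  obtain ⟨u, v, w, hdet⟩ := h
  rw [det_three] at hdet
  let j : E →ₗ[ℝ] ℝ × ℂ := ((Complex.reCLM ∘L k).prod m : E →L[ℝ] ℝ × ℂ)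
  let s : ℝ × ℝ × ℝ →ₗ[ℝ] E := (LinearMap.toSpanSingleton ℝ E u).coprod
    ((LinearMap.toSpanSingleton ℝ E v).coprod (LinearMap.toSpanSingleton ℝ E w))
  have h3 : Module.finrank ℝ (ℝ × ℂ) = 3 := by
    rw [Module.finrank_prod, Complex.finrank_real_complex, Module.finrank_self]
  have h3' : Module.finrank ℝ (ℝ × ℝ × ℝ) = 3 := by
    rw [Module.finrank_prod, Module.finrank_prod, Module.finrank_self]
  have hinj : Function.Injective (j ∘ₗ s) := by
    refine (injective_iff_map_eq_zero (j ∘ₗ s)).2 ?_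
    rintro ⟨a, b, c⟩ habc
    have hs : s (a, b, c) = a • u + (b • v + c • w) := rfl
    have e1 : (a : ℂ) * m u + b * m v + c * m w = 0 := by
      have : m (s (a, b, c)) = 0 := congrArg Prod.snd habc
      rw [hs, map_add, map_add, map_smul, map_smul, map_smul] at this
      simpa only [Complex.real_smul, add_assoc] using this
    have e2 := congrArg conj e1
    have e3 : (a : ℂ) * k u + b * k v + c * k w = 0 := by
      have h4 : (k (s (a, b, c))).re = 0 := congrArg Prod.fst habc
      have h5 := Complex.conj_eq_iff_re.1 (hk (s (a, b, c)))
      rw [h4, Complex.ofReal_zero, hs, map_add, map_add, map_smul, map_smul, map_smul] at h5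
      simpa only [Complex.real_smul, add_assoc] using h5.symm
    simp only [map_add, map_mul, Complex.conj_ofReal, map_zero] at e2
    have ha : (a : ℂ) = 0 := by
      refine (mul_eq_zero.1 (?_ : (a : ℂ) * _ = 0)).resolve_right hdet
      linear_combination (conj (m v) * k w - conj (m w) * k v) * e1 -
        (m v * k w - m w * k v) * e2 + (m v * conj (m w) - m w * conj (m v)) * e3
    have hb : (b : ℂ) = 0 := by
      refine (mul_eq_zero.1 (?_ : (b : ℂ) * _ = 0)).resolve_right hdet
      linear_combination -(conj (m u) * k w - conj (m w) * k u) * e1 +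
        (m u * k w - m w * k u) * e2 - (m u * conj (m w) - m w * conj (m u)) * e3
    have hc : (c : ℂ) = 0 := by
      refine (mul_eq_zero.1 (?_ : (c : ℂ) * _ = 0)).resolve_right hdet
      linear_combination (conj (m u) * k v - conj (m v) * k u) * e1 -
        (m u * k v - m v * k u) * e2 + (m u * conj (m v) - m v * conj (m u)) * e3
    rw [Complex.ofReal_eq_zero] at ha hb hc
    rw [ha, hb, hc]
    rfl
  have hsurj : Function.Surjective j :=
    Function.Surjective.of_comp (g := s)
      ((LinearMap.injective_iff_surjective_of_finrank_eq_finrank (h3'.trans h3.symm)).1 hinj)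
  have hj : Function.Bijective j :=
    ⟨(LinearMap.injective_iff_surjective_of_finrank_eq_finrank (hE.trans h3.symm)).2 hsurj, hsurj⟩
  exact ⟨(LinearEquiv.ofBijective j hj).toContinuousLinearEquiv, fun _ => rfl⟩

/-- The coordinates `L (v - v₀)`. -/
noncomputable def affineChart {E G : Type*} [NormedAddCommGroup E] [NormedSpace ℝ E]
    [NormedAddCommGroup G] [NormedSpace ℝ G] (L : E ≃L[ℝ] G) (v₀ : E) :
    OpenPartialHomeomorph E G :=
  ((Homeomorph.subRight v₀).trans L.toHomeomorph).toOpenPartialHomeomorph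

section

variable {E G : Type*} [NormedAddCommGroup E] [NormedSpace ℝ E]
  [NormedAddCommGroup G] [NormedSpace ℝ G] (L : E ≃L[ℝ] G) (v₀ : E)

lemma affineChart_apply (v : E) : affineChart L v₀ v = L (v - v₀) := rfl

lemma affineChart_symm_apply (w : G) : (affineChart L v₀).symm w = L.symm w + v₀ := rfl

lemma contDiff_affineChart : ContDiff ℝ ∞ (affineChart L v₀) :=
  L.contDiff.comp (contDiff_id.sub contDiff_const)

lemma contDiff_affineChart_symm : ContDiff ℝ ∞ (affineChart L v₀).symm :=
  L.symm.contDiff.add contDiff_const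

lemma fderiv_affineChart_symm (w v : G) :
    fderiv ℝ (affineChart L v₀).symm w v = L.symm v := by
  have h : HasFDerivAt (affineChart L v₀).symm (L.symm : G →L[ℝ] E) w :=
    L.symm.hasFDerivAt.add_const v₀
  rw [h.fderiv]
  rfl

end

/-- Every point of a solution with vanishing shear and non-vanishing expansion has a neighbourhood
where the solution is gauge equivalent to a normal form. -/
theorem exists_coordinates_gauge_normalForm {R : ℝ} {N : Type*} [TopologicalSpace N]
    [ChartedSpace (EuclideanSpace ℝ (Fin 3)) N] [IsManifold 𝓘(ℝ, EuclideanSpace ℝ (Fin 3)) ∞ N]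
    {D : Data (EuclideanSpace ℝ (Fin 3)) N} {σ ρ κ : N → ℂ} (h : D.IsSolutionOn R Set.univ)
    (hsc : D.HasSpinCoeffs Set.univ σ ρ κ) (hσ : ∀ p, σ p = 0) (hρ : ∀ p, ρ p ≠ 0) (p₀ : N) :
    ∃ e : OpenPartialHomeomorph N (ℝ × ℂ), p₀ ∈ e.source ∧
      ContMDiffOn 𝓘(ℝ, EuclideanSpace ℝ (Fin 3)) 𝓘(ℝ, ℝ × ℂ) ∞ e e.source ∧
      ContMDiffOn 𝓘(ℝ, ℝ × ℂ) 𝓘(ℝ, EuclideanSpace ℝ (Fin 3)) ∞ e.symm e.target ∧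
      (∀ p ∈ e.source, (e p).1 ≠ 0) ∧
      ∃ (φ A : N → ℝ) (z : N → ℂ),
        ContMDiffOn 𝓘(ℝ, EuclideanSpace ℝ (Fin 3)) 𝓘(ℝ, ℝ) ∞ φ e.source ∧
        ContMDiffOn 𝓘(ℝ, EuclideanSpace ℝ (Fin 3)) 𝓘(ℝ, ℝ) ∞ A e.source ∧
        ContMDiffOn 𝓘(ℝ, EuclideanSpace ℝ (Fin 3)) 𝓘(ℝ, ℂ) ∞ z e.source ∧
        (∀ p ∈ e.source, 0 < A p) ∧
        ∃ (V : Set ℂ) (x q : ℂ → ℂ) (a : ℂ → ℝ), IsOpen V ∧ (∀ p ∈ e.source, (e p).2 ∈ V) ∧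
          ContDiffOn ℝ ∞ x V ∧ ContDiffOn ℝ ∞ q V ∧ ContDiffOn ℝ ∞ a V ∧
          (D.gauge φ A z).EqOn
            (normalForm R (fun p => (e p).1) (fun p => (e p).2) x q a) e.source := by
  -- a chart in which `M = dζ` at the origin
  set c : OpenPartialHomeomorph N (EuclideanSpace ℝ (Fin 3)) := chartAt _ p₀ with hc
  have hcs : ContMDiffOn 𝓘(ℝ, EuclideanSpace ℝ (Fin 3)) 𝓘(ℝ, EuclideanSpace ℝ (Fin 3)) ∞ c
      c.source := contMDiffOn_chart
  have hcs' : ContMDiffOn 𝓘(ℝ, EuclideanSpace ℝ (Fin 3)) 𝓘(ℝ, EuclideanSpace ℝ (Fin 3)) ∞ c.symm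
      c.target := contMDiffOn_chart_symm
  have hp₀ : p₀ ∈ c.source := mem_chart_source _ p₀
  have hD₀ := isSolutionOn_pushData hcs hcs' isOpen_univ h
  set D₀ := pushData c D with hD₀def
  have hD₀' : D₀.IsSolutionOn R c.target := hD₀.mono fun y hy => ⟨hy, trivial⟩
  have hy₀ : c p₀ ∈ c.target := c.map_source hp₀
  obtain ⟨L, hL⟩ := exists_linear_equiv (by simp) (D₀.M (c p₀)) (D₀.K (c p₀))
    (hD₀'.real_K _ hy₀) (hD₀'.coframe _ hy₀)
  set l := affineChart L (c p₀) with hl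
  have hls := contDiff_affineChart L (c p₀)
  have hls' := contDiff_affineChart_symm L (c p₀)
  have hlm : ContMDiffOn 𝓘(ℝ, EuclideanSpace ℝ (Fin 3)) 𝓘(ℝ, ℝ × ℂ) ∞ l l.source :=
    hls.contMDiff.contMDiffOn
  have hlm' : ContMDiffOn 𝓘(ℝ, ℝ × ℂ) 𝓘(ℝ, EuclideanSpace ℝ (Fin 3)) ∞ l.symm l.target :=
    hls'.contMDiff.contMDiffOn
  have hD₁ := isSolutionOn_pushData hlm hlm' c.open_target
    ((FlatData.isSolutionOn_toData c.open_target).2 hD₀')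
  set D₁ := pushData l D₀.toData with hD₁def
  set U : Set (ℝ × ℂ) := l.target ∩ l.symm ⁻¹' c.target with hUdef
  have hU : IsOpen U := l.isOpen_inter_preimage_symm c.open_target
  have hl0 : l.symm 0 = c p₀ := by rw [affineChart_symm_apply, map_zero, zero_add]
  have hl0' : l (c p₀) = 0 := by rw [affineChart_apply, sub_self, map_zero]
  have h0U : (0 : ℝ × ℂ) ∈ U := ⟨trivial, by rwa [Set.mem_preimage, hl0]⟩
  have hM0 : ∀ v, D₁.M 0 v = v.2 := by
    intro v
    refine (pushForm_apply_fderiv l D₀.M 0 v).trans ?_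
    rw [hl0, fderiv_affineChart_symm, ← hL, L.apply_symm_apply]
  have hΓ : ∀ p ∈ U, ∃ ρ κ : ℂ, ρ ≠ 0 ∧
      ∀ v, D₁.Γ41 p v = ρ * conj (D₁.M p v) + κ * D₁.K p v := by
    intro p _
    refine ⟨ρ (c.symm (l.symm p)), κ (c.symm (l.symm p)), hρ _, fun v => ?_⟩
    have e1 := hsc (c.symm (l.symm p)) trivial
    have e2 : ∀ w : TangentSpace 𝓘(ℝ, EuclideanSpace ℝ (Fin 3)) (c.symm (l.symm p)),
        D.Γ41 (c.symm (l.symm p)) w = ρ (c.symm (l.symm p)) * conj (D.M (c.symm (l.symm p)) w) +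
          κ (c.symm (l.symm p)) * D.K (c.symm (l.symm p)) w := by
      intro w
      rw [e1]
      change σ (c.symm (l.symm p)) * D.M (c.symm (l.symm p)) w +
        ρ (c.symm (l.symm p)) * conj (D.M (c.symm (l.symm p)) w) +
          κ (c.symm (l.symm p)) * D.K (c.symm (l.symm p)) w = _
      rw [hσ, zero_mul, zero_add]
    exact e2 _
  obtain ⟨Ψ, I, B, φ, A, z, x, q, α, h0Ψ, -, hΨ, hΨ', hI, hB, hbox, h0box, hI0, hφ, hA, hz, hpos,
    hx, hq, hα, hEq⟩ := exists_gauge_eqOn_normalForm hU h0U hD₁ hM0 hΓ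
  have hbo : IsOpen (I ×ˢ B) := hI.prod hB
  -- the equality of the components is pulled back along the three changes of coordinates
  have hEq₂ := eqOn_of_pushData (E := ℝ × ℂ) (contMDiffOn_iff_contDiffOn.2 hΨ)
    (contMDiffOn_iff_contDiffOn.2 hΨ') hbo hφ hA hz hpos contDiff_fst.contDiffOn
    contDiff_snd.contDiffOn (fun y hy => hI0 _ hy.1) hEq
  set S₂ := Ψ.source ∩ Ψ ⁻¹' (I ×ˢ B) with hS₂
  have hS₂o : IsOpen S₂ := Ψ.isOpen_inter_preimage hbo
  have hΨ₂ : ContDiffOn ℝ ∞ Ψ S₂ := hΨ.mono Set.inter_subset_left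
  have hm₂ : Set.MapsTo Ψ S₂ (I ×ˢ B) := fun p hp => hp.2
  have hEq₁ := eqOn_of_pushData hlm hlm' hS₂o (hφ.comp hΨ₂ hm₂) (hA.comp hΨ₂ hm₂)
    (hz.comp hΨ₂ hm₂) (fun y hy => hpos _ hy.2) hΨ₂.fst hΨ₂.snd (fun y hy => hI0 _ hy.2.1) hEq₂
  set S₁ := l.source ∩ l ⁻¹' S₂ with hS₁
  have hS₁o : IsOpen S₁ := l.isOpen_inter_preimage hS₂o
  have hΨ₁ : ContDiffOn ℝ ∞ (fun p => Ψ (l p)) S₁ := hΨ₂.comp hls.contDiffOn fun p hp => hp.2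
  have hm₁ : Set.MapsTo (fun p => Ψ (l p)) S₁ (I ×ˢ B) := fun p hp => hp.2.2
  have hEq₀ := eqOn_of_pushData hcs hcs' hS₁o (hφ.comp hΨ₁ hm₁) (hA.comp hΨ₁ hm₁)
    (hz.comp hΨ₁ hm₁) (fun y hy => hpos _ hy.2.2) hΨ₁.fst hΨ₁.snd (fun y hy => hI0 _ hy.2.2.1) hEq₁
  set e : OpenPartialHomeomorph N (ℝ × ℂ) :=
    ((c.trans l).trans Ψ).trans (OpenPartialHomeomorph.ofSet (I ×ˢ B) hbo) with he
  have hep : ∀ p, e p = Ψ (l (c p)) := fun p => rfl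
  have hsrc : ∀ p ∈ e.source, p ∈ c.source ∧ l (c p) ∈ Ψ.source ∧ Ψ (l (c p)) ∈ I ×ˢ B := by
    intro p hp
    simp only [he, OpenPartialHomeomorph.trans_source, Set.mem_inter_iff, Set.mem_preimage] at hp
    exact ⟨hp.1.1.1, hp.1.2, hp.2⟩
  have htgt : ∀ y ∈ e.target, y ∈ Ψ.target ∧ l.symm (Ψ.symm y) ∈ c.target := by
    intro y hy
    simp only [he, OpenPartialHomeomorph.trans_target, Set.mem_inter_iff, Set.mem_preimage] at hy
    exact ⟨hy.2.1, hy.2.2.2⟩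
  have hes : ContMDiffOn 𝓘(ℝ, EuclideanSpace ℝ (Fin 3)) 𝓘(ℝ, ℝ × ℂ) ∞ e e.source :=
    (contMDiffOn_iff_contDiffOn.2 hΨ).comp (hls.contMDiff.comp_contMDiffOn
      (hcs.mono fun p hp => (hsrc p hp).1)) fun p hp => (hsrc p hp).2.1
  have hes' : ContMDiffOn 𝓘(ℝ, ℝ × ℂ) 𝓘(ℝ, EuclideanSpace ℝ (Fin 3)) ∞ e.symm e.target :=
    hcs'.comp (hls'.contMDiff.comp_contMDiffOn ((contMDiffOn_iff_contDiffOn.2 hΨ').mono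
      fun y hy => (htgt y hy).1)) fun y hy => (htgt y hy).2
  have heb : Set.MapsTo e e.source (I ×ˢ B) := fun p hp => (hsrc p hp).2.2
  have hsub : ∀ p ∈ e.source, p ∈ c.source ∩ c ⁻¹' S₁ := fun p hp =>
    ⟨(hsrc p hp).1, trivial, (hsrc p hp).2.1, (hsrc p hp).2.2⟩
  refine ⟨e, ?_, hes, hes', fun p hp => hI0 _ (heb hp).1, fun p => φ (e p), fun p => A (e p),
    fun p => z (e p), (contMDiffOn_iff_contDiffOn.2 hφ).comp hes heb,
    (contMDiffOn_iff_contDiffOn.2 hA).comp hes heb, (contMDiffOn_iff_contDiffOn.2 hz).comp hes heb,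
    fun p hp => hpos _ (heb hp), B, x, q, α, hB, fun p hp => (heb hp).2, hx, hq, hα, ?_⟩
  · simp only [he, OpenPartialHomeomorph.trans_source, Set.mem_inter_iff, Set.mem_preimage]
    refine ⟨⟨⟨hp₀, trivial⟩, ?_⟩, ?_⟩
    · change l (c p₀) ∈ Ψ.source
      rwa [hl0']
    · change Ψ (l (c p₀)) ∈ I ×ˢ B
      rwa [hl0']
  · exact ⟨fun p hp => hEq₀.M p (hsub p hp), fun p hp => hEq₀.K p (hsub p hp),
      fun p hp => hEq₀.Γ41 p (hsub p hp), fun p hp => hEq₀.Γ23 p (hsub p hp),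
      fun p hp => hEq₀.Γ12 p (hsub p hp), fun p hp => hEq₀.Γ34 p (hsub p hp),
      fun p hp => hEq₀.Ψ0 p (hsub p hp), fun p hp => hEq₀.Ψ1 p (hsub p hp),
      fun p hp => hEq₀.Ψ2 p (hsub p hp), fun p hp => hEq₀.Ψ3 p (hsub p hp)⟩

end Global

theorem proposition2 (R : ℝ) :
    -- every solution with `σ = 0`, `ρ ≠ 0` is, near every point, gauge equivalent to a normal form
    (∀ (N : Type*) [TopologicalSpace N] [ChartedSpace (EuclideanSpace ℝ (Fin 3)) N]
      [IsManifold 𝓘(ℝ, EuclideanSpace ℝ (Fin 3)) ∞ N]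
      (D : NullHypersurface.Data (EuclideanSpace ℝ (Fin 3)) N) (σ ρ κ : N → ℂ),
      D.IsSolutionOn R Set.univ →
      D.HasSpinCoeffs Set.univ σ ρ κ →
      (∀ p, σ p = 0) → (∀ p, ρ p ≠ 0) →
      ∀ p₀ : N,
        -- coordinates `(ρ, ζ, ζ̄)` on an open neighbourhood `e.source` of `p₀`
        ∃ e : OpenPartialHomeomorph N (ℝ × ℂ), p₀ ∈ e.source ∧
          ContMDiffOn 𝓘(ℝ, EuclideanSpace ℝ (Fin 3)) 𝓘(ℝ, ℝ × ℂ) ∞ e e.source ∧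
          ContMDiffOn 𝓘(ℝ, ℝ × ℂ) 𝓘(ℝ, EuclideanSpace ℝ (Fin 3)) ∞ e.symm e.target ∧
          (∀ p ∈ e.source, (e p).1 ≠ 0) ∧
        -- parameters of a frame transformation on `e.source`
        ∃ (φ A : N → ℝ) (z : N → ℂ),
          ContMDiffOn 𝓘(ℝ, EuclideanSpace ℝ (Fin 3)) 𝓘(ℝ, ℝ) ∞ φ e.source ∧
          ContMDiffOn 𝓘(ℝ, EuclideanSpace ℝ (Fin 3)) 𝓘(ℝ, ℝ) ∞ A e.source ∧
          ContMDiffOn 𝓘(ℝ, EuclideanSpace ℝ (Fin 3)) 𝓘(ℝ, ℂ) ∞ z e.source ∧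
          (∀ p ∈ e.source, 0 < A p) ∧
        -- functions of `(ζ, ζ̄)`
        ∃ (V : Set ℂ) (x q : ℂ → ℂ) (a : ℂ → ℝ), IsOpen V ∧ (∀ p ∈ e.source, (e p).2 ∈ V) ∧
          ContDiffOn ℝ ∞ x V ∧ ContDiffOn ℝ ∞ q V ∧ ContDiffOn ℝ ∞ a V ∧
          (D.gauge φ A z).EqOn
            (NullHypersurface.normalForm R (fun p => (e p).1) (fun p => (e p).2) x q a) e.source) ∧
    -- `x`, `q`, `a` are arbitrary: every normal form is a solution with `σ = 0` and `ρ ≠ 0`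
    (∀ (V : Set ℂ) (x q : ℂ → ℂ) (a : ℂ → ℝ), IsOpen V →
      ContDiffOn ℝ ∞ x V → ContDiffOn ℝ ∞ q V → ContDiffOn ℝ ∞ a V →
      (NullHypersurface.normalForm (E := ℝ × ℂ) (N := ℝ × ℂ) R
        Prod.fst Prod.snd x q a).IsSolutionOn R {p | p.1 ≠ 0 ∧ p.2 ∈ V} ∧
      (NullHypersurface.normalForm (E := ℝ × ℂ) (N := ℝ × ℂ) R
        Prod.fst Prod.snd x q a).HasSpinCoeffs {p | p.1 ≠ 0 ∧ p.2 ∈ V}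
          (fun _ => 0) (fun p => (p.1 : ℂ)) (fun _ => 0)) := by
  refine ⟨fun N _ _ _ D σ ρ κ h hsc hσ hρ p₀ =>
    exists_coordinates_gauge_normalForm h hsc hσ hρ p₀, fun V x q a hV hx hq ha => ?_⟩
  exact ⟨normalForm_isSolutionOn hV hx hq ha, normalForm_hasSpinCoeffs⟩
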